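/- We work over an algebraically closed field of characteristic zero; divisors are $\mathbb R$-divisors. \textbf{Conventions.} A contraction $f\colon X\to Z$ is a surjective proper morphism of normal varieties with $f_*\mathcal O_X=\mathcal O_Z$. A prime divisor of $X$ is horizontal if it dominates $Z$, and vertical otherwise. For a reduced divisor $\Sigma$ on $Z$, $f^{-1}(\Sigma)$ denotes its preimage as a reduced divisor. A pair $(X,B)$, with $K_X+B$ $\mathbb R$-Cartier, is log canonical if, writing $K_Y+B_Y=\pi^*(K_X+B)$ with $\pi_*K_Y=K_X$, all coefficients of $B_Y$ are $\le 1$ for every proper birational morphism $\pi\colon Y\to X$ from a normal variety. The pair $(X/Z,B)$ is generically log canonical (GLC) if $f\colon X\to Z$ is proper and surjective, $K_X+B$ is $\mathbb R$-Cartier, and $(X,B)$ is log canonical over the generic point of $Z$. Its discriminant is $B_Z=\sum_P(1-\gamma_P)P$, where $P$ runs over the prime divisors of $Z$ and \[\gamma_P=\sup\{t\in\mathbb R\mid (X,B+tf^*P)\text{ is log canonical over the generic point of }P\}.\] If $f$ is an equidimensional contraction and $K_Z+B_Z$ is $\mathbb R$-Cartier, the moduli part of $(X/Z,B)$ is $M_X=K_X+B-f^*(K_Z+B_Z)$;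 it depends on the choice of $K_X$ and $K_Z$, and is well defined up to linear equivalence. The GLC pair $(X/Z,B)$ satisfies Property $(*)$ if $f$ is a projective contraction and there is a reduced divisor $\Sigma_Z$ on $Z$ such that (i) $(Z,\Sigma_Z)$ is log smooth and the vertical part of $B$ equals $f^{-1}(\Sigma_Z)$; and (ii) for every closed point $z\in Z$ and every reduced divisor $\Sigma\ge\Sigma_Z$ such that $(Z,\Sigma)$ is log smooth around $z$, the pair $(X,B+f^*(\Sigma-\Sigma_Z))$ is log canonical around $f^{-1}(z)$. A foliation $\mathcal F$ on a normal variety $X$ is given by a saturated coherent subsheaf $T_{\mathcal F}\subset T_X$ closed under Lie bracket; $K_{\mathcal F}$ is a divisor with $\mathcal O_X(K_{\mathcal F})\cong(\det T_{\mathcal F})^*$; and $(\mathcal F,\Delta)$ is a foliated pair if $K_{\mathcal F}+\Delta$ is $\mathbb R$-Cartier. The foliation induced by $f\colon X\to Z$ has $T_{\mathcal F}=\ker(T_X\to f^*T_Z)$. A divisor is $\mathcal F$-invariant if sections of $T_{\mathcal F}$ preserve the ideal sheaf of each of its components. The foliated pair $(\mathcal F,\Delta)$ satisfies Property $(*)$,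 by means of $f$ and with associated divisor $G$, if $f\colon X\to Z$ is a projective contraction inducing $\mathcal F$ and $G\ge0$ is an $\mathcal F$-invariant divisor on $X$ such that $(X/Z,\Delta+G)$ satisfies Property $(*)$. \textbf{Proposition.} Let $(\mathcal F,\Delta)$ be a foliated pair on a normal variety $X$ which satisfies Property $(*)$, let $f\colon X\to Z$ be the induced contraction and let $G\ge0$ be an associated $\mathcal F$-invariant divisor. Assume that every component of $\Delta$ is horizontal with respect to $f$ and that $f$ is equidimensional, i.e. every irreducible component of every fibre has dimension $\dim X-\dim Z$. Then the discriminant $B_Z$ of $(X/Z,\Delta+G)$ is a well-defined $\mathbb R$-divisor, $K_Z+B_Z$ is $\mathbb R$-Cartier, and the moduli part $M_X=K_X+\Delta+G-f^*(K_Z+B_Z)$ satisfies \begin{enumerate} \item $K_{\mathcal F}+\Delta\sim M_X$ (linear equivalence); and \item $K_{\mathcal F}+\Delta\sim_{f,\mathbb R}K_X+\Delta+G$, i.e. there is an $\mathbb R$-Cartier divisor $H$ on $Z$ such that $K_{\mathcal F}+\Delta\sim_{\mathbb R}K_X+\Delta+G+f^*H$. \end{enumerate} These hold for every choice of the canonical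 divisors $K_{\mathcal F},K_X,K_Z$. -/

import Mathlib

open AlgebraicGeometry CategoryTheory

universe u

noncomputable section

/-- A normal variety over `k`: an integral normal scheme, separated and of finite type over `k`. -/
structure NormalVariety (k : Type u) [Field k] where
  X : Scheme.{u}
  str : X ⟶ Spec (CommRingCat.of k)
  [isIntegral : IsIntegral X]
  [isSeparated : IsSeparated str]
  [locallyOfFiniteType : LocallyOfFiniteType str]
  [quasiCompact : QuasiCompact str]
  normal : ∀ x : X, IsIntegrallyClosed (X.presheaf.stalk x)

namespace NormalVariety

attribute [instance] isIntegral isSeparated locallyOfFiniteType quasiCompact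

variable {k : Type u} [Field k]

instance (X : NormalVariety k) : IsLocallyNoetherian X.X :=
  LocallyOfFiniteType.isLocallyNoetherian X.str

/-- The function field. -/
abbrev K (X : NormalVariety k) : Type u := X.X.functionField

/-- The inclusion of the ground field in the function field. -/
def constants (X : NormalVariety k) : k →+* X.K :=
  ((Scheme.ΓSpecIso (CommRingCat.of k)).inv ≫ X.str.appTop ≫
    X.X.presheaf.germ ⊤ (genericPoint X.X) trivial).hom

instance (X : NormalVariety k) : Algebra k X.K := X.constants.toAlgebra

/-- Rational vector fields: `k`-derivations of the function field. -/
abbrev Der (X : NormalVariety k) : Type u := Derivation k X.K X.K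

/-- The rational function `φ` lies in the local ring at `x`. -/
def RegularAt (X : NormalVariety k) (x : X.X) (φ : X.K) : Prop :=
  ∃ a : X.X.presheaf.stalk x, algebraMap (X.X.presheaf.stalk x) X.K a = φ

/-- The rational function `φ` lies in the maximal ideal of the local ring at `x`. -/
def VanishesAt (X : NormalVariety k) (x : X.X) (φ : X.K) : Prop :=
  ∃ a ∈ IsLocalRing.maximalIdeal (X.X.presheaf.stalk x),
    algebraMap (X.X.presheaf.stalk x) X.K a = φ

/-- The rational function `φ` is a unit of the local ring at `x`. -/
def UnitAt (X : NormalVariety k) (x : X.X) (φ : X.K) : Prop :=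
  ∃ a : X.X.presheaf.stalk x, IsUnit a ∧ algebraMap (X.X.presheaf.stalk x) X.K a = φ

/-- The rational vector field `D` is regular at `x`, i.e. lies in the stalk of `T_X` at `x`:
it maps the local ring at `x` to itself. -/
def DerRegularAt (X : NormalVariety k) (x : X.X) (D : X.Der) : Prop :=
  ∀ φ : X.K, X.RegularAt x φ → X.RegularAt x (D φ)

/-! ### Divisors -/

/-- Prime divisors, given by their generic points: the points of codimension one. -/
abbrev PrimeDivisor (X : NormalVariety k) : Type u := {x : X.X // Order.coheight x = 1}

/-- `ℝ`-divisors. The value `D P` is the coefficient of `D` along `P`. -/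
abbrev RDivisor (X : NormalVariety k) : Type u := X.PrimeDivisor →₀ ℝ

/-- The order of vanishing of a rational function along a prime divisor. -/
def ord (X : NormalVariety k) (φ : X.K) (P : X.PrimeDivisor) : ℤ := Scheme.ord φ P.1

/-- All coefficients are `0` or `1`. -/
def IsReducedDivisor {X : NormalVariety k} (D : X.RDivisor) : Prop := ∀ P, D P = 0 ∨ D P = 1

/-- In a neighbourhood of `x` we have `D = ∑ r i • div (φ i)`
(a divisor near `x` is given by its coefficients along the prime divisors through `x`). -/
def IsLocalEquation {X : NormalVariety k} (D : X.RDivisor) (x : X.X)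
    {m : ℕ} (r : Fin m → ℝ) (φ : Fin m → X.K) : Prop :=
  (∀ i, φ i ≠ 0) ∧ ∀ P : X.PrimeDivisor, P.1 ⤳ x → D P = ∑ i, r i * (X.ord (φ i) P : ℝ)

/-- `D` is `ℝ`-Cartier on the open set `U`. -/
def IsRCartierOn {X : NormalVariety k} (U : X.X.Opens) (D : X.RDivisor) : Prop :=
  ∀ x ∈ U, ∃ (m : ℕ) (r : Fin m → ℝ) (φ : Fin m → X.K), IsLocalEquation D x r φ

/-- `D` is `ℝ`-Cartier. -/
def IsRCartier {X : NormalVariety k} (D : X.RDivisor) : Prop := IsRCartierOn ⊤ D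

/-- Linear equivalence `D ∼ D'`. -/
def LinEquiv {X : NormalVariety k} (D D' : X.RDivisor) : Prop :=
  ∃ φ : X.K, φ ≠ 0 ∧ ∀ P, D P - D' P = X.ord φ P

/-- `ℝ`-linear equivalence `D ∼_ℝ D'`. -/
def RLinEquiv {X : NormalVariety k} (D D' : X.RDivisor) : Prop :=
  ∃ (m : ℕ) (r : Fin m → ℝ) (φ : Fin m → X.K), (∀ i, φ i ≠ 0) ∧
    ∀ P, D P - D' P = ∑ i, r i * (X.ord (φ i) P : ℝ)

/-! ### Dominant morphisms and pullback -/

/-- Dominant morphisms of varieties over `k`. -/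
structure DominantMorphism (X Z : NormalVariety k) where
  hom : X.X ⟶ Z.X
  comm : hom ≫ Z.str = X.str
  [isDominant : IsDominant hom]

attribute [instance] DominantMorphism.isDominant

namespace DominantMorphism

variable {X Z : NormalVariety k}

lemma map_genericPoint (f : DominantMorphism X Z) :
    f.hom (genericPoint X.X) = genericPoint Z.X := by
  apply ((genericPoint_spec Z.X).eq _).symm
  have h := (genericPoint_spec X.X).image f.hom.continuous
  rwa [Set.image_univ, f.hom.denseRange.closure_range] at h

/-- The pullback `f^*` of rational functions, `K(Z) → K(X)`. -/
def pullback (f : DominantMorphism X Z) : Z.K →+* X.K :=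
  (Z.X.presheaf.stalkSpecializes (specializes_of_eq f.map_genericPoint) ≫
    f.hom.stalkMap (genericPoint X.X)).hom

/-- `c` is the coefficient of `f^* D` along the prime divisor `E` (for `D` an `ℝ`-Cartier divisor
near the image of the generic point of `E`): if `D = ∑ r i • div (φ i)` near that image then
`f^* D = ∑ r i • div (f^* φ i)` near the generic point of `E`. -/
def IsPullbackCoeff (f : DominantMorphism X Z) (D : Z.RDivisor) (E : X.PrimeDivisor) (c : ℝ) :
    Prop :=
  ∃ (m : ℕ) (r : Fin m → ℝ) (φ : Fin m → Z.K), IsLocalEquation D (f.hom E.1) r φ ∧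
    c = ∑ i, r i * (X.ord (f.pullback (φ i)) E : ℝ)

/-- `D` is `ℝ`-Cartier on `V` and the divisor `N` coincides with `f^* D` over `V`. -/
def IsPullbackOver (f : DominantMorphism X Z) (V : Z.X.Opens) (D : Z.RDivisor) (N : X.RDivisor) :
    Prop :=
  IsRCartierOn V D ∧ ∀ E : X.PrimeDivisor, f.hom E.1 ∈ V → f.IsPullbackCoeff D E (N E)

/-- `D` is `ℝ`-Cartier and `N = f^* D`. -/
def IsPullback (f : DominantMorphism X Z) (D : Z.RDivisor) (N : X.RDivisor) : Prop :=
  f.IsPullbackOver ⊤ D N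

/-- `D ∼_{f,ℝ} D'`: there is an `ℝ`-Cartier divisor `H` on `Z` with `D ∼_ℝ D' + f^* H`. -/
def RLinEquivOver (f : DominantMorphism X Z) (D D' : X.RDivisor) : Prop :=
  ∃ (H : Z.RDivisor) (N : X.RDivisor), f.IsPullback H N ∧ RLinEquiv D (D' + N)

/-- The prime divisor `E` is horizontal: it dominates `Z`. -/
def IsHorizontal (f : DominantMorphism X Z) (E : X.PrimeDivisor) : Prop :=
  f.hom E.1 = genericPoint Z.X

/-- A contraction: a surjective proper morphism with `f_* 𝒪_X = 𝒪_Z`. -/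
structure IsContraction (f : DominantMorphism X Z) : Prop where
  proper : IsProper f.hom
  surjective : Function.Surjective f.hom
  bijective_app : ∀ U : Z.X.Opens, Function.Bijective (f.hom.app U)

/-- Projectivity: `f` is proper and there is an `f`-ample Cartier divisor `C`, given by local
equations `g x` at the points `x`. Relative ampleness: for every affine open `V` of `Z`
the open set `f⁻¹ V` is covered by affine non-vanishing loci `W` of sections `s` of positive
multiples `𝒪(m C)` over `f⁻¹ V`. -/
def IsProjective (f : DominantMorphism X Z) : Prop :=
  IsProper f.hom ∧ ∃ g : X.X → X.K, (∀ x, g x ≠ 0) ∧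
    (∀ x, ∃ U : X.X.Opens, x ∈ U ∧ ∀ y ∈ U, X.UnitAt y (g x / g y)) ∧
    ∀ V : Z.X.Opens, IsAffineOpen V → ∀ x ∈ f.hom ⁻¹ᵁ V,
      ∃ (m : ℕ) (s : X.K) (W : X.X.Opens), 1 ≤ m ∧ IsAffineOpen W ∧ x ∈ W ∧ W ≤ f.hom ⁻¹ᵁ V ∧
        ∀ y ∈ f.hom ⁻¹ᵁ V, X.RegularAt y (s * g y ^ m) ∧ (y ∈ W ↔ X.UnitAt y (s * g y ^ m))

/-- Equidimensionality: every irreducible component of every fibre has dimension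
`dim X - dim Z`. -/
def IsEquidimensional (f : DominantMorphism X Z) : Prop :=
  ∀ z : Z.X, ∀ C ∈ irreducibleComponents ↥(f.hom ⁻¹' {z}),
    topologicalKrullDim ↥C + topologicalKrullDim Z.X = topologicalKrullDim X.X

/-- A proper birational morphism. -/
def IsProperBirational (f : DominantMorphism X Z) : Prop :=
  IsProper f.hom ∧ Function.Bijective f.pullback

/-- For `f` proper birational: `f_* D = D'`. -/
def IsPushforward (f : DominantMorphism X Z) (D : X.RDivisor) (D' : Z.RDivisor) : Prop :=
  ∀ (E : X.PrimeDivisor) (P : Z.PrimeDivisor), f.hom E.1 = P.1 → D E = D' P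

end DominantMorphism

/-! ### Canonical divisors -/

/-- Let `T` be a saturated subsheaf of `T_X`, with generic stalk `V`, of rank `r`, and stalks `T x`.
The divisor `D` satisfies `𝒪_X(D) ≅ (det T)^*`, that is, `D` is the divisor of a nonzero rational
section `η` of the reflexive rank one sheaf `(det T)^*`. Such an `η` is an alternating `r`-form
on `V`, and its order along `P` is the least order along `P` of the functions `η(∂₁, …, ∂ᵣ)`, where
the `∂ᵢ` are in the stalk of `T` at `P`. -/
def IsDetDualDivisor (X : NormalVariety k) (V : Submodule X.K X.Der) (T : X.X → Set X.Der)
    (D : X.RDivisor) : Prop :=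
  ∃ η : V [⋀^Fin (Module.finrank X.K V)]→ₗ[X.K] X.K, η ≠ 0 ∧
    ∀ P : X.PrimeDivisor, ∃ n : ℤ, D P = n ∧
      IsLeast {j : ℤ | ∃ v : Fin (Module.finrank X.K V) → V,
        (∀ i, (v i : X.Der) ∈ T P.1) ∧ η v ≠ 0 ∧ j = X.ord (η v) P} n

/-- `D` is a canonical divisor `K_X`: the divisor of a nonzero rational top differential form,
regarded as an alternating form on rational vector fields. -/
def IsCanonical {X : NormalVariety k} (D : X.RDivisor) : Prop :=
  X.IsDetDualDivisor ⊤ (fun x => {D | X.DerRegularAt x D}) D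

/-! ### Log canonical pairs -/

/-- The pair `(U, B|_U)` is log canonical, for `U ⊆ X` open: `K_X + B` is `ℝ`-Cartier on `U` and
for every proper birational morphism `π : Y → X` from a normal variety, writing
`K_Y + B_Y = π^*(K_X + B)` with `π_* K_Y = K_X`, the coefficient of `B_Y` along every prime
divisor `E` on `Y` with centre meeting `U` is at most one. -/
def LcOn {X : NormalVariety k} (B : X.RDivisor) (U : X.X.Opens) : Prop :=
  ∃ KX : X.RDivisor, IsCanonical KX ∧ IsRCartierOn U (KX + B) ∧
    ∀ (Y : NormalVariety k) (π : DominantMorphism Y X), π.IsProperBirational →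
      ∀ KY : Y.RDivisor, IsCanonical KY → π.IsPushforward KY KX →
        ∀ (E : Y.PrimeDivisor) (c : ℝ), π.hom E.1 ∈ U → π.IsPullbackCoeff (KX + B) E c →
          c - KY E ≤ 1

/-- `(X, B)` is a log pair: `K_X + B` is `ℝ`-Cartier. -/
def IsLogPair {X : NormalVariety k} (B : X.RDivisor) : Prop :=
  ∃ KX : X.RDivisor, IsCanonical KX ∧ IsRCartier (KX + B)

namespace DominantMorphism

variable {X Z : NormalVariety k}

/-- `(X/Z, B)` is a generically log canonical pair. -/
structure IsGLC (f : DominantMorphism X Z) (B : X.RDivisor) : Prop where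
  proper : IsProper f.hom
  surjective : Function.Surjective f.hom
  logPair : IsLogPair B
  lc : ∃ V : Z.X.Opens, genericPoint Z.X ∈ V ∧ LcOn B (f.hom ⁻¹ᵁ V)

/-- `(X, B + t f^* P)` is log canonical over the generic point of `P`, i.e. over a neighbourhood
`V` of that point (on which `P` is `ℝ`-Cartier). -/
def LcOverGeneric (f : DominantMorphism X Z) (B : X.RDivisor) (P : Z.PrimeDivisor) (t : ℝ) :
    Prop :=
  ∃ (V : Z.X.Opens) (N : X.RDivisor), P.1 ∈ V ∧ f.IsPullbackOver V (Finsupp.single P 1) N ∧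
    LcOn (B + t • N) (f.hom ⁻¹ᵁ V)

/-- `BZ` is the discriminant of `(X/Z, B)`: its coefficient along `P` is `1 - γ_P`, with `γ_P`
the supremum (a real number) of all `t` such that `(X, B + t f^* P)` is log canonical over the
generic point of `P`. -/
def IsDiscriminant (f : DominantMorphism X Z) (B : X.RDivisor) (BZ : Z.RDivisor) : Prop :=
  ∀ P : Z.PrimeDivisor, (∃ t, f.LcOverGeneric B P t) ∧
    IsLUB {t : ℝ | f.LcOverGeneric B P t} (1 - BZ P)

/-- For an equidimensional contraction `f`: `M` is a moduli part of `(X/Z, B)`, that is,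
`K_Z + B_Z` is `ℝ`-Cartier, where `B_Z` is the discriminant, and
`M = K_X + B - f^*(K_Z + B_Z)` for some choice of canonical divisors. -/
def IsModuliPart (f : DominantMorphism X Z) (B M : X.RDivisor) : Prop :=
  ∃ (KX : X.RDivisor) (KZ BZ : Z.RDivisor) (N : X.RDivisor),
    IsCanonical KX ∧ IsCanonical KZ ∧ f.IsDiscriminant B BZ ∧ f.IsPullback (KZ + BZ) N ∧
    M = KX + B - N

end DominantMorphism

/-! ### Property (*) for pairs -/

/-- At `z` the components of `S` are part of a regular system of parameters: there are
`dim 𝒪_{Z,z}` elements generating the maximal ideal of `𝒪_{Z,z}` such that every component of `S`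
through `z` is defined by one of them. -/
def SNCAt {Z : NormalVariety k} (S : Z.RDivisor) (z : Z.X) : Prop :=
  ∃ (n : ℕ) (t : Fin n → Z.X.presheaf.stalk z),
    (n : WithBot ℕ∞) = ringKrullDim (Z.X.presheaf.stalk z) ∧
    Ideal.span (Set.range t) = IsLocalRing.maximalIdeal (Z.X.presheaf.stalk z) ∧
    ∀ P : Z.PrimeDivisor, S P ≠ 0 → ∀ h : P.1 ⤳ z, ∃ i,
      (IsLocalRing.maximalIdeal (Z.X.presheaf.stalk P.1)).comap
        (Z.X.presheaf.stalkSpecializes h).hom = Ideal.span {t i}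

/-- `(Z, S)` is log smooth on the open set `U`: `U` is smooth over `k` and `S` has simple normal
crossings on `U`. -/
def LogSmoothOn {Z : NormalVariety k} (S : Z.RDivisor) (U : Z.X.Opens) : Prop :=
  Smooth (U.ι ≫ Z.str) ∧ ∀ z ∈ U, SNCAt S z

namespace DominantMorphism

variable {X Z : NormalVariety k}

open Classical in
/-- Property (*) for `(X/Z, B)`, where `SZ` is the reduced divisor on `Z` of the definition.
In `vertical_part`, the right hand side is the coefficient along `E` of `f⁻¹(SZ)`, the preimage
of `SZ` as a reduced divisor: it is `1` if `E` is contained in the preimage of the support of `SZ`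
and `0` otherwise. -/
structure PropertyStarWith (f : DominantMorphism X Z) (B : X.RDivisor) (SZ : Z.RDivisor) :
    Prop where
  glc : f.IsGLC B
  projective : f.IsProjective
  contraction : f.IsContraction
  reduced : IsReducedDivisor SZ
  logSmooth : LogSmoothOn SZ ⊤
  vertical_part : ∀ E : X.PrimeDivisor, ¬ f.IsHorizontal E →
    B E = if ∃ P : Z.PrimeDivisor, SZ P ≠ 0 ∧ P.1 ⤳ f.hom E.1 then 1 else 0
  lc : ∀ z : Z.X, IsClosed {z} → ∀ S : Z.RDivisor, IsReducedDivisor S → SZ ≤ S →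
    (∃ U : Z.X.Opens, z ∈ U ∧ LogSmoothOn S U) →
    ∃ N : X.RDivisor, f.IsPullback (S - SZ) N ∧
      ∃ U : X.X.Opens, f.hom ⁻¹' {z} ⊆ (U : Set X.X) ∧ LcOn (B + N) U

/-- Property (*) for `(X/Z, B)`. -/
def PropertyStar (f : DominantMorphism X Z) (B : X.RDivisor) : Prop :=
  ∃ SZ : Z.RDivisor, f.PropertyStarWith B SZ

end DominantMorphism

/-! ### Foliations -/

/-- A foliation on `X`: a coherent subsheaf `T_F` of `T_X`, saturated and closed under the Lie
bracket. The sections of `T_F` over a nonempty open set `U` are regarded as rational vector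
fields (the value on the empty set is irrelevant). -/
structure Foliation (X : NormalVariety k) where
  sec : X.X.Opens → AddSubgroup X.Der
  regular : ∀ (U : X.X.Opens) [Nonempty U], ∀ D ∈ sec U, ∀ x ∈ U, X.DerRegularAt x D
  smul_mem : ∀ (U : X.X.Opens) [Nonempty U], ∀ D ∈ sec U, ∀ a : Γ(X.X, U),
    algebraMap Γ(X.X, U) X.K a • D ∈ sec U
  restrict : ∀ (U V : X.X.Opens) [Nonempty V], V ≤ U → sec U ≤ sec V
  glue : ∀ (U : X.X.Opens) [Nonempty U] (D : X.Der),
    (∀ x ∈ U, ∃ V : X.X.Opens, x ∈ V ∧ V ≤ U ∧ D ∈ sec V) → D ∈ sec U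
  quasicoherent : ∀ (U : X.X.Opens) [Nonempty U], IsAffineOpen U → ∀ g : Γ(X.X, U),
    Nonempty (X.X.basicOpen g) → ∀ D ∈ sec (X.X.basicOpen g),
    ∃ n : ℕ, (algebraMap Γ(X.X, U) X.K g) ^ n • D ∈ sec U
  saturated : ∀ (U : X.X.Opens) [Nonempty U] (D : X.Der), (∀ x ∈ U, X.DerRegularAt x D) →
    ∀ a : Γ(X.X, U), a ≠ 0 → algebraMap Γ(X.X, U) X.K a • D ∈ sec U → D ∈ sec U
  lie_mem : ∀ (U : X.X.Opens) [Nonempty U], ∀ D ∈ sec U, ∀ D' ∈ sec U, ⁅D, D'⁆ ∈ sec U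

namespace Foliation

variable {X Z : NormalVariety k}

/-- The stalk of `T_F` at `x`. -/
def stalk (F : Foliation X) (x : X.X) : Set X.Der :=
  {D | ∃ U : X.X.Opens, x ∈ U ∧ D ∈ F.sec U}

/-- The generic stalk of `T_F`, a vector space over the function field. -/
def generic (F : Foliation X) : Submodule X.K X.Der :=
  Submodule.span X.K (F.stalk (genericPoint X.X))

/-- `D` is a canonical divisor `K_F`, that is, `𝒪_X(D) ≅ (det T_F)^*`. -/
def IsCanonical (F : Foliation X) (D : X.RDivisor) : Prop :=
  X.IsDetDualDivisor F.generic F.stalk D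

/-- `(F, Δ)` is a foliated pair: `K_F + Δ` is `ℝ`-Cartier. -/
def IsFoliatedPair (F : Foliation X) (Δ : X.RDivisor) : Prop :=
  ∃ KF : X.RDivisor, F.IsCanonical KF ∧ IsRCartier (KF + Δ)

/-- `F` is the foliation induced by `f`: `T_F` is the kernel of `T_X → f^* T_Z`, i.e. consists of
the vector fields annihilating the rational functions on `Z`. -/
def IsInducedBy (F : Foliation X) (f : DominantMorphism X Z) : Prop :=
  ∀ (U : X.X.Opens) [Nonempty U] (D : X.Der), D ∈ F.sec U ↔
    (∀ x ∈ U, X.DerRegularAt x D) ∧ ∀ φ : Z.K, D (f.pullback φ) = 0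

/-- The prime divisor `P` is `F`-invariant: sections of `T_F` preserve its ideal sheaf. -/
def IsInvariant (F : Foliation X) (P : X.PrimeDivisor) : Prop :=
  ∀ U : X.X.Opens, P.1 ∈ U → ∀ D ∈ F.sec U, ∀ φ : X.K,
    (∀ x ∈ U, X.RegularAt x φ) → X.VanishesAt P.1 φ → X.VanishesAt P.1 (D φ)

/-- `(F, Δ)` satisfies Property (*) by means of the contraction `f`, and the `F`-invariant divisor
`G ≥ 0` is associated to `(F, Δ)`. -/
structure IsAssociated (F : Foliation X) (Δ : X.RDivisor) (f : DominantMorphism X Z)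
    (G : X.RDivisor) : Prop where
  projective : f.IsProjective
  contraction : f.IsContraction
  induced : F.IsInducedBy f
  nonneg : 0 ≤ G
  invariant : ∀ P : X.PrimeDivisor, G P ≠ 0 → F.IsInvariant P
  propertyStar : f.PropertyStar (Δ + G)

end Foliation

end NormalVariety

end

open NormalVariety

/-!
The proof compares canonical divisors coefficient by coefficient, at the generic points of the
prime divisors of `X`, by means of explicit frames of vector fields.

*Coordinates.* In characteristic zero, generators of the maximal ideal of a regular local ring `A`
essentially of finite type over `k`, together with lifts of a transcendence basis of the residue
field, are coordinates: the dual vector fields are a basis of the derivations of `A`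
(`IsLocalRing.isCoordSystem`). This applies at the generic point of a prime divisor, at the generic
point of the variety, and at the points where a divisor has simple normal crossings. A divisor that
represents the dual of the determinant of a sheaf of vector fields has, along each prime divisor,
the order of a fixed form `dw₁ ∧ ⋯ ∧ dwᵣ` on a frame (`IsDetDualDivisor.exists_ord_eq`).

*Comparison of canonical divisors.* Let `E` be a prime divisor of `X`. If `E` is horizontal, the
relative vector fields have a frame which, together with lifts of a frame of the vector fields on
`Z`, is a frame of the vector fields on `X`. If `E` lies with multiplicity `m` over a prime divisor
of `Z` with equation `p`, then `f^* p = v q ^ m`, where `q` is an equation of `E` and `v` is a unit.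
So `dp` is `q ^ (m - 1)` times a form that is part of a basis, and one of the lifts is divisible by
`q ^ (m - 1)`. Hence, up to a principal divisor, `K_X - K_F - f^* K_Z` is `0` along horizontal
divisors and `m - 1` along vertical ones (`DominantMorphism.exists_canonical_eq`).

*Equidimensionality.* The closure in its fibre of the generic point of a vertical divisor `E` is a
component of the fibre. Its dimension is at least the transcendence degree of the residue field
extension, and so the image of `E` has codimension one
(`DominantMorphism.IsEquidimensional.coheight_eq_one`). In particular all divisors on `Z` can be
pulled back.

*Discriminant.* Property (*) with `Σ = Σ_Z + P`, near a closed point of `P` where this divisor has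
simple normal crossings, shows that `(X, B + f^* P)` is log canonical over the generic point of `P`
if `P` is not a component of `Σ_Z`. As the coefficients of the boundary of a log canonical pair are
at most one, it follows that the discriminant is `Σ_Z`
(`DominantMorphism.PropertyStarWith.isDiscriminant_iff`) and that the fibres over
prime divisors outside `Σ_Z` are reduced. On the other hand, `G` has no horizontal component,
because the vector field dual to an equation of such a component would not preserve its ideal.
Hence the vertical part of `Δ + G` is `G`, with coefficient `Σ_Z(P)` along each divisor over `P`,
and `K_F + Δ - (K_X + Δ + G - f^* (K_Z + Σ_Z))` has, up to a principal divisor, the coefficient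
`(1 - m) (1 - Σ_Z(P)) = 0`.
-/

noncomputable section

/-! ### Derivations in characteristic zero and Kähler differentials of local rings -/

section Derivations

open Algebra KaehlerDifferential

/-- In characteristic zero a derivation that kills elements over which the field is algebraic is
zero. -/
theorem Derivation.eq_zero_of_isAlgebraic_adjoin {k κ Q ι : Type*} [Field k] [CharZero k] [Field κ]
    [Algebra k κ] [AddCommGroup Q] [Module κ Q] [Module k Q] [IsScalarTower k κ Q] {t : ι → κ}
    [Algebra.IsAlgebraic (Algebra.adjoin k (Set.range t)) κ] (D : Derivation k κ Q)
    (h : ∀ i, D (t i) = 0) : D = 0 := by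
  have hD : ∀ x : k, D (algebraMap k κ x) = 0 := fun x => D.map_algebraMap x
  let E : IntermediateField k κ :=
    { carrier := {x | D x = 0}
      mul_mem' := fun {a b} ha hb => by
        simp only [Set.mem_ofPred_eq] at ha hb ⊢
        rw [D.leibniz, ha, hb, smul_zero, smul_zero, add_zero]
      add_mem' := fun {a b} ha hb => by
        simp only [Set.mem_ofPred_eq] at ha hb ⊢
        rw [map_add, ha, hb, add_zero]
      algebraMap_mem' := hD
      inv_mem' := fun a ha => by
        simp only [Set.mem_ofPred_eq] at ha ⊢
        rw [D.leibniz_inv, ha, smul_zero] }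
  have hE : ∀ x : E, D (x : κ) = 0 := fun x => x.2
  let _ : Module E Q := Module.compHom Q (algebraMap E κ)
  have : IsScalarTower E κ Q := ⟨fun a b c => by
    change (a • b) • c = (algebraMap E κ a) • b • c
    rw [Algebra.smul_def, mul_smul]⟩
  let D' : Derivation E κ Q :=
    Derivation.mk' { toFun := D
                     map_add' := D.map_add
                     map_smul' := fun a x => by
                      change D (algebraMap E κ a * x) = (algebraMap E κ a) • D x
                      rw [D.leibniz]
                      have : D (algebraMap E κ a) = 0 := hE a
                      rw [this, smul_zero, add_zero] }
      (fun a b => D.leibniz a b)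
  ext x
  have hsub : Algebra.adjoin k (Set.range t) ≤ E.toSubalgebra := by
    rw [Algebra.adjoin_le_iff]
    rintro _ ⟨i, rfl⟩
    exact h i
  have hx : IsAlgebraic E x := by
    obtain ⟨p, hp, hpx⟩ := Algebra.IsAlgebraic.isAlgebraic (R := Algebra.adjoin k (Set.range t)) x
    refine ⟨p.map (Subalgebra.inclusion hsub).toRingHom, ?_, ?_⟩
    · rwa [Ne, Polynomial.map_eq_zero_iff]
      exact Subalgebra.inclusion_injective hsub
    · rw [Polynomial.aeval_def] at hpx ⊢
      rw [Polynomial.eval₂_map]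
      exact hpx
  have hint : IsIntegral E x := hx.isIntegral
  have hs : (minpoly E x).Separable := (minpoly.irreducible hint).separable
  have h1 := D'.map_aeval (minpoly E x) x
  rw [minpoly.aeval, map_zero] at h1
  have h2 := hs.aeval_derivative_ne_zero (minpoly.aeval E x)
  exact (smul_eq_zero.mp h1.symm).resolve_left h2

/-- Let `A` be a local ring essentially of finite type over a field of characteristic zero. The
differentials of generators of the maximal ideal, together with those of lifts of a transcendence
basis of the residue field, generate `Ω_{A/k}`: modulo them and `𝔪 Ω` the universal derivation
factors through the residue field, where it vanishes on a transcendence basis. -/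
theorem KaehlerDifferential.span_eq_top_of_isLocalRing {k A ι ι' : Type*} [Field k] [CharZero k]
    [CommRing A] [IsLocalRing A] [Algebra k A] [Algebra.EssFiniteType k A] {s : ι → A}
    (hs : Ideal.span (Set.range s) = IsLocalRing.maximalIdeal A) {t : ι' → A}
    (ht : IsTranscendenceBasis k (IsLocalRing.residue A ∘ t)) :
    Submodule.span A (Set.range (D k A ∘ Sum.elim s t)) = ⊤ := by
  set N := Submodule.span A (Set.range (D k A ∘ Sum.elim s t)) with hN
  set m := IsLocalRing.maximalIdeal A with hm
  let M : Submodule A Ω[A⁄k] := N ⊔ m • ⊤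
  have hNs : ∀ i, D k A (s i) ∈ N := fun i => Submodule.subset_span ⟨Sum.inl i, rfl⟩
  have hNt : ∀ i, D k A (t i) ∈ N := fun i => Submodule.subset_span ⟨Sum.inr i, rfl⟩
  let Q := Ω[A⁄k] ⧸ M
  have htors : Module.IsTorsionBySet A Q (m : Set A) := by
    rintro q ⟨a, ha⟩
    obtain ⟨q, rfl⟩ := Submodule.Quotient.mk_surjective _ q
    change a • Submodule.Quotient.mk q = (0 : Q)
    rw [← Submodule.Quotient.mk_smul, Submodule.Quotient.mk_eq_zero]
    exact Submodule.mem_sup_right (Submodule.smul_mem_smul ha trivial)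
  let _ : Module (IsLocalRing.ResidueField A) Q := htors.module
  have : IsScalarTower A (IsLocalRing.ResidueField A) Q := htors.isScalarTower
  have : IsScalarTower k (IsLocalRing.ResidueField A) Q := by
    refine ⟨fun a b c => ?_⟩
    obtain ⟨b, rfl⟩ := IsLocalRing.residue_surjective b
    have : a • IsLocalRing.residue A b = algebraMap A (IsLocalRing.ResidueField A) (a • b) := by
      rw [Algebra.smul_def, Algebra.smul_def, map_mul]; rfl
    rw [this, algebraMap_smul]
    have h2 : IsLocalRing.residue A b • c = b • c := algebraMap_smul _ b c
    rw [h2, smul_assoc]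
  let d : Derivation k A Q := M.mkQ.compDer (D k A)
  have hdm : ∀ a ∈ m, d a = 0 := by
    intro a ha
    change M.mkQ (D k A a) = 0
    rw [Submodule.mkQ_apply, Submodule.Quotient.mk_eq_zero]
    rw [← hs] at ha
    refine Submodule.span_induction (p := fun a _ => D k A a ∈ M) ?_ ?_ ?_ ?_ ha
    · rintro _ ⟨i, rfl⟩
      exact Submodule.mem_sup_left (hNs i)
    · simp
    · intro x y _ _ hx hy
      rw [map_add]; exact add_mem hx hy
    · intro a x hx' hx
      rw [smul_eq_mul, Derivation.leibniz]
      refine add_mem (M.smul_mem _ hx) (Submodule.mem_sup_right (Submodule.smul_mem_smul ?_ trivial))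
      rw [← hs]; exact hx'
  have hker : ∀ a b : A, IsLocalRing.residue A a = IsLocalRing.residue A b → d a = d b := by
    intro a b hab
    rw [← sub_eq_zero, ← map_sub]
    apply hdm
    rw [← IsLocalRing.residue_eq_zero_iff, map_sub, hab, sub_self]
  let r := Function.surjInv (IsLocalRing.residue_surjective (R := A))
  have hr : ∀ x, IsLocalRing.residue A (r x) = x := Function.surjInv_eq _
  have hdr : ∀ a, d (r (IsLocalRing.residue A a)) = d a := fun a => hker _ _ (hr _)
  let d' : Derivation k (IsLocalRing.ResidueField A) Q :=
    Derivation.mk' { toFun := fun x => d (r x)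
                     map_add' := fun x y => by
                      rw [← map_add]; apply hker; rw [hr, map_add, hr, hr]
                     map_smul' := fun a x => by
                      rw [RingHom.id_apply, ← d.map_smul]; apply hker
                      rw [hr, Algebra.smul_def, Algebra.smul_def, map_mul, hr]; rfl }
      (fun a b => by
        change d (r (a * b)) = a • d (r b) + b • d (r a)
        have h1 : a • d (r b) = r a • d (r b) := by
          conv_lhs => rw [← hr a]
          exact algebraMap_smul _ (r a) _
        have h2 : b • d (r a) = r b • d (r a) := by
          conv_lhs => rw [← hr b]
          exact algebraMap_smul _ (r b) _
        rw [h1, h2, ← d.leibniz]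
        apply hker
        rw [hr, map_mul, hr, hr])
  have := ht.isAlgebraic
  have hd' : d' = 0 := by
    apply Derivation.eq_zero_of_isAlgebraic_adjoin (t := IsLocalRing.residue A ∘ t)
    intro i
    change d (r (IsLocalRing.residue A (t i))) = 0
    rw [hdr]
    change M.mkQ (D k A (t i)) = 0
    rw [Submodule.mkQ_apply, Submodule.Quotient.mk_eq_zero]
    exact Submodule.mem_sup_left (hNt i)
  have hM : M = ⊤ := by
    rw [_root_.eq_top_iff, ← KaehlerDifferential.span_range_derivation, Submodule.span_le]
    rintro _ ⟨a, rfl⟩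
    have : d a = 0 := by
      rw [← hdr]
      exact congrArg (fun D : Derivation k (IsLocalRing.ResidueField A) Q =>
        D (IsLocalRing.residue A a)) hd'
    exact (Submodule.Quotient.mk_eq_zero _).mp this
  rw [_root_.eq_top_iff]
  refine Submodule.le_of_le_smul_of_le_jacobson_bot (I := m) Module.Finite.fg_top ?_ ?_
  · rw [IsLocalRing.jacobson_eq_maximalIdeal ⊥ bot_ne_top]
  · exact hM.ge

/-- In characteristic zero derivations can be prescribed on a transcendence basis. -/
theorem IsTranscendenceBasis.exists_derivation {k K ι : Type*} [Field k] [CharZero k] [Field K]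
    [Algebra k K] {x : ι → K} (hx : IsTranscendenceBasis k x) (c : ι → K) :
    ∃ D : Derivation k K K, ∀ i, D (x i) = c i := by
  have := charZero_of_injective_algebraMap (algebraMap k K).injective
  let P := MvPolynomial ι k
  let _ : Algebra P K := (MvPolynomial.aeval x).toAlgebra
  have : IsScalarTower k P K := IsScalarTower.of_algebraMap_eq fun r => by
    change _ = MvPolynomial.aeval x (algebraMap k P r)
    rw [AlgHom.commutes]
  have hinj : Function.Injective (algebraMap P K) := hx.1
  have : FaithfulSMul P K := (faithfulSMul_iff_algebraMap_injective _ _).mpr hinj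
  have : Algebra.IsAlgebraic P K := by
    have := hx.isAlgebraic
    refine ⟨fun y => ?_⟩
    obtain ⟨p, hp, hpy⟩ := Algebra.IsAlgebraic.isAlgebraic (R := Algebra.adjoin k (Set.range x)) y
    refine ⟨p.map hx.1.aevalEquiv.symm.toRingEquiv.toRingHom, ?_, ?_⟩
    · rwa [Ne, Polynomial.map_eq_zero_iff]
      exact hx.1.aevalEquiv.symm.injective
    · rw [Polynomial.aeval_def] at hpy ⊢
      rw [Polynomial.eval₂_map, ← hpy]
      congr 1
      ext z
      change MvPolynomial.aeval x (hx.1.aevalEquiv.symm z) = z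
      rw [← AlgebraicIndependent.algebraMap_aevalEquiv hx.1, AlgEquiv.apply_symm_apply]
      rfl
  let L := FractionRing P
  let _ : Algebra L K := FractionRing.liftAlgebra P K
  have : IsScalarTower P L K := FractionRing.isScalarTower_liftAlgebra P K
  have : CharZero L := charZero_of_injective_algebraMap (algebraMap k L).injective
  have : Algebra.IsAlgebraic L K := Algebra.IsAlgebraic.extendScalars (IsFractionRing.injective P L)
  have : Algebra.FormallyEtale P L := Algebra.FormallyEtale.of_isLocalization (nonZeroDivisors P)
  have : Algebra.FormallyEtale L K := Algebra.FormallyEtale.of_isSeparable L K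
  have : Algebra.FormallyEtale P K := Algebra.FormallyEtale.comp P L K
  let D0 : Derivation k P K := MvPolynomial.mkDerivation k c
  let φ := (D0.liftKaehlerDifferential).liftBaseChange K
  let e := KaehlerDifferential.tensorKaehlerEquivOfFormallyEtale k P K
  refine ⟨(φ.comp e.symm.toLinearMap).compDer (D k K), fun i => ?_⟩
  have h1 : x i = algebraMap P K (MvPolynomial.X i) := by
    change _ = MvPolynomial.aeval x (MvPolynomial.X i); simp
  change φ (e.symm (D k K (x i))) = c i
  rw [h1, KaehlerDifferential.tensorKaehlerEquivOfFormallyEtale_symm_D_algebraMap]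
  simp only [φ, D0, LinearMap.liftBaseChange_tmul, Derivation.liftKaehlerDifferential_comp_D,
    one_smul]
  exact MvPolynomial.mkDerivation_X _ _ _

/-- Let `k ⊆ K` be fields of characteristic zero, and `A ⊆ K` a `k`-subalgebra. The family `u` of
elements of `A` is a system of coordinates of `A` if there are derivations `∂ i` of `K`, dual to
`u`, that preserve `A` and span the derivations of `K`. Then the derivations of `K` that preserve
`A` are freely generated over `A` by the `∂ i`. -/
def IsCoordSystem {k K ι : Type*} [Field k] [Field K] [Algebra k K] [Fintype ι] [DecidableEq ι]
    (A : Subalgebra k K) (u : ι → K) : Prop :=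
  (∀ i, u i ∈ A) ∧ ∃ d : ι → Derivation k K K,
    (∀ i j, d i (u j) = if i = j then 1 else 0) ∧ (∀ i, ∀ a ∈ A, d i a ∈ A) ∧
    ∀ D : Derivation k K K, D = ∑ i, D (u i) • d i

/-- Evaluation of derivations on a family of elements. -/
def Derivation.evalFamily {k K ι : Type*} [Field k] [Field K] [Algebra k K] (u : ι → K) :
    Derivation k K K →ₗ[K] (ι → K) where
  toFun D i := D (u i)
  map_add' _ _ := rfl
  map_smul' _ _ := rfl

section Fields

variable {k K : Type*} [Field k] [CharZero k] [Field K] [Algebra k K]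

/-- In characteristic zero the derivations of a field have the dual basis of any finite
transcendence basis. -/
def IsTranscendenceBasis.derivationEquiv {ι : Type*} {x : ι → K} (hx : IsTranscendenceBasis k x) :
    Derivation k K K ≃ₗ[K] (ι → K) :=
  LinearEquiv.ofBijective (Derivation.evalFamily x) <| by
    refine ⟨?_, fun c => ?_⟩
    · rw [← LinearMap.ker_eq_bot, LinearMap.ker_eq_bot']
      intro D hD
      have := hx.isAlgebraic
      exact D.eq_zero_of_isAlgebraic_adjoin (t := x) fun i => congrFun hD i
    · obtain ⟨D, hD⟩ := hx.exists_derivation c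
      exact ⟨D, funext hD⟩

theorem IsTranscendenceBasis.finrank_derivation {ι : Type*} [Fintype ι] {x : ι → K}
    (hx : IsTranscendenceBasis k x) : Module.finrank K (Derivation k K K) = Fintype.card ι := by
  rw [hx.derivationEquiv.finrank_eq, Module.finrank_fintype_fun_eq_card]

theorem IsTranscendenceBasis.finite_derivation {ι : Type*} [Fintype ι] {x : ι → K}
    (hx : IsTranscendenceBasis k x) : Module.Finite K (Derivation k K K) :=
  Module.Finite.equiv hx.derivationEquiv.symm

end Fields

/-- A derivation of `K` is expressed on a subring `A` through its values on elements whose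
differentials generate `Ω_{A/k}`. -/
theorem Derivation.exists_eq_sum_of_span_eq_top {k K : Type*} [Field k] [Field K] [Algebra k K]
    {A ι : Type*} [CommRing A] [Algebra k A]
    [Algebra A K] [IsScalarTower k A K] [Fintype ι] {u : ι → A}
    (hu : Submodule.span A (Set.range (KaehlerDifferential.D k A ∘ u)) = ⊤) (a : A) :
    ∃ c : ι → A, ∀ D : Derivation k K K,
      D (algebraMap A K a) = ∑ i, algebraMap A K (c i) * D (algebraMap A K (u i)) := by
  have ha : KaehlerDifferential.D k A a ∈
      Submodule.span A (Set.range (KaehlerDifferential.D k A ∘ u)) := by rw [hu]; trivial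
  obtain ⟨c, hc⟩ := (Submodule.mem_span_range_iff_exists_fun A).mp ha
  refine ⟨c, fun D => ?_⟩
  have h2 := congrArg (D.compAlgebraMap A).liftKaehlerDifferential hc
  simp only [map_sum, LinearMap.map_smul, Function.comp_apply,
    Derivation.liftKaehlerDifferential_comp_D] at h2
  change ∑ i, c i • D (algebraMap A K (u i)) = D (algebraMap A K a) at h2
  rw [← h2]
  exact Finset.sum_congr rfl fun i _ => Algebra.smul_def _ _

theorem Derivation.evalFamily_injective_of_span_eq_top {k K : Type*} [Field k] [Field K]
    [Algebra k K] {A ι : Type*} [CommRing A] [Algebra k A]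
    [Algebra A K] [IsScalarTower k A K] [IsDomain A] [IsFractionRing A K] [Fintype ι] {u : ι → A}
    (hu : Submodule.span A (Set.range (KaehlerDifferential.D k A ∘ u)) = ⊤) :
    Function.Injective (Derivation.evalFamily (k := k) (algebraMap A K ∘ u)) := by
  rw [← LinearMap.ker_eq_bot, LinearMap.ker_eq_bot']
  intro D hD
  have hA : ∀ a : A, D (algebraMap A K a) = 0 := by
    intro a
    obtain ⟨c, hc⟩ := Derivation.exists_eq_sum_of_span_eq_top (K := K) hu a
    rw [hc]
    refine Finset.sum_eq_zero fun i _ => ?_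
    have : D (algebraMap A K (u i)) = 0 := congrFun hD i
    rw [this, mul_zero]
  ext x
  obtain ⟨a, b, hb, rfl⟩ := IsFractionRing.div_surjective (A := A) x
  rw [div_eq_mul_inv, D.leibniz, D.leibniz_inv, hA, hA]
  simp

section Fields

variable {k K : Type*} [Field k] [CharZero k] [Field K] [Algebra k K]

/-- If the differentials of `u` generate `Ω_{A/k}` then their number is at least the transcendence
degree of the fraction field. -/
theorem IsTranscendenceBasis.card_le_of_span_eq_top {A ι ι' : Type*} [CommRing A] [Algebra k A]
    [Algebra A K] [IsScalarTower k A K] [IsDomain A] [IsFractionRing A K] [Fintype ι] {u : ι → A}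
    (hu : Submodule.span A (Set.range (KaehlerDifferential.D k A ∘ u)) = ⊤) [Fintype ι']
    {x : ι' → K} (hx : IsTranscendenceBasis k x) : Fintype.card ι' ≤ Fintype.card ι := by
  rw [← hx.finrank_derivation, ← Module.finrank_fintype_fun_eq_card (R := K) (η := ι)]
  exact LinearMap.finrank_le_finrank_of_injective (Derivation.evalFamily_injective_of_span_eq_top hu)

/-- Elements whose differentials generate `Ω_{A/k}` and whose number does not exceed the
transcendence degree are coordinates. -/
theorem isCoordSystem_of_span_eq_top {A ι ι' : Type*} [CommRing A] [Algebra k A]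
    [Algebra A K] [IsScalarTower k A K] [IsDomain A] [IsFractionRing A K] [Fintype ι]
    [DecidableEq ι] {u : ι → A}
    (hu : Submodule.span A (Set.range (KaehlerDifferential.D k A ∘ u)) = ⊤) [Fintype ι']
    {x : ι' → K} (hx : IsTranscendenceBasis k x) (hle : Fintype.card ι ≤ Fintype.card ι') :
    IsCoordSystem (IsScalarTower.toAlgHom k A K).range (algebraMap A K ∘ u) := by
  have hinj := Derivation.evalFamily_injective_of_span_eq_top (K := K) hu
  have := hx.finite_derivation
  have hsurj : Function.Surjective (Derivation.evalFamily (k := k) (algebraMap A K ∘ u)) := by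
    refine (LinearMap.injective_iff_surjective_of_finrank_eq_finrank ?_).mp hinj
    rw [hx.finrank_derivation, Module.finrank_fintype_fun_eq_card]
    exact le_antisymm (hx.card_le_of_span_eq_top hu) hle
  refine ⟨fun i => ⟨u i, rfl⟩, ?_⟩
  choose d hd using fun i : ι => hsurj (Pi.single i 1)
  have hd' : ∀ i j, d i (algebraMap A K (u j)) = if i = j then 1 else 0 := by
    intro i j
    have := congrFun (hd i) j
    change d i (algebraMap A K (u j)) = _ at this
    rw [this, Pi.single_apply]
    simp only [eq_comm]
  refine ⟨d, hd', ?_, fun D => hinj ?_⟩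
  · rintro i _ ⟨a, rfl⟩
    obtain ⟨c, hc⟩ := Derivation.exists_eq_sum_of_span_eq_top (K := K) hu a
    refine ⟨c i, ?_⟩
    change algebraMap A K (c i) = d i (algebraMap A K a)
    rw [hc]
    simp [hd']
  · funext j
    simp [map_sum, Derivation.evalFamily, hd']

end Fields

section Dimension

open Cardinal

/-- Elements that are algebraically independent modulo a prime `Q`, together with some element of
`Q`, are algebraically independent modulo any strictly smaller prime. -/
theorem AlgebraicIndependent.exists_option_of_lt {k A ι : Type*} [Field k] [CommRing A] [Algebra k A]
    {P Q : Ideal A} [P.IsPrime] (hPQ : P < Q) {y : ι → A}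
    (hy : AlgebraicIndependent k fun i => Ideal.Quotient.mk Q (y i)) :
    ∃ q : A, AlgebraicIndependent k fun o : Option ι => Ideal.Quotient.mk P (o.elim q y) := by
  obtain ⟨q, hqQ, hqP⟩ := SetLike.exists_of_lt hPQ
  refine ⟨q, ?_⟩
  let φ : A ⧸ P →ₐ[k] A ⧸ Q := Ideal.Quotient.factorₐ k hPQ.le
  have hyP : AlgebraicIndependent k fun i => Ideal.Quotient.mk P (y i) :=
    AlgebraicIndependent.of_comp φ hy
  have key : AlgebraicIndependent k
      fun o : Option ι => o.elim (Ideal.Quotient.mk P q) fun i => Ideal.Quotient.mk P (y i) := by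
    rw [hyP.option_iff_transcendental]
    intro halg
    have hq0 : Ideal.Quotient.mk P q ≠ 0 := by rwa [Ne, Ideal.Quotient.eq_zero_iff_mem]
    obtain ⟨g, hg0, hg⟩ := halg.exists_nonzero_coeff_and_aeval_eq_zero
      (mem_nonZeroDivisors_of_ne_zero hq0)
    apply hg0
    have hφq : φ (Ideal.Quotient.mk P q) = 0 := by
      change Ideal.Quotient.mk Q q = 0
      rwa [Ideal.Quotient.eq_zero_iff_mem]
    have h1 : φ (g.coeff 0) = 0 := by
      have h2 := congrArg φ hg
      rw [map_zero, Polynomial.aeval_def, Polynomial.eval₂_eq_sum_range, map_sum,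
        Finset.sum_eq_single 0] at h2
      · simpa using h2
      · intro i _ hi
        rw [map_mul, map_pow, hφq, zero_pow hi, mul_zero]
      · simp
    have hmem : ∀ z ∈ Algebra.adjoin k (Set.range fun i => Ideal.Quotient.mk P (y i)),
        ∃ p, MvPolynomial.aeval (R := k) (fun i => Ideal.Quotient.mk P (y i)) p = z := by
      intro z hz
      rwa [Algebra.adjoin_range_eq_range_aeval] at hz
    obtain ⟨p, hp⟩ := hmem _ (g.coeff 0).2
    rw [← hp, ← AlgHom.comp_apply, MvPolynomial.comp_aeval] at h1
    have hp0 : p = 0 := by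
      rw [← map_zero (MvPolynomial.aeval (R := k) fun i => φ (Ideal.Quotient.mk P (y i)))] at h1
      exact hy h1
    rw [hp0, map_zero] at hp
    exact Subtype.ext hp.symm
  convert! key using 2 with o
  cases o <;> rfl

/-- Along a chain of primes the number of independent elements increases by at least one at each
step. -/
theorem AlgebraicIndependent.exists_of_ltSeries {k A : Type*} [Field k] [CommRing A] [Algebra k A]
    (p : LTSeries (PrimeSpectrum A)) {e : ℕ} {y : Fin e → A}
    (hy : AlgebraicIndependent k fun i => Ideal.Quotient.mk p.last.asIdeal (y i)) (j : ℕ)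
    (hj : j ≤ p.length) : ∃ y : Fin (e + j) → A, AlgebraicIndependent k
      fun i => Ideal.Quotient.mk (p ⟨p.length - j, by omega⟩).asIdeal (y i) := by
  induction j with
  | zero => exact ⟨y, hy⟩
  | succ j ih =>
    obtain ⟨y, hy⟩ := ih (by omega)
    have hlt : (p ⟨p.length - (j + 1), by omega⟩).asIdeal < (p ⟨p.length - j, by omega⟩).asIdeal := by
      rw [PrimeSpectrum.asIdeal_lt_asIdeal]
      apply p.strictMono
      rw [Fin.mk_lt_mk]
      omega
    obtain ⟨q, hq⟩ := AlgebraicIndependent.exists_option_of_lt hlt hy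
    refine ⟨fun i => (finSuccEquiv (e + j) i).elim q y, ?_⟩
    exact hq.comp _ (finSuccEquiv (e + j)).injective

/-- For a local domain over a field the dimension plus the transcendence degree of the residue
field does not exceed the transcendence degree of the fraction field. -/
theorem IsLocalRing.add_le_of_algebraicIndependent {k A K : Type*} [Field k] [CommRing A]
    [IsLocalRing A] [IsDomain A] [Algebra k A] [Field K] [Algebra A K] [IsFractionRing A K]
    [Algebra k K] [IsScalarTower k A K] {n e N : ℕ} (hn : n ≤ ringKrullDim A) {y : Fin e → A}
    (hy : AlgebraicIndependent k (IsLocalRing.residue A ∘ y)) {x : Fin N → K}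
    (hx : IsTranscendenceBasis k x) : n + e ≤ N := by
  obtain ⟨p, hp⟩ := Order.le_krullDim_iff.mp hn
  have hle : p.last.asIdeal ≤ IsLocalRing.maximalIdeal A :=
    IsLocalRing.le_maximalIdeal p.last.isPrime.ne_top
  have hy' : AlgebraicIndependent k fun i => Ideal.Quotient.mk p.last.asIdeal (y i) :=
    AlgebraicIndependent.of_comp (Ideal.Quotient.factorₐ k hle) hy
  obtain ⟨z, hz⟩ := AlgebraicIndependent.exists_of_ltSeries p hy' p.length le_rfl
  have hz1 : AlgebraicIndependent k z :=
    AlgebraicIndependent.of_comp (Ideal.Quotient.mkₐ k _) hz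
  have hz2 : AlgebraicIndependent k (algebraMap A K ∘ z) :=
    hz1.map' (f := IsScalarTower.toAlgHom k A K) (IsFractionRing.injective A K)
  have h3 := hz2.lift_cardinalMk_le_trdeg
  rw [← hx.lift_cardinalMk_eq_trdeg, Cardinal.mk_fin, Cardinal.mk_fin, Cardinal.lift_natCast,
    Cardinal.lift_natCast, Nat.cast_le, hp] at h3
  omega

/-- A domain of finite type over a field has dimension at least its transcendence degree. -/
theorem AlgebraicIndependent.le_ringKrullDim {F B : Type*} [Field F] [CommRing B] [IsDomain B]
    [Algebra F B] [Algebra.FiniteType F B] {e : ℕ} {y : Fin e → B} (hy : AlgebraicIndependent F y) :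
    e ≤ ringKrullDim B := by
  obtain ⟨s, g, hg, hint⟩ := exists_integral_inj_algHom_of_fg F B
  let _ : Algebra (MvPolynomial (Fin s) F) B := g.toAlgebra
  have : Algebra.IsIntegral (MvPolynomial (Fin s) F) B := ⟨hint⟩
  have : IsScalarTower F (MvPolynomial (Fin s) F) B :=
    IsScalarTower.of_algebraMap_eq fun r => (g.commutes r).symm
  have : FaithfulSMul (MvPolynomial (Fin s) F) B := (faithfulSMul_iff_algebraMap_injective _ _).mpr hg
  have hes : e ≤ s := by
    have htb : IsTranscendenceBasis F (algebraMap (MvPolynomial (Fin s) F) B ∘ MvPolynomial.X) :=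
      (IsTranscendenceBasis.mvPolynomial (Fin s) F).algebraMap_comp
    have h3 := hy.lift_cardinalMk_le_trdeg
    rw [← htb.lift_cardinalMk_eq_trdeg, Cardinal.mk_fin, Cardinal.mk_fin, Cardinal.lift_natCast,
      Cardinal.lift_natCast, Nat.cast_le] at h3
    exact h3
  have hdim : (s : WithBot ℕ∞) ≤ ringKrullDim (MvPolynomial (Fin s) F) := by
    rw [MvPolynomial.ringKrullDim_of_isNoetherianRing, ringKrullDim_eq_zero_of_field]
    simp
  obtain ⟨l, hl⟩ := Order.le_krullDim_iff.mp hdim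
  obtain ⟨P, hP, hPl⟩ := Ideal.exists_ideal_over_prime_of_isIntegral_of_isDomain (S := B)
    l.head.asIdeal (by
      rw [(RingHom.injective_iff_ker_eq_bot (algebraMap (MvPolynomial (Fin s) F) B)).mp hg]
      exact bot_le)
  have : P.LiesOver l.head.asIdeal := ⟨hPl.symm⟩
  obtain ⟨L, hL, -⟩ := Ideal.exists_ltSeries_of_hasGoingUp l P
  refine le_trans ?_ (Order.le_krullDim_iff.mpr ⟨L, hL⟩)
  rw [hl]
  exact_mod_cast hes

end Dimension

section LocalCoordinates

theorem exists_isTranscendenceBasis_fin (k L : Type*) [Field k] [Field L] [Algebra k L]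
    [FinTrdeg k L] : ∃ (n : ℕ) (x : Fin n → L), IsTranscendenceBasis k x := by
  obtain ⟨S, hS⟩ := exists_isTranscendenceBasis k L
  have : Finite S := finite_of_isTranscendenceBasis hS
  exact ⟨_, _, hS.comp_equiv (Finite.equivFin S).symm⟩

theorem IsLocalRing.essFiniteType_residueField (k A : Type*) [Field k] [CommRing A]
    [IsLocalRing A] [Algebra k A] [Algebra.EssFiniteType k A] :
    Algebra.EssFiniteType k (IsLocalRing.ResidueField A) := by
  have : Algebra.FiniteType A (IsLocalRing.ResidueField A) :=
    Algebra.FiniteType.of_surjective (Algebra.ofId A _) IsLocalRing.residue_surjective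
  exact Algebra.EssFiniteType.comp k A _

theorem IsFractionRing.essFiniteType (k A K : Type*) [Field k] [CommRing A] [IsDomain A]
    [Algebra k A] [Algebra.EssFiniteType k A] [Field K] [Algebra A K] [IsFractionRing A K]
    [Algebra k K] [IsScalarTower k A K] : Algebra.EssFiniteType k K := by
  have : Algebra.EssFiniteType A K := Algebra.EssFiniteType.of_isLocalization K (nonZeroDivisors A)
  exact Algebra.EssFiniteType.comp k A K

theorem IsLocalRing.exists_isTranscendenceBasis_residue (k A : Type*) [Field k] [CommRing A]
    [IsLocalRing A] [Algebra k A] [Algebra.EssFiniteType k A] :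
    ∃ (e : ℕ) (t : Fin e → A), IsTranscendenceBasis k (IsLocalRing.residue A ∘ t) := by
  have := IsLocalRing.essFiniteType_residueField k A
  obtain ⟨n, x, hx⟩ := exists_isTranscendenceBasis_fin k (IsLocalRing.ResidueField A)
  choose t ht using fun i => IsLocalRing.residue_surjective (x i)
  have : IsLocalRing.residue A ∘ t = x := funext ht
  exact ⟨n, t, by rwa [this]⟩

/-- Lifts of a transcendence basis of the residue field of `A` can be completed to lifts of a
transcendence basis of the residue field of a local ring dominating `A`. -/
theorem IsLocalRing.exists_isTranscendenceBasis_residue_sumElim {k A B : Type*} [Field k]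
    [CommRing A] [IsLocalRing A] [Algebra k A] [CommRing B] [IsLocalRing B] [Algebra k B]
    [Algebra.EssFiniteType k B] (φ : A →ₐ[k] B) [IsLocalHom φ.toRingHom] {ι : Type*} {x : ι → A}
    (hx : IsTranscendenceBasis k (IsLocalRing.residue A ∘ x)) :
    ∃ (r : ℕ) (y : Fin r → B),
      IsTranscendenceBasis k (IsLocalRing.residue B ∘ Sum.elim y (φ ∘ x)) := by
  let _ : Algebra (IsLocalRing.ResidueField A) (IsLocalRing.ResidueField B) :=
    (IsLocalRing.ResidueField.map φ.toRingHom).toAlgebra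
  have : IsScalarTower k (IsLocalRing.ResidueField A) (IsLocalRing.ResidueField B) :=
    IsScalarTower.of_algebraMap_eq fun c => by
      change IsLocalRing.residue B (algebraMap k B c) =
        IsLocalRing.residue B (φ (algebraMap k A c))
      rw [φ.commutes]
  have := IsLocalRing.essFiniteType_residueField k B
  obtain ⟨S, hS⟩ := exists_isTranscendenceBasis (IsLocalRing.ResidueField A)
    (IsLocalRing.ResidueField B)
  have h1 := hx.sumElim_comp hS
  have : Finite (S ⊕ ι) := finite_of_isTranscendenceBasis h1
  have : Finite S := Finite.of_injective (Sum.inl : S → S ⊕ ι) Sum.inl_injective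
  choose y hy using fun i : S => IsLocalRing.residue_surjective (R := B) i
  refine ⟨_, y ∘ (Finite.equivFin S).symm, ?_⟩
  have h2 := h1.comp_equiv ((Finite.equivFin S).symm.sumCongr (Equiv.refl ι))
  convert! h2 using 1
  funext i
  rcases i with i | i
  · exact hy _
  · rfl

/-- Let `A` be a local domain essentially of finite type over a field of characteristic zero. If
the maximal ideal is generated by `dim A` elements, then these elements and lifts of a
transcendence basis of the residue field are coordinates. -/
theorem IsLocalRing.isCoordSystem {k A K : Type*} [Field k] [CharZero k] [CommRing A]
    [IsLocalRing A] [IsDomain A] [Algebra k A] [Algebra.EssFiniteType k A] [Field K] [Algebra A K]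
    [IsFractionRing A K] [Algebra k K] [IsScalarTower k A K] {n e : ℕ} {s : Fin n → A}
    (hs : Ideal.span (Set.range s) = IsLocalRing.maximalIdeal A) (hn : n ≤ ringKrullDim A)
    {t : Fin e → A} (ht : IsTranscendenceBasis k (IsLocalRing.residue A ∘ t)) :
    IsCoordSystem (IsScalarTower.toAlgHom k A K).range (algebraMap A K ∘ Sum.elim s t) := by
  have := IsFractionRing.essFiniteType k A K
  obtain ⟨N, x, hx⟩ := exists_isTranscendenceBasis_fin k K
  refine isCoordSystem_of_span_eq_top (KaehlerDifferential.span_eq_top_of_isLocalRing hs ht) hx ?_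
  simpa using IsLocalRing.add_le_of_algebraicIndependent hn ht.1 hx

end LocalCoordinates

/-- The number of coordinates is the dimension of the space of derivations. -/
theorem IsCoordSystem.finrank_eq {k K ι : Type*} [Field k] [Field K] [Algebra k K] [Fintype ι]
    [DecidableEq ι] {A : Subalgebra k K} {u : ι → K} (hu : IsCoordSystem A u) :
    Module.finrank K (Derivation k K K) = Fintype.card ι := by
  obtain ⟨-, d, hd, -, hD⟩ := hu
  have hli : LinearIndependent K d := by
    rw [Fintype.linearIndependent_iff]
    intro c hc i
    have := congrArg (fun D : Derivation k K K => D (u i)) hc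
    have h2 : (∑ j, c j • d j) (u i) = ∑ j, c j * d j (u i) := by
      rw [← Derivation.coeFnAddMonoidHom_apply, map_sum, Finset.sum_apply]
      rfl
    simp only [h2, hd, Derivation.zero_apply] at this
    simpa using this
  refine Module.finrank_eq_card_basis (Module.Basis.mk hli ?_)
  intro D _
  rw [hD D]
  exact Submodule.sum_mem _ fun i _ => Submodule.smul_mem _ _ (Submodule.subset_span ⟨i, rfl⟩)

end Derivations

/-! ### Rational functions on a normal variety -/

namespace NormalVariety

open TopologicalSpace

variable {k : Type u} [Field k] (X : NormalVariety k)

/-- The local ring at `x` as an algebra over the ground field. -/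
@[reducible] def stalkAlgebra (x : X.X) : Algebra k (X.X.presheaf.stalk x) :=
  RingHom.toAlgebra ((Scheme.ΓSpecIso (CommRingCat.of k)).inv ≫ X.str.appTop ≫
    X.X.presheaf.germ ⊤ x trivial).hom

theorem isScalarTower_stalk (x : X.X) :
    letI := X.stalkAlgebra x
    IsScalarTower k (X.X.presheaf.stalk x) X.K := by
  let _ := X.stalkAlgebra x
  refine IsScalarTower.of_algebraMap_eq fun c => ?_
  have : Nonempty (⊤ : X.X.Opens) := ⟨⟨x, trivial⟩⟩
  exact (Scheme.algebraMap_germ_eq_germToFunctionField (X := X.X) (U := ⊤) (x := x) trivial _).symm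

/-- The local ring at `x` as a subalgebra of the function field. -/
def localSubalgebra (x : X.X) : Subalgebra k X.K :=
  let _ := X.stalkAlgebra x
  have := X.isScalarTower_stalk x
  (IsScalarTower.toAlgHom k (X.X.presheaf.stalk x) X.K).range

variable {X}

theorem algebraMap_stalk_injective (x : X.X) :
    Function.Injective (algebraMap (X.X.presheaf.stalk x) X.K) :=
  IsFractionRing.injective _ _

theorem regularAt_algebraMap {x : X.X} (a : X.X.presheaf.stalk x) :
    X.RegularAt x (algebraMap _ X.K a) := ⟨a, rfl⟩

theorem vanishesAt_algebraMap {x : X.X} {a : X.X.presheaf.stalk x} :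
    X.VanishesAt x (algebraMap _ X.K a) ↔ a ∈ IsLocalRing.maximalIdeal (X.X.presheaf.stalk x) := by
  refine ⟨?_, fun h => ⟨a, h, rfl⟩⟩
  rintro ⟨b, hb, hab⟩
  rwa [← algebraMap_stalk_injective x hab]

theorem unitAt_algebraMap {x : X.X} {a : X.X.presheaf.stalk x} :
    X.UnitAt x (algebraMap _ X.K a) ↔ IsUnit a := by
  refine ⟨?_, fun h => ⟨a, h, rfl⟩⟩
  rintro ⟨b, hb, hab⟩
  rwa [← algebraMap_stalk_injective x hab]

theorem UnitAt.regularAt {x : X.X} {φ : X.K} (h : X.UnitAt x φ) : X.RegularAt x φ :=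
  let ⟨a, _, ha⟩ := h; ⟨a, ha⟩

theorem VanishesAt.regularAt {x : X.X} {φ : X.K} (h : X.VanishesAt x φ) : X.RegularAt x φ :=
  let ⟨a, _, ha⟩ := h; ⟨a, ha⟩

theorem RegularAt.vanishesAt_iff {x : X.X} {φ : X.K} (h : X.RegularAt x φ) :
    X.VanishesAt x φ ↔ ¬ X.UnitAt x φ := by
  obtain ⟨a, rfl⟩ := h
  rw [vanishesAt_algebraMap, unitAt_algebraMap, IsLocalRing.mem_maximalIdeal, mem_nonunits_iff]

theorem unitAt_iff {x : X.X} {φ : X.K} :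
    X.UnitAt x φ ↔ φ ≠ 0 ∧ X.RegularAt x φ ∧ X.RegularAt x φ⁻¹ := by
  constructor
  · rintro ⟨a, ha, rfl⟩
    obtain ⟨u, rfl⟩ := ha
    refine ⟨?_, ⟨_, rfl⟩, ⟨(↑u⁻¹ : X.X.presheaf.stalk x), ?_⟩⟩
    · exact ((Units.isUnit u).map (algebraMap _ X.K)).ne_zero
    · refine eq_inv_of_mul_eq_one_left ?_
      rw [← map_mul, Units.inv_mul, map_one]
  · rintro ⟨h0, ⟨a, rfl⟩, ⟨b, hb⟩⟩
    refine ⟨a, IsUnit.of_mul_eq_one b (algebraMap_stalk_injective x ?_), rfl⟩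
    rw [map_mul, hb, map_one, mul_inv_cancel₀ h0]

theorem RegularAt.add {x : X.X} {φ ψ : X.K} (h : X.RegularAt x φ) (h' : X.RegularAt x ψ) :
    X.RegularAt x (φ + ψ) := (X.localSubalgebra x).add_mem h h'

theorem RegularAt.sub {x : X.X} {φ ψ : X.K} (h : X.RegularAt x φ) (h' : X.RegularAt x ψ) :
    X.RegularAt x (φ - ψ) := (X.localSubalgebra x).sub_mem h h'

theorem RegularAt.mul {x : X.X} {φ ψ : X.K} (h : X.RegularAt x φ) (h' : X.RegularAt x ψ) :
    X.RegularAt x (φ * ψ) := (X.localSubalgebra x).mul_mem h h'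

theorem RegularAt.pow {x : X.X} {φ : X.K} (h : X.RegularAt x φ) (n : ℕ) :
    X.RegularAt x (φ ^ n) := (X.localSubalgebra x).pow_mem h n

theorem RegularAt.sum {x : X.X} {ι : Type*} {s : Finset ι} {φ : ι → X.K}
    (h : ∀ i ∈ s, X.RegularAt x (φ i)) : X.RegularAt x (∑ i ∈ s, φ i) :=
  (X.localSubalgebra x).sum_mem h

theorem regularAt_zero (x : X.X) : X.RegularAt x 0 := (X.localSubalgebra x).zero_mem

theorem regularAt_one (x : X.X) : X.RegularAt x 1 := (X.localSubalgebra x).one_mem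

theorem unitAt_one (x : X.X) : X.UnitAt x 1 := ⟨1, isUnit_one, map_one _⟩

theorem UnitAt.ne_zero {x : X.X} {φ : X.K} (h : X.UnitAt x φ) : φ ≠ 0 := (unitAt_iff.mp h).1

theorem UnitAt.inv {x : X.X} {φ : X.K} (h : X.UnitAt x φ) : X.UnitAt x φ⁻¹ := by
  rw [unitAt_iff] at h ⊢
  exact ⟨inv_ne_zero h.1, h.2.2, by rw [inv_inv]; exact h.2.1⟩

theorem UnitAt.mul {x : X.X} {φ ψ : X.K} (h : X.UnitAt x φ) (h' : X.UnitAt x ψ) :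
    X.UnitAt x (φ * ψ) := by
  obtain ⟨a, ha, rfl⟩ := h
  obtain ⟨b, hb, rfl⟩ := h'
  exact ⟨a * b, ha.mul hb, map_mul _ _ _⟩

/-- A rational function is regular on an open set. -/
theorem isOpen_setOf_regularAt (φ : X.K) : IsOpen {x : X.X | X.RegularAt x φ} := by
  rw [isOpen_iff_forall_mem_open]
  rintro x ⟨a, rfl⟩
  obtain ⟨U, hxU, s, rfl⟩ := X.X.presheaf.exists_germ_eq a
  refine ⟨U, fun y hy => ?_, U.2, hxU⟩
  have : Nonempty U := ⟨⟨x, hxU⟩⟩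
  rw [Set.mem_ofPred_eq, Scheme.algebraMap_germ_eq_germToFunctionField,
    ← Scheme.algebraMap_germ_eq_germToFunctionField X.X hy]
  exact regularAt_algebraMap _

theorem isOpen_setOf_unitAt (φ : X.K) : IsOpen {x : X.X | X.UnitAt x φ} := by
  by_cases h0 : φ = 0
  · convert! isOpen_empty
    ext x
    simp [unitAt_iff, h0]
  · convert! (isOpen_setOf_regularAt φ).inter (isOpen_setOf_regularAt φ⁻¹) using 1
    ext x
    simp [unitAt_iff, h0]

theorem RegularAt.of_specializes {x y : X.X} (h : y ⤳ x) {φ : X.K} (hφ : X.RegularAt x φ) :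
    X.RegularAt y φ := h.mem_open (isOpen_setOf_regularAt φ) hφ

theorem UnitAt.of_specializes {x y : X.X} (h : y ⤳ x) {φ : X.K} (hφ : X.UnitAt x φ) :
    X.UnitAt y φ := h.mem_open (isOpen_setOf_unitAt φ) hφ

theorem VanishesAt.of_specializes {x y : X.X} (h : y ⤳ x) {φ : X.K} (hφ : X.VanishesAt y φ)
    (hx : X.RegularAt x φ) : X.VanishesAt x φ := by
  rw [hx.vanishesAt_iff]
  rw [hφ.regularAt.vanishesAt_iff] at hφ
  exact fun h' => hφ (h'.of_specializes h)

theorem regularAt_genericPoint (φ : X.K) : X.RegularAt (genericPoint X.X) φ := by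
  refine ⟨φ, ?_⟩
  rw [RingHom.algebraMap_toAlgebra]
  simp

/-- A nonempty affine open set, in terms of its coordinate ring. -/
structure AffineChart (X : NormalVariety k) where
  /-- the open set -/
  U : X.X.Opens
  affine : IsAffineOpen U
  nonempty : Nonempty U

variable (X) in
theorem exists_affineChart (x : X.X) : ∃ c : X.AffineChart, x ∈ c.U := by
  obtain ⟨U, hU, hU2, -⟩ := exists_isAffineOpen_mem_and_subset (X := X.X) (U := ⊤) (x := x) (by simp)
  exact ⟨⟨U, hU, ⟨⟨x, hU2⟩⟩⟩, hU2⟩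

namespace AffineChart

variable (c : X.AffineChart)

instance : Nonempty c.U := c.nonempty

/-- Regular functions on the chart as rational functions. -/
def toK : Γ(X.X, c.U) →+* X.K := (X.X.germToFunctionField c.U).hom

theorem toK_eq {x : X.X} (hx : x ∈ c.U) (a : Γ(X.X, c.U)) :
    c.toK a = algebraMap (X.X.presheaf.stalk x) X.K (X.X.presheaf.germ c.U x hx a) :=
  (Scheme.algebraMap_germ_eq_germToFunctionField X.X hx a).symm

theorem toK_injective : Function.Injective c.toK := X.X.germToFunctionField_injective c.U

theorem regularAt_toK {x : X.X} (hx : x ∈ c.U) (a : Γ(X.X, c.U)) : X.RegularAt x (c.toK a) := by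
  rw [c.toK_eq hx]; exact regularAt_algebraMap _

theorem unitAt_toK_iff {x : X.X} (hx : x ∈ c.U) (a : Γ(X.X, c.U)) :
    X.UnitAt x (c.toK a) ↔ x ∈ X.X.basicOpen a := by
  rw [c.toK_eq hx, unitAt_algebraMap, Scheme.mem_basicOpen _ _ _ hx]

/-- The point of the variety given by a prime of the coordinate ring. -/
def point (q : PrimeSpectrum Γ(X.X, c.U)) : X.X := c.affine.fromSpec q

theorem point_mem (q : PrimeSpectrum Γ(X.X, c.U)) : c.point q ∈ c.U := by
  have : c.point q ∈ Set.range c.affine.fromSpec := ⟨q, rfl⟩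
  rwa [c.affine.range_fromSpec] at this

theorem exists_point_eq {x : X.X} (hx : x ∈ c.U) : ∃ q, c.point q = x := by
  have : x ∈ Set.range c.affine.fromSpec := by rwa [c.affine.range_fromSpec]
  exact this

theorem unitAt_point_iff (q : PrimeSpectrum Γ(X.X, c.U)) (a : Γ(X.X, c.U)) :
    X.UnitAt (c.point q) (c.toK a) ↔ a ∉ q.asIdeal := by
  rw [c.unitAt_toK_iff (c.point_mem q)]
  have h := c.affine.fromSpec_preimage_basicOpen a
  change q ∈ c.affine.fromSpec ⁻¹ᵁ X.X.basicOpen a ↔ _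
  rw [h]
  rfl

theorem point_specializes_iff {p q : PrimeSpectrum Γ(X.X, c.U)} :
    c.point p ⤳ c.point q ↔ p ≤ q := by
  rw [PrimeSpectrum.le_iff_specializes]
  exact c.affine.fromSpec.isOpenEmbedding.isInducing.specializes_iff

theorem coheight_point (q : PrimeSpectrum Γ(X.X, c.U)) :
    (Order.coheight (c.point q) : ℕ∞) = q.asIdeal.height := by
  have h1 := coheight_eq_of_isOpenImmersion (x := show Spec Γ(X.X, c.U) from q) c.affine.fromSpec
  have h2 := idealHeight_eq_coheight Γ(X.X, c.U) q
  exact h1.trans h2.symm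

theorem vanishesAt_point_iff (q : PrimeSpectrum Γ(X.X, c.U)) (a : Γ(X.X, c.U)) :
    X.VanishesAt (c.point q) (c.toK a) ↔ a ∈ q.asIdeal := by
  rw [(c.regularAt_toK (c.point_mem q) a).vanishesAt_iff, c.unitAt_point_iff, not_not]

theorem exists_eq_div {x : X.X} (hx : x ∈ c.U) {φ : X.K} (hφ : X.RegularAt x φ) :
    ∃ a b, X.UnitAt x (c.toK b) ∧ φ = c.toK a / c.toK b := by
  obtain ⟨s, rfl⟩ := hφ
  let _ := X.X.presheaf.algebra_section_stalk (U := c.U) ⟨x, hx⟩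
  have := c.affine.isLocalization_stalk ⟨x, hx⟩
  obtain ⟨a, b, h⟩ := IsLocalization.exists_mk'_eq
    (c.affine.primeIdealOf ⟨x, hx⟩).asIdeal.primeCompl s
  have hb : IsUnit (X.X.presheaf.germ c.U x hx b.1) :=
    IsLocalization.map_units (X.X.presheaf.stalk x) b
  have hb' : X.UnitAt x (c.toK b.1) := by rwa [c.toK_eq hx, unitAt_algebraMap]
  refine ⟨a, b, hb', ?_⟩
  rw [eq_div_iff hb'.ne_zero, c.toK_eq hx, c.toK_eq hx, ← map_mul]
  congr 1
  rw [← h]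
  exact IsLocalization.mk'_spec (X.X.presheaf.stalk x) a b

/-- The coordinate ring as an algebra over the ground field. -/
@[reducible] def algebra : Algebra k Γ(X.X, c.U) :=
  RingHom.toAlgebra ((Scheme.ΓSpecIso (CommRingCat.of k)).inv ≫ X.str.appLE ⊤ c.U le_top).hom

theorem finiteType : letI := c.algebra; Algebra.FiniteType k Γ(X.X, c.U) := by
  let _ := c.algebra
  have h : (X.str.appLE ⊤ c.U le_top).hom.FiniteType :=
    X.str.finiteType_appLE (isAffineOpen_top _) c.affine _
  have h2 : ((Scheme.ΓSpecIso (CommRingCat.of k)).inv ≫ X.str.appLE ⊤ c.U le_top).hom.FiniteType := by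
    rw [CommRingCat.hom_comp]
    refine RingHom.FiniteType.comp h ?_
    exact RingHom.FiniteType.of_surjective _
      (ConcreteCategory.bijective_of_isIso (Scheme.ΓSpecIso (CommRingCat.of k)).inv).2
  exact h2

theorem toK_algebraMap (r : k) : letI := c.algebra; c.toK (algebraMap k _ r) = algebraMap k X.K r := by
  let _ := c.algebra
  have h : X.str.appLE ⊤ c.U le_top ≫ X.X.germToFunctionField c.U =
      X.str.appTop ≫ X.X.presheaf.germ ⊤ (genericPoint X.X) trivial := by
    change (X.str.appTop ≫ X.X.presheaf.map _) ≫ X.X.presheaf.germ c.U _ _ = _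
    rw [Category.assoc]
    exact congrArg (X.str.appTop ≫ ·) (X.X.presheaf.germ_res (homOfLE (le_top : c.U ≤ ⊤))
      (genericPoint X.X) _)
  exact congrArg (fun g => g.hom ((Scheme.ΓSpecIso (CommRingCat.of k)).inv.hom r)) h

end AffineChart

end NormalVariety

namespace NormalVariety

open TopologicalSpace

variable {k : Type u} [Field k] {X : NormalVariety k}

/-! ### Regular derivations and coordinates at a point -/

/-- A rational vector field is regular on an open set. -/
theorem isOpen_setOf_derRegularAt (D : X.Der) : IsOpen {x : X.X | X.DerRegularAt x D} := by
  rw [isOpen_iff_forall_mem_open]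
  intro x hx
  obtain ⟨c, hc⟩ := X.exists_affineChart x
  let _ := c.algebra
  obtain ⟨S, hS⟩ := c.finiteType
  refine ⟨c.U ∩ ⋂ a ∈ S, {y | X.RegularAt y (D (c.toK a))}, ?_, ?_, ?_⟩
  · rintro y ⟨hy, hyS⟩ φ hφ
    simp only [Set.mem_iInter, Set.mem_ofPred_eq] at hyS
    have key : ∀ a : Γ(X.X, c.U), X.RegularAt y (D (c.toK a)) := by
      intro a
      have ha : a ∈ Algebra.adjoin k (S : Set Γ(X.X, c.U)) := by rw [hS]; trivial
      induction ha using Algebra.adjoin_induction with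
      | mem a ha => exact hyS a ha
      | algebraMap r => rw [c.toK_algebraMap, D.map_algebraMap]; exact regularAt_zero y
      | add a b _ _ ha hb => rw [map_add, map_add]; exact ha.add hb
      | mul a b _ _ ha hb =>
        rw [map_mul, D.leibniz]
        exact ((c.regularAt_toK hy a).mul hb).add ((c.regularAt_toK hy b).mul ha)
    obtain ⟨a, b, hb, rfl⟩ := c.exists_eq_div hy hφ
    rw [div_eq_mul_inv, D.leibniz, D.leibniz_inv]
    refine ((c.regularAt_toK hy a).mul ?_).add (hb.inv.regularAt.mul (key a))
    rw [neg_smul, ← zero_sub]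
    exact (regularAt_zero y).sub ((hb.inv.regularAt.pow 2).mul (key b))
  · exact c.U.2.inter (S.finite_toSet.isOpen_biInter fun a _ => isOpen_setOf_regularAt _)
  · refine ⟨hc, ?_⟩
    simp only [Set.mem_iInter, Set.mem_ofPred_eq]
    exact fun a _ => hx _ (c.regularAt_toK hc a)

theorem essFiniteType_stalk (x : X.X) :
    letI := X.stalkAlgebra x
    Algebra.EssFiniteType k (X.X.presheaf.stalk x) := by
  let _ := X.stalkAlgebra x
  obtain ⟨c, hc⟩ := X.exists_affineChart x
  let _ := c.algebra
  let _ := X.X.presheaf.algebra_section_stalk (U := c.U) ⟨x, hc⟩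
  have := c.affine.isLocalization_stalk ⟨x, hc⟩
  have := c.finiteType
  have : IsScalarTower k Γ(X.X, c.U) (X.X.presheaf.stalk x) :=
    IsScalarTower.of_algebraMap_eq fun r => algebraMap_stalk_injective x <| by
      have := X.isScalarTower_stalk x
      rw [← IsScalarTower.algebraMap_apply k (X.X.presheaf.stalk x) X.K, ← c.toK_algebraMap,
        c.toK_eq hc]
      rfl
  have : Algebra.EssFiniteType Γ(X.X, c.U) (X.X.presheaf.stalk x) :=
    Algebra.EssFiniteType.of_isLocalization _
      (c.affine.primeIdealOf ⟨x, hc⟩).asIdeal.primeCompl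
  exact Algebra.EssFiniteType.comp k Γ(X.X, c.U) _

variable (X) in
theorem essFiniteType_functionField : Algebra.EssFiniteType k X.K := by
  let _ := X.stalkAlgebra (genericPoint X.X)
  have := X.isScalarTower_stalk (genericPoint X.X)
  have := essFiniteType_stalk (genericPoint X.X)
  exact IsFractionRing.essFiniteType k (X.X.presheaf.stalk (genericPoint X.X)) X.K

/-- The family `u` is a system of coordinates at `x`. -/
def IsCoordAt (x : X.X) {ι : Type*} [Fintype ι] [DecidableEq ι] (u : ι → X.K) : Prop :=
  IsCoordSystem (X.localSubalgebra x) u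

theorem isCoordAt_iff {x : X.X} {ι : Type*} [Fintype ι] [DecidableEq ι] {u : ι → X.K} :
    X.IsCoordAt x u ↔ (∀ i, X.RegularAt x (u i)) ∧ ∃ d : ι → X.Der,
      (∀ i j, d i (u j) = if i = j then 1 else 0) ∧ (∀ i, X.DerRegularAt x (d i)) ∧
      ∀ D : X.Der, D = ∑ i, D (u i) • d i := Iff.rfl

/-- Coordinates at a point are coordinates in a neighbourhood. -/
theorem isOpen_setOf_isCoordAt {ι : Type*} [Fintype ι] [DecidableEq ι] (u : ι → X.K) :
    IsOpen {x : X.X | X.IsCoordAt x u} := by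
  rw [isOpen_iff_forall_mem_open]
  intro x hx
  obtain ⟨h1, d, hd, hdr, hD⟩ := isCoordAt_iff.mp hx
  refine ⟨(⋂ i, {y | X.RegularAt y (u i)}) ∩ ⋂ i, {y | X.DerRegularAt y (d i)}, ?_, ?_, ?_⟩
  · rintro y ⟨hy1, hy2⟩
    simp only [Set.mem_iInter, Set.mem_ofPred_eq] at hy1 hy2
    exact isCoordAt_iff.mpr ⟨hy1, d, hd, hy2, hD⟩
  · exact (isOpen_iInter_of_finite fun i => isOpen_setOf_regularAt _).inter
      (isOpen_iInter_of_finite fun i => isOpen_setOf_derRegularAt _)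
  · simp only [Set.mem_inter_iff, Set.mem_iInter, Set.mem_ofPred_eq]
    exact ⟨h1, hdr⟩

theorem IsCoordAt.of_specializes {x y : X.X} (h : y ⤳ x) {ι : Type*} [Fintype ι] [DecidableEq ι]
    {u : ι → X.K} (hu : X.IsCoordAt x u) : X.IsCoordAt y u :=
  h.mem_open (isOpen_setOf_isCoordAt u) hu

theorem IsCoordAt.comp_equiv {x : X.X} {ι ι' : Type*} [Fintype ι] [DecidableEq ι] [Fintype ι']
    [DecidableEq ι'] {u : ι → X.K} (hu : X.IsCoordAt x u) (e : ι' ≃ ι) :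
    X.IsCoordAt x (u ∘ e) := by
  obtain ⟨h1, d, hd, hdr, hD⟩ := isCoordAt_iff.mp hu
  refine isCoordAt_iff.mpr ⟨fun i => h1 _, d ∘ e, fun i j => ?_, fun i => hdr _, fun D => ?_⟩
  · simp [hd]
  · rw [hD D]
    simp only [Function.comp_apply]
    rw [← hD D]
    exact (hD D).trans (Equiv.sum_comp e fun i => D (u i) • d i).symm

/-- Generators of the maximal ideal at `x`, as many as the dimension of the local ring, and lifts
of a transcendence basis of the residue field are coordinates at `x`. -/
theorem isCoordAt_sumElim [CharZero k] {x : X.X} {n e : ℕ} {s : Fin n → X.X.presheaf.stalk x}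
    (hs : Ideal.span (Set.range s) = IsLocalRing.maximalIdeal (X.X.presheaf.stalk x))
    (hn : n ≤ ringKrullDim (X.X.presheaf.stalk x)) {t : Fin e → X.X.presheaf.stalk x}
    (ht : letI := X.stalkAlgebra x
      IsTranscendenceBasis k (IsLocalRing.residue (X.X.presheaf.stalk x) ∘ t)) :
    X.IsCoordAt x (algebraMap (X.X.presheaf.stalk x) X.K ∘ Sum.elim s t) := by
  let _ := X.stalkAlgebra x
  have := X.isScalarTower_stalk x
  have := essFiniteType_stalk x
  exact IsLocalRing.isCoordSystem hs hn ht

/-! ### Prime divisors -/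

theorem lt_iff_specializes_and_ne {x y : X.X} : x < y ↔ y ⤳ x ∧ x ≠ y := by
  rw [lt_iff_le_not_ge]
  refine and_congr_right fun h => ?_
  refine ⟨fun h' he => h' (he ▸ specializes_rfl), fun h' h'' => h' (Specializes.antisymm h'' h).eq⟩

theorem coheight_genericPoint : Order.coheight (genericPoint X.X) = 0 :=
  Order.coheight_top X.X

theorem PrimeDivisor.ne_genericPoint (P : X.PrimeDivisor) : P.1 ≠ genericPoint X.X := by
  intro h
  have h1 : Order.coheight P.1 = 1 := P.2
  rw [h, coheight_genericPoint] at h1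
  exact zero_ne_one h1

theorem one_le_coheight {x : X.X} (hx : x ≠ genericPoint X.X) : 1 ≤ Order.coheight x := by
  have h := Order.coheight_add_one_le
    (lt_iff_specializes_and_ne.mpr ⟨genericPoint_specializes x, hx⟩)
  rwa [coheight_genericPoint, zero_add] at h

/-- A point that specializes to the generic point of a prime divisor is that point or the generic
point of the variety. -/
theorem PrimeDivisor.eq_or_eq_of_specializes (P : X.PrimeDivisor) {x : X.X} (h : x ⤳ P.1) :
    x = P.1 ∨ x = genericPoint X.X := by
  by_contra! hne
  have h3 := Order.coheight_add_one_le (lt_iff_specializes_and_ne.mpr ⟨h, hne.1.symm⟩)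
  have h4 := one_le_coheight hne.2
  rw [show Order.coheight P.1 = 1 from P.2] at h3
  have h6 : (1 : ℕ∞) + 1 ≤ 1 := (by gcongr : (1 : ℕ∞) + 1 ≤ Order.coheight x + 1).trans h3
  norm_num at h6

instance PrimeDivisor.isDiscreteValuationRing (P : X.PrimeDivisor) :
    IsDiscreteValuationRing (X.X.presheaf.stalk P.1) := by
  have hdim := ringKrullDim_stalk_eq_coheight P.1
  rw [P.2] at hdim
  have := X.normal P.1
  have hnf : ¬ IsField (X.X.presheaf.stalk P.1) := by
    intro hF
    rw [ringKrullDim_eq_zero_of_isField hF] at hdim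
    norm_num at hdim
  have hle : Ring.KrullDimLE 1 (X.X.presheaf.stalk P.1) :=
    Ring.krullDimLE_iff.mpr (by rw [hdim]; norm_num)
  have hmax := Ring.krullDimLE_one_iff_of_noZeroDivisors.mp hle
  have htfae := (IsDiscreteValuationRing.TFAE (X.X.presheaf.stalk P.1) hnf).out 0 3
  refine htfae.mpr ⟨this, IsLocalRing.maximalIdeal _, ⟨?_, inferInstance⟩, fun I ⟨hI, hI'⟩ =>
    IsLocalRing.eq_maximalIdeal (hmax I hI hI')⟩
  exact fun h => hnf (IsLocalRing.isField_iff_maximalIdeal_eq.mpr h)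

/-- A rational function that generates the maximal ideal of the local ring of a prime divisor. -/
def IsUniformizerAt (P : X.PrimeDivisor) (p : X.K) : Prop :=
  ∃ a : X.X.presheaf.stalk P.1, Irreducible a ∧ algebraMap _ X.K a = p

theorem PrimeDivisor.exists_isUniformizerAt (P : X.PrimeDivisor) : ∃ p, X.IsUniformizerAt P p := by
  obtain ⟨a, ha⟩ := IsDiscreteValuationRing.exists_irreducible (X.X.presheaf.stalk P.1)
  exact ⟨_, a, ha, rfl⟩

theorem IsUniformizerAt.ne_zero {P : X.PrimeDivisor} {p : X.K} (hp : X.IsUniformizerAt P p) :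
    p ≠ 0 := by
  obtain ⟨a, ha, rfl⟩ := hp
  exact (map_ne_zero_iff _ (algebraMap_stalk_injective P.1)).mpr ha.ne_zero

theorem IsUniformizerAt.vanishesAt {P : X.PrimeDivisor} {p : X.K} (hp : X.IsUniformizerAt P p) :
    X.VanishesAt P.1 p := by
  obtain ⟨a, ha, rfl⟩ := hp
  rw [vanishesAt_algebraMap, IsLocalRing.mem_maximalIdeal]
  exact ha.not_isUnit

/-- Every nonzero rational function is a unit times a power of a uniformizer. -/
theorem IsUniformizerAt.exists_eq_mul_zpow {P : X.PrimeDivisor} {p : X.K}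
    (hp : X.IsUniformizerAt P p) {φ : X.K} (hφ : φ ≠ 0) :
    ∃ (n : ℤ) (v : X.K), X.UnitAt P.1 v ∧ φ = v * p ^ n := by
  obtain ⟨a, ha, rfl⟩ := hp
  obtain ⟨n, v, hv⟩ := IsDiscreteValuationRing.exists_units_eq_smul_zpow_of_irreducible ha hφ
  refine ⟨n, algebraMap _ X.K (v : X.X.presheaf.stalk P.1), ⟨_, v.isUnit, rfl⟩, ?_⟩
  rw [hv, Units.smul_def, Algebra.smul_def]

theorem ord_mul (P : X.PrimeDivisor) {φ ψ : X.K} (hφ : φ ≠ 0) (hψ : ψ ≠ 0) :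
    X.ord (φ * ψ) P = X.ord φ P + X.ord ψ P := Scheme.ord_mul hφ hψ

theorem UnitAt.ord_eq_zero {P : X.PrimeDivisor} {φ : X.K} (h : X.UnitAt P.1 φ) :
    X.ord φ P = 0 := by
  obtain ⟨a, ha, rfl⟩ := h
  have h0 : algebraMap _ X.K a ≠ 0 := (ha.map _).ne_zero
  rw [ord, Scheme.ord_eq_iff P.2 h0]
  exact Ring.ordFrac_of_isUnit ha

theorem IsUniformizerAt.ord_eq_one {P : X.PrimeDivisor} {p : X.K} (hp : X.IsUniformizerAt P p) :
    X.ord p P = 1 := by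
  have h0 := hp.ne_zero
  obtain ⟨a, ha, rfl⟩ := hp
  rw [ord, Scheme.ord_eq_iff P.2 h0]
  exact Ring.ordFrac_irreducible ha

theorem ord_one (P : X.PrimeDivisor) : X.ord 1 P = 0 := (unitAt_one P.1).ord_eq_zero

theorem ord_inv (P : X.PrimeDivisor) (φ : X.K) : X.ord φ⁻¹ P = - X.ord φ P := by
  by_cases h : φ = 0
  · rw [h, inv_zero]
    simp [ord]
  · have := ord_mul P h (inv_ne_zero h)
    rw [mul_inv_cancel₀ h, ord_one] at this
    omega

theorem ord_pow (P : X.PrimeDivisor) {φ : X.K} (h : φ ≠ 0) (n : ℕ) :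
    X.ord (φ ^ n) P = n * X.ord φ P := by
  induction n with
  | zero => rw [pow_zero, ord_one]; simp
  | succ n ih => rw [pow_succ, ord_mul P (pow_ne_zero n h) h, ih]; push_cast; ring

theorem ord_zpow (P : X.PrimeDivisor) {φ : X.K} (h : φ ≠ 0) (n : ℤ) :
    X.ord (φ ^ n) P = n * X.ord φ P := by
  obtain ⟨n, rfl | rfl⟩ := n.eq_nat_or_neg
  · rw [zpow_natCast, ord_pow P h]
  · rw [zpow_neg, ord_inv, zpow_natCast, ord_pow P h]; ring

theorem IsUniformizerAt.exists_eq_mul_zpow_ord {P : X.PrimeDivisor} {p : X.K}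
    (hp : X.IsUniformizerAt P p) {φ : X.K} (hφ : φ ≠ 0) :
    ∃ v : X.K, X.UnitAt P.1 v ∧ φ = v * p ^ X.ord φ P := by
  obtain ⟨n, v, hv, h⟩ := hp.exists_eq_mul_zpow hφ
  have : X.ord φ P = n := by
    rw [h, ord_mul P hv.ne_zero (zpow_ne_zero n hp.ne_zero), hv.ord_eq_zero,
      ord_zpow P hp.ne_zero, hp.ord_eq_one]
    ring
  exact ⟨v, hv, by rw [this]; exact h⟩

theorem ord_nonneg_iff {P : X.PrimeDivisor} {φ : X.K} (hφ : φ ≠ 0) :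
    0 ≤ X.ord φ P ↔ X.RegularAt P.1 φ := by
  obtain ⟨p, hp⟩ := P.exists_isUniformizerAt
  have key : ∀ ψ : X.K, ψ ≠ 0 → 0 ≤ X.ord ψ P → X.RegularAt P.1 ψ := by
    intro ψ hψ h
    obtain ⟨v, hv, hvψ⟩ := hp.exists_eq_mul_zpow_ord hψ
    obtain ⟨n, hn⟩ := Int.eq_ofNat_of_zero_le h
    rw [hvψ, hn, zpow_natCast]
    exact hv.regularAt.mul (hp.vanishesAt.regularAt.pow n)
  refine ⟨key φ hφ, fun h => ?_⟩
  by_contra! hneg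
  have hinv : X.RegularAt P.1 φ⁻¹ := key _ (inv_ne_zero hφ) (by rw [ord_inv]; omega)
  have := (unitAt_iff.mpr ⟨hφ, h, hinv⟩).ord_eq_zero
  omega

theorem ord_eq_zero_iff {P : X.PrimeDivisor} {φ : X.K} (hφ : φ ≠ 0) :
    X.ord φ P = 0 ↔ X.UnitAt P.1 φ := by
  refine ⟨fun h => unitAt_iff.mpr ⟨hφ, (ord_nonneg_iff hφ).mp h.ge, ?_⟩, UnitAt.ord_eq_zero⟩
  rw [← ord_nonneg_iff (inv_ne_zero hφ), ord_inv, h, neg_zero]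

theorem one_le_ord_iff {P : X.PrimeDivisor} {φ : X.K} (hφ : φ ≠ 0) :
    1 ≤ X.ord φ P ↔ X.VanishesAt P.1 φ := by
  constructor
  · intro h
    rw [((ord_nonneg_iff hφ).mp (by omega)).vanishesAt_iff, ← ord_eq_zero_iff hφ]
    omega
  · intro h
    have h1 := (ord_nonneg_iff hφ).mpr h.regularAt
    have h2 := h.regularAt.vanishesAt_iff.mp h
    rw [← ord_eq_zero_iff hφ] at h2
    omega

end NormalVariety

namespace NormalVariety

open TopologicalSpace

variable {k : Type u} [Field k] {X Z : NormalVariety k}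

/-! ### Pullback of rational functions -/

namespace DominantMorphism

variable (f : DominantMorphism X Z)

theorem pullback_algebraMap (x : X.X) (a : Z.X.presheaf.stalk (f.hom x)) :
    f.pullback (algebraMap _ Z.K a) = algebraMap (X.X.presheaf.stalk x) X.K (f.hom.stalkMap x a) := by
  have h := Scheme.Hom.stalkSpecializes_stalkMap_apply f.hom (genericPoint X.X) x
    (genericPoint_specializes x) a
  refine Eq.trans ?_ h
  have h2 := Z.X.presheaf.stalkSpecializes_comp (specializes_of_eq f.map_genericPoint)
    (genericPoint_specializes (f.hom x))
  exact congrArg (fun g => f.hom.stalkMap (genericPoint X.X) (g.hom a)) h2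

theorem pullback_algebraMap_base (r : k) :
    f.pullback (algebraMap k Z.K r) = algebraMap k X.K r := by
  have h1 := Scheme.Hom.germ_stalkMap f.hom ⊤ (genericPoint X.X) trivial
  have h2 : Z.str.appTop ≫ f.hom.appTop = X.str.appTop := by
    rw [← f.comm]; rfl
  have h3 := Z.X.presheaf.germ_stalkSpecializes (U := ⊤) trivial
    (specializes_of_eq f.map_genericPoint)
  have h4 : (Z.str.appTop ≫ Z.X.presheaf.germ ⊤ (genericPoint Z.X) trivial) ≫
      (Z.X.presheaf.stalkSpecializes (specializes_of_eq f.map_genericPoint) ≫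
        f.hom.stalkMap (genericPoint X.X)) =
      X.str.appTop ≫ X.X.presheaf.germ ⊤ (genericPoint X.X) trivial := by
    rw [← h2]
    refine (Category.assoc _ _ _).trans (Eq.trans ?_ (Category.assoc _ _ _).symm)
    exact congrArg (Z.str.appTop ≫ ·) ((Category.assoc _ _ _).symm.trans
      ((congrArg (· ≫ f.hom.stalkMap (genericPoint X.X)) h3).trans h1))
  exact congrArg (fun g => g.hom ((Scheme.ΓSpecIso (CommRingCat.of k)).inv.hom r)) h4

theorem pullback_ne_zero {φ : Z.K} (h : φ ≠ 0) : f.pullback φ ≠ 0 :=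
  (map_ne_zero f.pullback).mpr h

theorem regularAt_pullback {x : X.X} {φ : Z.K} (h : Z.RegularAt (f.hom x) φ) :
    X.RegularAt x (f.pullback φ) := by
  obtain ⟨a, rfl⟩ := h
  exact ⟨_, (f.pullback_algebraMap x a).symm⟩

theorem unitAt_pullback {x : X.X} {φ : Z.K} (h : Z.UnitAt (f.hom x) φ) :
    X.UnitAt x (f.pullback φ) := by
  obtain ⟨a, ha, rfl⟩ := h
  exact ⟨_, ha.map (f.hom.stalkMap x).hom, (f.pullback_algebraMap x a).symm⟩

theorem vanishesAt_pullback_iff {x : X.X} {φ : Z.K} (h : Z.RegularAt (f.hom x) φ) :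
    X.VanishesAt x (f.pullback φ) ↔ Z.VanishesAt (f.hom x) φ := by
  rw [h.vanishesAt_iff, (f.regularAt_pullback h).vanishesAt_iff, not_iff_not]
  refine ⟨?_, f.unitAt_pullback⟩
  obtain ⟨a, rfl⟩ := h
  rw [f.pullback_algebraMap, unitAt_algebraMap, unitAt_algebraMap]
  exact fun h => (isUnit_map_iff (f.hom.stalkMap x).hom a).mp h

/-- The homomorphism of local rings as a homomorphism of algebras over the ground field. -/
def stalkMapₐ (x : X.X) :
    letI := Z.stalkAlgebra (f.hom x)
    letI := X.stalkAlgebra x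
    Z.X.presheaf.stalk (f.hom x) →ₐ[k] X.X.presheaf.stalk x :=
  letI := Z.stalkAlgebra (f.hom x)
  letI := X.stalkAlgebra x
  { (f.hom.stalkMap x).hom with
    commutes' := fun r => algebraMap_stalk_injective x <| by
      have := X.isScalarTower_stalk x
      have := Z.isScalarTower_stalk (f.hom x)
      change algebraMap _ X.K (f.hom.stalkMap x (algebraMap k _ r)) = _
      rw [← f.pullback_algebraMap, ← IsScalarTower.algebraMap_apply k _ Z.K,
        f.pullback_algebraMap_base, ← IsScalarTower.algebraMap_apply k _ X.K] }

/-! ### Multiplicities of fibres over prime divisors -/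

/-- The order along `E` of the pullback of a rational function is the product of the order of the
function along the image of `E` and the order of the pullback of a uniformizer. -/
theorem ord_pullback {E : X.PrimeDivisor} {P : Z.PrimeDivisor} (h : f.hom E.1 = P.1) {p : Z.K}
    (hp : Z.IsUniformizerAt P p) {φ : Z.K} (hφ : φ ≠ 0) :
    X.ord (f.pullback φ) E = X.ord (f.pullback p) E * Z.ord φ P := by
  obtain ⟨v, hv, hvφ⟩ := hp.exists_eq_mul_zpow_ord hφ
  have hv' : X.UnitAt E.1 (f.pullback v) := f.unitAt_pullback (by rw [h]; exact hv)
  have hp' := f.pullback_ne_zero hp.ne_zero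
  conv_lhs => rw [hvφ, map_mul, map_zpow₀]
  rw [X.ord_mul E hv'.ne_zero (zpow_ne_zero _ hp'), hv'.ord_eq_zero, ord_zpow E hp']
  ring

theorem ord_pullback_of_isHorizontal {E : X.PrimeDivisor} (h : f.IsHorizontal E) {φ : Z.K}
    (hφ : φ ≠ 0) : X.ord (f.pullback φ) E = 0 := by
  refine (f.unitAt_pullback ?_).ord_eq_zero
  rw [show f.hom E.1 = genericPoint Z.X from h]
  exact unitAt_iff.mpr ⟨hφ, regularAt_genericPoint _, regularAt_genericPoint _⟩

/-- The multiplicity of the prime divisor `E` in the pullback of its image `P`. -/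
def mult (E : X.PrimeDivisor) (P : Z.PrimeDivisor) : ℤ :=
  X.ord (f.pullback P.exists_isUniformizerAt.choose) E

theorem ord_pullback_eq_mult_mul {E : X.PrimeDivisor} {P : Z.PrimeDivisor} (h : f.hom E.1 = P.1)
    {φ : Z.K} (hφ : φ ≠ 0) : X.ord (f.pullback φ) E = f.mult E P * Z.ord φ P :=
  f.ord_pullback h P.exists_isUniformizerAt.choose_spec hφ

theorem one_le_mult {E : X.PrimeDivisor} {P : Z.PrimeDivisor} (h : f.hom E.1 = P.1) :
    1 ≤ f.mult E P := by
  have hp := P.exists_isUniformizerAt.choose_spec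
  rw [mult, one_le_ord_iff (f.pullback_ne_zero hp.ne_zero), f.vanishesAt_pullback_iff, h]
  · exact hp.vanishesAt
  · rw [h]; exact hp.vanishesAt.regularAt

/-- Every prime divisor of the target of a surjective morphism is dominated by a prime divisor of
the source: a component of the zero locus of the pullback of a local equation. -/
theorem exists_primeDivisor_over (hf : Function.Surjective f.hom) (P : Z.PrimeDivisor) :
    ∃ E : X.PrimeDivisor, f.hom E.1 = P.1 := by
  obtain ⟨x, hx⟩ := hf P.1
  obtain ⟨p, hp⟩ := P.exists_isUniformizerAt
  obtain ⟨c, hc⟩ := X.exists_affineChart x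
  have hpx : Z.RegularAt (f.hom x) p := by rw [hx]; exact hp.vanishesAt.regularAt
  have hvx : X.VanishesAt x (f.pullback p) := by
    rw [f.vanishesAt_pullback_iff hpx, hx]; exact hp.vanishesAt
  obtain ⟨a, b, hb, hab⟩ := c.exists_eq_div hc hvx.regularAt
  obtain ⟨Q, rfl⟩ := c.exists_point_eq hc
  have hb0 := hb.ne_zero
  have ha : c.toK a = f.pullback p * c.toK b := by rw [hab, div_mul_cancel₀ _ hb0]
  have haQ : a ∈ Q.asIdeal := by
    rw [← c.vanishesAt_point_iff, ha]
    obtain ⟨s, hs, hs'⟩ := hvx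
    obtain ⟨t, ht⟩ := hb.regularAt
    exact ⟨s * t, Ideal.mul_mem_right _ _ hs, by rw [map_mul, hs', ht]⟩
  obtain ⟨q, hq, hqQ⟩ := Ideal.exists_minimalPrimes_le
    ((Ideal.span_singleton_le_iff_mem (I := Q.asIdeal)).mpr haQ)
  have hqp : q.IsPrime := hq.1.1
  have haq : a ∈ q := hq.1.2 (Ideal.mem_span_singleton_self a)
  let q' : PrimeSpectrum Γ(X.X, c.U) := ⟨q, hqp⟩
  have : IsNoetherianRing Γ(X.X, c.U) := IsLocallyNoetherian.component_noetherian ⟨c.U, c.affine⟩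
  have hheight : q.height ≤ 1 := Ideal.height_le_one_of_isPrincipal_of_mem_minimalPrimes _ q hq
  have hspec : c.point q' ⤳ c.point Q := c.point_specializes_iff.mpr hqQ
  have hbq : X.UnitAt (c.point q') (c.toK b) := hb.of_specializes hspec
  have hvq : X.VanishesAt (c.point q') (f.pullback p) := by
    have h1 := (c.vanishesAt_point_iff q' a).mpr haq
    rw [hab]
    obtain ⟨s, hs, hs'⟩ := h1
    obtain ⟨t, ht⟩ := hbq.inv.regularAt
    exact ⟨s * t, Ideal.mul_mem_right _ _ hs, by rw [map_mul, hs', ht, div_eq_mul_inv]⟩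
  have hne : c.point q' ≠ genericPoint X.X := by
    intro h
    rw [hvq.regularAt.vanishesAt_iff] at hvq
    apply hvq
    rw [h]
    exact unitAt_iff.mpr ⟨f.pullback_ne_zero hp.ne_zero, regularAt_genericPoint _,
      regularAt_genericPoint _⟩
  have hco : Order.coheight (c.point q') = 1 :=
    le_antisymm (by rw [c.coheight_point]; exact hheight) (one_le_coheight hne)
  refine ⟨⟨c.point q', hco⟩, ?_⟩
  have hfs : f.hom (c.point q') ⤳ P.1 := by
    rw [← hx]; exact hspec.map f.hom.continuous
  refine (P.eq_or_eq_of_specializes hfs).resolve_right fun h => ?_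
  have hreg : Z.RegularAt (f.hom (c.point q')) p := by rw [h]; exact regularAt_genericPoint _
  rw [f.vanishesAt_pullback_iff hreg, hreg.vanishesAt_iff, h] at hvq
  exact hvq (unitAt_iff.mpr ⟨hp.ne_zero, regularAt_genericPoint _, regularAt_genericPoint _⟩)

end DominantMorphism

variable (X) in
instance : NoetherianSpace X.X := by
  have : CompactSpace X.X := by
    have := QuasiCompact.isCompact_preimage (f := X.str) Set.univ isOpen_univ isCompact_univ
    exact ⟨by simpa using this⟩
  have : IsNoetherian X.X := {}
  infer_instance

/-- Only finitely many prime divisors are contained in the complement of a nonempty open set. -/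
theorem finite_setOf_primeDivisor_notMem (U : X.X.Opens) (hU : genericPoint X.X ∈ U) :
    {P : X.PrimeDivisor | P.1 ∉ U}.Finite := by
  obtain ⟨S, hS, hcl, hirr, hcov⟩ := NoetherianSpace.exists_finite_set_isClosed_irreducible
    (isClosed_compl_iff.mpr U.isOpen)
  have hmem : ∀ P : X.PrimeDivisor, P.1 ∉ U → closure {P.1} ∈ S := by
    intro P hP
    have hP' : P.1 ∈ ⋃₀ S := hcov ▸ hP
    obtain ⟨t, ht, hPt⟩ := hP'
    obtain ⟨c, hc⟩ := QuasiSober.sober (hirr t ht) (hcl t ht)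
    have hcU : c ∉ U := by
      have : c ∈ ⋃₀ S := ⟨t, ht, hc.mem⟩
      rw [← hcov] at this
      exact this
    have h1 : c ⤳ P.1 := hc.specializes hPt
    rcases P.eq_or_eq_of_specializes h1 with h | h
    · rw [← h, hc.def]; exact ht
    · exact absurd (h ▸ hU) hcU
  refine Set.Finite.of_finite_image (f := fun P : X.PrimeDivisor => closure {P.1})
    (hS.subset ?_) ?_
  · rintro _ ⟨P, hP, rfl⟩
    exact hmem P hP
  · intro P _ Q _ h
    exact Subtype.ext ((inseparable_iff_closure_eq.mpr h).eq)

end NormalVariety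

namespace NormalVariety

variable {k : Type u} [Field k] {X Z : NormalVariety k}

theorem regularAt_prod {x : X.X} {ι : Type*} {s : Finset ι} {φ : ι → X.K}
    (h : ∀ i ∈ s, X.RegularAt x (φ i)) : X.RegularAt x (∏ i ∈ s, φ i) :=
  Finset.prod_induction _ (X.RegularAt x) (fun _ _ => RegularAt.mul) (regularAt_one x) h

theorem regularAt_det {x : X.X} {ι : Type*} [Fintype ι] [DecidableEq ι] {M : Matrix ι ι X.K}
    (h : ∀ i j, X.RegularAt x (M i j)) : X.RegularAt x M.det := by
  rw [Matrix.det_apply']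
  refine RegularAt.sum fun σ _ => ?_
  refine RegularAt.mul ?_ (regularAt_prod fun i _ => h _ _)
  rcases Int.units_eq_one_or (Equiv.Perm.sign σ) with h | h
  · rw [h]; simpa using regularAt_one x
  · rw [h]; simpa using (regularAt_zero x).sub (regularAt_one x)

/-! ### Frames -/

/-- Let `T ⊆ V` be the stalk at `x` and the generic stalk of a sheaf of rational vector fields. The
family `b` is a frame at `x`: it is a basis of the stalk over the local ring and linearly
independent over the function field. -/
structure IsFrameAt (x : X.X) (V : Submodule X.K X.Der) (T : Set X.Der) {ι : Type*} [Fintype ι]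
    (b : ι → X.Der) : Prop where
  mem : ∀ i, b i ∈ T
  mem_generic : ∀ i, b i ∈ V
  linearIndependent : LinearIndependent X.K b
  exists_eq_sum : ∀ D ∈ T, D ∈ V → ∃ c : ι → X.K, (∀ i, X.RegularAt x (c i)) ∧ D = ∑ i, c i • b i

theorem IsFrameAt.comp_equiv {x : X.X} {V : Submodule X.K X.Der} {T : Set X.Der} {ι ι' : Type*}
    [Fintype ι] [Fintype ι'] {b : ι → X.Der} (h : X.IsFrameAt x V T b) (e : ι' ≃ ι) :
    X.IsFrameAt x V T (b ∘ e) where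
  mem i := h.mem _
  mem_generic i := h.mem_generic _
  linearIndependent := h.linearIndependent.comp _ e.injective
  exists_eq_sum D hD hV := by
    obtain ⟨c, hc, hD⟩ := h.exists_eq_sum D hD hV
    exact ⟨c ∘ e, fun i => hc _, hD.trans (Equiv.sum_comp e fun i => c i • b i).symm⟩

section Det

variable {V : Submodule X.K X.Der} {T : X.X → Set X.Der}

/-- The alternating form `v ↦ det (vᵢ(wⱼ))`, that is `dw₁ ∧ ⋯ ∧ dwᵣ`, on a space of rational
vector fields. -/
def wedge (V : Submodule X.K X.Der) {ι : Type*} [Fintype ι] [DecidableEq ι] (w : ι → X.K) :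
    V [⋀^ι]→ₗ[X.K] X.K :=
  (Matrix.detRowAlternating (R := X.K) (n := ι)).compLinearMap
    ((Derivation.evalFamily w).comp V.subtype)

/-- The order of an alternating form along a prime divisor is computed by a frame. -/
theorem IsFrameAt.isLeast {P : X.PrimeDivisor} {ι : Type*} [Fintype ι] [DecidableEq ι]
    {b : ι → V} (hb : X.IsFrameAt P.1 V (T P.1) (fun i => (b i : X.Der)))
    {η : V [⋀^ι]→ₗ[X.K] X.K} (hη : η b ≠ 0) :
    IsLeast {j : ℤ | ∃ v : ι → V, (∀ i, (v i : X.Der) ∈ T P.1) ∧ η v ≠ 0 ∧ j = X.ord (η v) P}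
      (X.ord (η b) P) := by
  refine ⟨⟨b, hb.mem, hη, rfl⟩, ?_⟩
  rintro _ ⟨v, hv, hv0, rfl⟩
  choose c hc hvc using fun i => hb.exists_eq_sum (v i) (hv i) (v i).2
  let L : (ι → X.K) →ₗ[X.K] V := Fintype.linearCombination X.K b
  have h1 : v = fun i => L (c i) := by
    funext i
    apply Subtype.ext
    rw [hvc i]
    simp [L, Fintype.linearCombination_apply]
  have h2 : η v = η b * Matrix.det (.of c) := by
    have h3 := congrArg (fun g => g c)
      ((η.compLinearMap L).eq_smul_basis_det (Pi.basisFun X.K ι))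
    rw [Pi.basisFun_det] at h3
    rw [h1]
    refine h3.trans ?_
    simp only [AlternatingMap.smul_apply, AlternatingMap.compLinearMap_apply, smul_eq_mul,
      Pi.basisFun_apply]
    congr 2
    funext i
    simp [L, Fintype.linearCombination_apply, Pi.single_apply]
  rw [h2] at hv0 ⊢
  have h0 := right_ne_zero_of_mul hv0
  rw [ord_mul P hη h0]
  have := (ord_nonneg_iff (P := P) h0).mpr (regularAt_det fun i j => hc i j)
  omega

theorem wedge_comp_equiv {ι ι' : Type*} [Fintype ι] [DecidableEq ι] [Fintype ι'] [DecidableEq ι']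
    (w : ι → X.K) (v : ι → V) (e : ι' ≃ ι) : wedge V (w ∘ e) (v ∘ e) = wedge V w v :=
  Matrix.det_submatrix_equiv_self e (.of fun i j => (v i : X.Der) (w j))

/-- If the functions `w` separate the vector fields in `V`, their wedge product does not vanish on
bases of `V`. -/
theorem wedge_ne_zero {ι : Type*} [Fintype ι] [DecidableEq ι] {w : ι → X.K}
    (hw : ∀ D ∈ V, (∀ i, D (w i) = 0) → D = 0) {v : ι → V} (hv : LinearIndependent X.K v) :
    wedge V w v ≠ 0 := by
  have hinj : Function.Injective ((Derivation.evalFamily w).comp V.subtype) := by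
    rw [← LinearMap.ker_eq_bot, LinearMap.ker_eq_bot']
    exact fun D hD => Subtype.ext (hw D D.2 fun i => congrFun hD i)
  have h := hv.map' _ (LinearMap.ker_eq_bot.mpr hinj)
  exact ((Matrix.isUnit_iff_isUnit_det _).mp
    (Matrix.linearIndependent_rows_iff_isUnit.mp h)).ne_zero

/-- The coefficients of the divisor of a rational section of `(det T)^*`, in terms of frames. -/
theorem IsDetDualDivisor.exists_ord_eq {D : X.RDivisor} (hD : X.IsDetDualDivisor V T D)
    {ι : Type*} [Fintype ι] [DecidableEq ι] (hcard : Fintype.card ι = Module.finrank X.K V)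
    [Module.Finite X.K V] {w : ι → X.K} (hw : ∀ D ∈ V, (∀ i, D (w i) = 0) → D = 0) :
    ∃ c : X.K, c ≠ 0 ∧ ∀ (P : X.PrimeDivisor) (b : ι → X.Der), X.IsFrameAt P.1 V (T P.1) b →
      Matrix.det (.of fun i j => b i (w j)) ≠ 0 ∧
      D P = X.ord c P + X.ord (Matrix.det (.of fun i j => b i (w j))) P := by
  obtain ⟨η, hη, hD⟩ := hD
  let e : Fin (Module.finrank X.K V) ≃ ι := (Fintype.equivFinOfCardEq hcard).symm
  let β := Module.finBasis X.K V
  have hwe : wedge V (w ∘ e) β ≠ 0 :=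
    wedge_ne_zero (fun D hD h => hw D hD fun i => by simpa using h (e.symm i)) β.linearIndependent
  have hηβ : η β ≠ 0 := fun h => hη <| by rw [η.eq_smul_basis_det β, h, zero_smul]
  refine ⟨η β / wedge V (w ∘ e) β, div_ne_zero hηβ hwe, fun P b hb => ?_⟩
  let b' : ι → V := fun i => ⟨b i, hb.mem_generic i⟩
  have hb' : LinearIndependent X.K b' := hb.linearIndependent.of_comp V.subtype
  have hdet : wedge V w b' ≠ 0 := wedge_ne_zero hw hb'
  refine ⟨hdet, ?_⟩
  have hηb : η (b' ∘ e) = η β / wedge V (w ∘ e) β * wedge V w b' := by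
    rw [← wedge_comp_equiv w b' e, η.eq_smul_basis_det β,
      (wedge V (w ∘ e)).eq_smul_basis_det β]
    simp only [AlternatingMap.smul_apply, smul_eq_mul, β.det_self, mul_one]
    field_simp
  have hηb0 : η (b' ∘ e) ≠ 0 := by
    rw [hηb]
    exact mul_ne_zero (div_ne_zero hηβ hwe) hdet
  obtain ⟨n, hn, hleast⟩ := hD P
  have h1 := hleast.unique (IsFrameAt.isLeast (b := b' ∘ e) (hb.comp_equiv e) hηb0)
  rw [hn, h1, hηb, ord_mul P (div_ne_zero hηβ hwe) hdet]
  push_cast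
  rfl

/-- A divisor that is given by frames as the divisor of the form `dw₁ ∧ ⋯ ∧ dwᵣ`. -/
theorem isDetDualDivisor_of_frames {D : X.RDivisor} {ι : Type*} [Fintype ι] [DecidableEq ι]
    (hcard : Fintype.card ι = Module.finrank X.K V) [Module.Finite X.K V] {w : ι → X.K}
    (hw : ∀ D ∈ V, (∀ i, D (w i) = 0) → D = 0)
    (hD : ∀ P : X.PrimeDivisor, ∃ b : ι → X.Der, X.IsFrameAt P.1 V (T P.1) b ∧
      D P = X.ord (Matrix.det (.of fun i j => b i (w j))) P) :
    X.IsDetDualDivisor V T D := by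
  let e : Fin (Module.finrank X.K V) ≃ ι := (Fintype.equivFinOfCardEq hcard).symm
  have hwe : ∀ D ∈ V, (∀ i, D ((w ∘ e) i) = 0) → D = 0 :=
    fun D hD h => hw D hD fun i => by simpa using h (e.symm i)
  let β := Module.finBasis X.K V
  refine ⟨wedge V (w ∘ e), fun h => wedge_ne_zero hwe β.linearIndependent (by rw [h]; rfl), ?_⟩
  intro P
  obtain ⟨b, hb, hDP⟩ := hD P
  let b' : ι → V := fun i => ⟨b i, hb.mem_generic i⟩
  have hb' : LinearIndependent X.K b' := hb.linearIndependent.of_comp V.subtype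
  refine ⟨_, hDP, ?_⟩
  have h1 := IsFrameAt.isLeast (b := b' ∘ e) (hb.comp_equiv e)
    (wedge_ne_zero hwe (hb'.comp e e.injective))
  rw [wedge_comp_equiv] at h1
  exact h1

end Det

end NormalVariety

namespace NormalVariety

variable {k : Type u} [Field k] {X Z : NormalVariety k}

theorem derivation_sum_apply {ι : Type*} (s : Finset ι) (D : ι → X.Der) (φ : X.K) :
    (∑ i ∈ s, D i) φ = ∑ i ∈ s, D i φ :=
  map_sum (AddMonoidHom.mk' (fun D : X.Der => D φ) fun _ _ => rfl) D s

theorem VanishesAt.sub {x : X.X} {φ ψ : X.K} (hφ : X.VanishesAt x φ) (hψ : X.VanishesAt x ψ) :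
    X.VanishesAt x (φ - ψ) := by
  obtain ⟨a, ha, rfl⟩ := hφ
  obtain ⟨b, hb, rfl⟩ := hψ
  exact ⟨a - b, Ideal.sub_mem _ ha hb, map_sub _ _ _⟩

theorem VanishesAt.mul_right {x : X.X} {φ ψ : X.K} (hφ : X.VanishesAt x φ) (hψ : X.RegularAt x ψ) :
    X.VanishesAt x (φ * ψ) := by
  obtain ⟨a, ha, rfl⟩ := hφ
  obtain ⟨b, rfl⟩ := hψ
  exact ⟨a * b, Ideal.mul_mem_right _ _ ha, map_mul _ _ _⟩

theorem UnitAt.add_vanishesAt {x : X.X} {φ ψ : X.K} (hφ : X.UnitAt x φ) (hψ : X.VanishesAt x ψ) :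
    X.UnitAt x (φ + ψ) := by
  by_contra h
  rw [← (hφ.regularAt.add hψ.regularAt).vanishesAt_iff.not_left] at h
  exact (hφ.regularAt.vanishesAt_iff.mp (by simpa using (not_not.mp h).sub hψ)) hφ

theorem unitAt_natCast [CharZero k] (x : X.X) {m : ℕ} (hm : m ≠ 0) : X.UnitAt x (m : X.K) := by
  let _ := X.stalkAlgebra x
  have := X.isScalarTower_stalk x
  have h : (m : X.K) = algebraMap (X.X.presheaf.stalk x) X.K (algebraMap k _ (m : k)) := by
    rw [← IsScalarTower.algebraMap_apply k _ X.K, map_natCast]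
  rw [h, unitAt_algebraMap]
  exact (IsUnit.mk0 (m : k) (Nat.cast_ne_zero.mpr hm)).map _

theorem IsCoordAt.isFrameAt {x : X.X} {ι : Type*} [Fintype ι] [DecidableEq ι] {u : ι → X.K}
    (hu : X.IsCoordAt x u) : ∃ d : ι → X.Der, (∀ i j, d i (u j) = if i = j then 1 else 0) ∧
      (∀ D : X.Der, D = ∑ i, D (u i) • d i) ∧ X.IsFrameAt x ⊤ {D | X.DerRegularAt x D} d := by
  obtain ⟨h1, d, hd, hdr, hD⟩ := isCoordAt_iff.mp hu
  refine ⟨d, hd, hD, hdr, fun _ => trivial, ?_, fun D hDr _ => ⟨_, fun i => hDr _ (h1 i), hD D⟩⟩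
  rw [Fintype.linearIndependent_iff]
  intro g hg i
  have := congrArg (fun D : X.Der => D (u i)) hg
  simpa [derivation_sum_apply, hd] using this

/-- Coordinates at the generic point of a prime divisor, one of which is a local equation `q`,
can be changed so that `q` is replaced by a function `p = v * q ^ m` with `v` a unit, up to the
factor `q ^ (m - 1)`: as `dp = q ^ (m - 1) (m v dq + q dv)` and `m` is invertible, the form
`dp / q ^ (m - 1)` together with the differentials of the other coordinates is a basis. -/
theorem IsCoordAt.exists_frame_of_eq_mul_pow [CharZero k] {E : X.PrimeDivisor} {ι : Type*}
    [Fintype ι] [DecidableEq ι] {u : Option ι → X.K} (hu : X.IsCoordAt E.1 u)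
    (hq : X.IsUniformizerAt E (u none)) {p v : X.K} {m : ℕ} (hm : m ≠ 0) (hv : X.UnitAt E.1 v)
    (hp : p = v * u none ^ m) :
    ∃ b : Option ι → X.Der, (∀ i j, b (some i) (u (some j)) = if i = j then 1 else 0) ∧
      (∀ i, b (some i) p = 0) ∧ (∀ j, b none (u (some j)) = 0) ∧ b none p = u none ^ (m - 1) ∧
      X.IsFrameAt E.1 ⊤ {D | X.DerRegularAt E.1 D} b := by
  obtain ⟨h1, d, hd, hdr, hD⟩ := isCoordAt_iff.mp hu
  set q := u none with hqdef
  let ω : X.Der → X.K := fun D => m * v * D q + q * D v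
  have hDp : ∀ D : X.Der, D p = q ^ (m - 1) * ω D := by
    intro D
    have : q ^ m = q ^ (m - 1) * q := by rw [← pow_succ, Nat.sub_add_cancel (by omega)]
    rw [hp, D.leibniz, D.leibniz_pow, this]
    simp only [ω, smul_eq_mul, nsmul_eq_mul]
    ring
  have hε : X.UnitAt E.1 (ω (d none)) := by
    have h2 : ω (d none) = m * v + q * d none v := by simp [ω, hqdef, hd]
    rw [h2]
    exact ((unitAt_natCast E.1 hm).mul hv).add_vanishesAt
      (hq.vanishesAt.mul_right (hdr _ _ hv.regularAt))
  set ε := ω (d none)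
  have hε0 : ε ≠ 0 := hε.ne_zero
  let b : Option ι → X.Der := fun o => o.elim (ε⁻¹ • d none)
    fun i => d (some i) - (q * d (some i) v / ε) • d none
  have hωd : ∀ i, ω (d (some i)) = q * d (some i) v := fun i => by simp [ω, hqdef, hd]
  have hω : ∀ (D D' : X.Der) (c : X.K), ω (D - c • D') = ω D - c * ω D' := by
    intro D D' c
    simp only [ω, Derivation.sub_apply, Derivation.smul_apply, smul_eq_mul]
    ring
  have hω' : ∀ (D' : X.Der) (c : X.K), ω (c • D') = c * ω D' := by
    intro D' c
    simp only [ω, Derivation.smul_apply, smul_eq_mul]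
    ring
  have hbs : ∀ i, ω (b (some i)) = 0 := by
    intro i
    simp only [b, Option.elim, hω, hωd]
    field_simp
    simp [ε]
  have hbn : ω (b none) = 1 := by
    simp only [b, Option.elim, hω']
    exact inv_mul_cancel₀ hε0
  have hbu : ∀ i j, b (some i) (u (some j)) = if i = j then 1 else 0 := by
    intro i j
    simp [b, Derivation.sub_apply, Derivation.smul_apply, hd]
  have hbnu : ∀ j, b none (u (some j)) = 0 := by
    intro j
    simp [b, Derivation.smul_apply, hd]
  have hsum : ∀ D : X.Der, D = ω D • b none + ∑ i, D (u (some i)) • b (some i) := by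
    intro D
    have h3 := hD D
    rw [Fintype.sum_option] at h3
    have h4 : ω D = D q * ε + ∑ i, D (u (some i)) * (q * d (some i) v) := by
      have h5 : D v = D q * d none v + ∑ i, D (u (some i)) * d (some i) v := by
        conv_lhs => rw [h3]
        simp [derivation_sum_apply, hqdef]
      have h6 : ε = m * v + q * d none v := by simp [ε, ω, hqdef, hd]
      have h7 : ∑ i, D (u (some i)) * (q * d (some i) v) =
          q * ∑ i, D (u (some i)) * d (some i) v := by
        rw [Finset.mul_sum]; exact Finset.sum_congr rfl fun _ _ => by ring
      rw [h7, h6]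
      simp only [ω, h5]
      ring
    have h8 : ω D • b none = D q • d none + ∑ i, (D (u (some i)) * (q * d (some i) v / ε)) • d none := by
      simp only [b, Option.elim]
      rw [← Finset.sum_smul, ← add_smul, smul_smul, h4]
      congr 1
      rw [add_mul, Finset.sum_mul]
      congr 1
      · field_simp
      · exact Finset.sum_congr rfl fun _ _ => by field_simp
    rw [h8]
    conv_lhs => rw [h3]
    rw [add_assoc, ← Finset.sum_add_distrib]
    congr 1
    refine Finset.sum_congr rfl fun i _ => ?_
    simp only [b, Option.elim]
    rw [smul_sub, smul_smul]
    abel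
  have hreg : ∀ o, X.DerRegularAt E.1 (b o) := by
    intro o φ hφ
    cases o with
    | none => exact hε.inv.regularAt.mul (hdr _ _ hφ)
    | some i =>
      refine (hdr _ _ hφ).sub (RegularAt.mul ?_ (hdr _ _ hφ))
      rw [div_eq_mul_inv]
      exact (hq.vanishesAt.regularAt.mul (hdr _ _ hv.regularAt)).mul hε.inv.regularAt
  refine ⟨b, hbu, fun i => by rw [hDp, hbs, mul_zero], hbnu, by rw [hDp, hbn, mul_one],
    hreg, fun _ => trivial, ?_, fun D hDr _ => ?_⟩
  · rw [Fintype.linearIndependent_iff]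
    intro g hg
    rw [Fintype.sum_option] at hg
    have hsome : ∀ i, g (some i) = 0 := by
      intro i
      have := congrArg (fun D : X.Der => D (u (some i))) hg
      simpa [derivation_sum_apply, hbu, hbnu] using this
    have hnone : g none = 0 := by
      simp only [hsome, zero_smul, Finset.sum_const_zero, add_zero] at hg
      have := congrArg ω hg
      rw [hω', hbn, mul_one] at this
      simpa [ω] using this
    intro o
    cases o with
    | none => exact hnone
    | some i => exact hsome i
  · refine ⟨fun o => o.elim (ω D) fun i => D (u (some i)), ?_, ?_⟩
    · intro o
      cases o with
      | none =>
        have h2 := unitAt_natCast (X := X) E.1 hm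
        exact ((h2.regularAt.mul hv.regularAt).mul (hDr _ hq.vanishesAt.regularAt)).add
          (hq.vanishesAt.regularAt.mul (hDr _ hv.regularAt))
      | some i => exact hDr _ (h1 _)
    · rw [Fintype.sum_option]
      exact hsum D

namespace DominantMorphism

variable (f : DominantMorphism X Z)

/-! ### Frames adapted to a morphism -/

/-- An identity between rational vector fields on the source and the target of a dominant morphism
can be checked on coordinates of the target. -/
theorem apply_pullback_eq {z : Z.X} {κ : Type*} [Fintype κ] [DecidableEq κ] {u : κ → Z.K}
    (hu : Z.IsCoordAt z u) {D : X.Der} {δ : Z.Der} {a : X.K}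
    (h : ∀ i, D (f.pullback (u i)) = a * f.pullback (δ (u i))) (φ : Z.K) :
    D (f.pullback φ) = a * f.pullback (δ φ) := by
  let _ : Algebra Z.K X.K := f.pullback.toAlgebra
  obtain ⟨-, d, hd, -, hsum⟩ := isCoordAt_iff.mp hu
  rw [← sub_eq_zero]
  by_contra hne
  obtain ⟨l, hl⟩ := not_forall.mp (mt (Module.forall_dual_apply_eq_zero_iff Z.K _).mp hne)
  have hsmul : ∀ (c : Z.K) (g : X.K), l (f.pullback c * g) = c * l g := fun c g =>
    l.map_smul c g
  let δ' : Z.Der := Derivation.mk'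
    { toFun := fun φ => l (D (f.pullback φ) - a * f.pullback (δ φ))
      map_add' := fun φ ψ => by
        simp only [map_add, mul_add, map_sub]
        abel
      map_smul' := fun c φ => by
        rw [RingHom.id_apply, Algebra.smul_def, Algebra.smul_def, ← hsmul,
          f.pullback_algebraMap_base]
        congr 1
        rw [Derivation.leibniz, map_mul, Derivation.leibniz, f.pullback_algebraMap_base]
        simp [f.pullback_algebraMap_base]
        ring }
    fun φ ψ => by
      simp only [LinearMap.coe_mk, AddHom.coe_mk, smul_eq_mul]
      rw [← hsmul, ← hsmul, ← map_add]
      congr 1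
      simp only [map_mul, Derivation.leibniz, smul_eq_mul, map_add]
      ring
  have h0 : δ' = 0 := by
    rw [hsum δ']
    refine Finset.sum_eq_zero fun i _ => ?_
    have : δ' (u i) = l (D (f.pullback (u i)) - a * f.pullback (δ (u i))) := rfl
    rw [this, h, sub_self, map_zero, zero_smul]
  exact hl (congrArg (fun D : Z.Der => D φ) h0)

end DominantMorphism

end NormalVariety

namespace NormalVariety

variable {k : Type u} [Field k] {X Z : NormalVariety k}

/-- At the generic point of a prime divisor, a local equation and lifts of a transcendence basis of
the residue field are coordinates. -/
theorem PrimeDivisor.isCoordAt_option [CharZero k] (P : X.PrimeDivisor)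
    {q : X.X.presheaf.stalk P.1} (hq : Irreducible q) {ι : Type*} [Fintype ι] [DecidableEq ι]
    {t : ι → X.X.presheaf.stalk P.1}
    (ht : letI := X.stalkAlgebra P.1
      IsTranscendenceBasis k (IsLocalRing.residue (X.X.presheaf.stalk P.1) ∘ t)) :
    X.IsCoordAt P.1 (fun o : Option ι => algebraMap (X.X.presheaf.stalk P.1) X.K (o.elim q t)) := by
  let _ := X.stalkAlgebra P.1
  let e := Fintype.equivFin ι
  have hs : Ideal.span (Set.range ![q]) = IsLocalRing.maximalIdeal (X.X.presheaf.stalk P.1) := by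
    rw [hq.maximalIdeal_eq]
    simp
  have hn : ((1 : ℕ) : WithBot ℕ∞) ≤ ringKrullDim (X.X.presheaf.stalk P.1) := by
    rw [ringKrullDim_stalk_eq_coheight, P.2]
    rfl
  have h := isCoordAt_sumElim hs hn (t := t ∘ e.symm) (ht.comp_equiv e.symm)
  let e' : Option ι ≃ Fin 1 ⊕ Fin (Fintype.card ι) :=
    (Equiv.optionEquivSumPUnit.{0} ι).trans ((Equiv.sumComm _ _).trans
      (Equiv.sumCongr (Equiv.ofUnique _ _) e))
  have h' := h.comp_equiv e'
  convert h' using 1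
  funext o
  cases o with
  | none => simp [e']
  | some i => simp [e']

theorem isCoordAt_genericPoint [CharZero k] {x : X.X} (hx : x = genericPoint X.X) {ι : Type*}
    [Fintype ι] [DecidableEq ι] {t : ι → X.X.presheaf.stalk x}
    (ht : letI := X.stalkAlgebra x
      IsTranscendenceBasis k (IsLocalRing.residue (X.X.presheaf.stalk x) ∘ t)) :
    X.IsCoordAt x (algebraMap (X.X.presheaf.stalk x) X.K ∘ t) := by
  subst hx
  let _ := X.stalkAlgebra (genericPoint X.X)
  let e := Fintype.equivFin ι
  have hs : Ideal.span (Set.range (![] : Fin 0 → X.X.presheaf.stalk (genericPoint X.X))) =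
      IsLocalRing.maximalIdeal (X.X.presheaf.stalk (genericPoint X.X)) := by
    have hf : IsField (X.X.presheaf.stalk (genericPoint X.X)) := Field.toIsField X.K
    rw [IsLocalRing.isField_iff_maximalIdeal_eq.mp hf]
    simp
  have hn : ((0 : ℕ) : WithBot ℕ∞) ≤ ringKrullDim (X.X.presheaf.stalk (genericPoint X.X)) := by
    rw [ringKrullDim_stalk_eq_coheight, coheight_genericPoint]
    rfl
  have h := (isCoordAt_sumElim hs hn (t := t ∘ e.symm) (ht.comp_equiv e.symm)).comp_equiv
    (e.trans (Equiv.emptySum (Fin 0) (Fin (Fintype.card ι))).symm)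
  convert h using 1
  funext i
  simp

variable (X) in
instance [CharZero k] : Module.Finite X.K X.Der := by
  obtain ⟨n, u, hu⟩ : ∃ (n : ℕ) (u : Fin n → X.K), X.IsCoordAt (genericPoint X.X) u := by
    let _ := X.stalkAlgebra (genericPoint X.X)
    have := X.essFiniteType_stalk (genericPoint X.X)
    obtain ⟨n, x, hx⟩ := IsLocalRing.exists_isTranscendenceBasis_residue k
      (X.X.presheaf.stalk (genericPoint X.X))
    exact ⟨n, _, isCoordAt_genericPoint rfl hx⟩
  obtain ⟨-, d, -, -, hD⟩ := isCoordAt_iff.mp hu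
  exact Module.Finite.of_surjective (Fintype.linearCombination X.K d) fun D => ⟨_, (hD D).symm⟩

namespace DominantMorphism

variable (f : DominantMorphism X Z)

/-- The rational vector fields that annihilate the rational functions on the target. -/
def relativeDer : Submodule X.K X.Der where
  carrier := {D | ∀ φ : Z.K, D (f.pullback φ) = 0}
  add_mem' h h' φ := by rw [Derivation.add_apply, h, h', add_zero]
  zero_mem' _ := rfl
  smul_mem' c D h φ := by rw [Derivation.smul_apply, h, smul_zero]

/-- A frame of the tangent sheaf at `x` that consists of vector fields `bF` along the fibres
and of lifts `b'` of the frame `bZ` at the image of `x`, up to the factors `a`. -/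
structure IsAdaptedAt (x : X.X) {ι κ : Type*} [Fintype ι] [Fintype κ] [DecidableEq κ]
    (bF : ι → X.Der) (b' : κ → X.Der) (bZ : κ → Z.Der) (a : κ → X.K) : Prop where
  frame : X.IsFrameAt x ⊤ {D | X.DerRegularAt x D} (Sum.elim bF b')
  frame_target : Z.IsFrameAt (f.hom x) ⊤ {D | Z.DerRegularAt (f.hom x) D} bZ
  exists_dual : ∃ t : κ → Z.K, ∀ i j, bZ i (t j) = if i = j then 1 else 0
  mem_relativeDer : ∀ i, bF i ∈ f.relativeDer
  lift : ∀ j φ, b' j (f.pullback φ) = a j * f.pullback (bZ j φ)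
  ne_zero : ∀ j, a j ≠ 0
  card : Fintype.card ι + Fintype.card κ = Module.finrank X.K X.Der
  card_target : Fintype.card κ = Module.finrank Z.K Z.Der

variable {f}

theorem IsAdaptedAt.comp_equiv {x : X.X} {ι κ ι' κ' : Type*} [Fintype ι] [Fintype κ]
    [DecidableEq κ] [Fintype ι'] [Fintype κ'] [DecidableEq κ'] {bF : ι → X.Der} {b' : κ → X.Der}
    {bZ : κ → Z.Der} {a : κ → X.K} (h : f.IsAdaptedAt x bF b' bZ a) (e : ι' ≃ ι) (e' : κ' ≃ κ) :
    f.IsAdaptedAt x (bF ∘ e) (b' ∘ e') (bZ ∘ e') (a ∘ e') where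
  frame := by
    have := h.frame.comp_equiv (Equiv.sumCongr e e')
    rwa [show ⇑(Equiv.sumCongr e e') = Sum.map e e' from rfl, Sum.elim_comp_map] at this
  frame_target := h.frame_target.comp_equiv e'
  exists_dual := by
    obtain ⟨t, ht⟩ := h.exists_dual
    exact ⟨t ∘ e', fun i j => by simp [ht]⟩
  mem_relativeDer i := h.mem_relativeDer _
  lift j := h.lift _
  ne_zero j := h.ne_zero _
  card := by rw [Fintype.card_congr e, Fintype.card_congr e', h.card]
  card_target := by rw [Fintype.card_congr e', h.card_target]

/-- The vector fields along the fibres in an adapted frame are a frame of the relative tangent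
sheaf. -/
theorem IsAdaptedAt.isFrameAt_relativeDer {x : X.X} {ι κ : Type*} [Fintype ι] [Fintype κ]
    [DecidableEq κ] {bF : ι → X.Der} {b' : κ → X.Der} {bZ : κ → Z.Der} {a : κ → X.K}
    (h : f.IsAdaptedAt x bF b' bZ a) :
    X.IsFrameAt x f.relativeDer {D | X.DerRegularAt x D ∧ D ∈ f.relativeDer} bF where
  mem i := ⟨h.frame.mem (.inl i), h.mem_relativeDer i⟩
  mem_generic := h.mem_relativeDer
  linearIndependent := by
    have := h.frame.linearIndependent.comp _ Sum.inl_injective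
    rwa [Sum.elim_comp_inl] at this
  exists_eq_sum D hD _ := by
    obtain ⟨t, ht⟩ := h.exists_dual
    obtain ⟨c, hc, hDc⟩ := h.frame.exists_eq_sum D hD.1 trivial
    rw [Fintype.sum_sum_type] at hDc
    simp only [Sum.elim_inl, Sum.elim_inr] at hDc
    have hz : ∀ j, c (.inr j) = 0 := by
      intro j
      have h1 := hD.2 (t j)
      rw [hDc, Derivation.add_apply, derivation_sum_apply, derivation_sum_apply,
        Finset.sum_eq_zero (fun i _ => by rw [Derivation.smul_apply, h.mem_relativeDer i, smul_zero]),
        zero_add] at h1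
      simp only [Derivation.smul_apply, h.lift, ht, smul_eq_mul] at h1
      rw [Finset.sum_eq_single j (fun i _ hij => by simp [hij]) (fun hj => by simp at hj)] at h1
      simpa [h.ne_zero j] using h1
    refine ⟨fun i => c (.inl i), fun i => hc _, ?_⟩
    conv_lhs => rw [hDc]
    simp [hz]

/-- The wedge product of the differentials of functions `w` and of pullbacks of functions `z`,
evaluated on an adapted frame. -/
theorem IsAdaptedAt.det_eq {x : X.X} {ι κ : Type*} [Fintype ι] [DecidableEq ι] [Fintype κ]
    [DecidableEq κ] {bF : ι → X.Der} {b' : κ → X.Der} {bZ : κ → Z.Der} {a : κ → X.K}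
    (h : f.IsAdaptedAt x bF b' bZ a) (w : ι → X.K) (z : κ → Z.K) :
    Matrix.det (.of fun i j => Sum.elim bF b' i (Sum.elim w (f.pullback ∘ z) j)) =
      Matrix.det (.of fun i j => bF i (w j)) *
        ((∏ j, a j) * f.pullback (Matrix.det (.of fun i j => bZ i (z j)))) := by
  have h1 : (Matrix.of fun i j => Sum.elim bF b' i (Sum.elim w (f.pullback ∘ z) j)) =
      Matrix.fromBlocks (.of fun i j => bF i (w j)) 0 (.of fun i j => b' i (w j))
        (.of fun i j => a i * f.pullback.mapMatrix (.of fun i j => bZ i (z j)) i j) := by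
    ext (i | i) (j | j)
    · rfl
    · exact h.mem_relativeDer i _
    · rfl
    · exact h.lift i _
  rw [h1, Matrix.det_fromBlocks_zero₁₂, Matrix.det_mul_column, RingHom.map_det]

variable (f)

theorem exists_isAdaptedAt_of_isHorizontal [CharZero k] {E : X.PrimeDivisor}
    (hE : f.IsHorizontal E) :
    ∃ (r n : ℕ) (bF : Fin r → X.Der) (b' : Fin n → X.Der) (bZ : Fin n → Z.Der) (a : Fin n → X.K),
      f.IsAdaptedAt E.1 bF b' bZ a ∧ ∏ j, a j = 1 ∧ ∃ i q, X.IsUniformizerAt E q ∧ bF i q = 1 := by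
  let _ := X.stalkAlgebra E.1
  let _ := Z.stalkAlgebra (f.hom E.1)
  have := X.essFiniteType_stalk E.1
  have := Z.essFiniteType_stalk (f.hom E.1)
  obtain ⟨n, x, hx⟩ := IsLocalRing.exists_isTranscendenceBasis_residue k
    (Z.X.presheaf.stalk (f.hom E.1))
  have : IsLocalHom (f.stalkMapₐ E.1).toRingHom :=
    inferInstanceAs (IsLocalHom (f.hom.stalkMap E.1).hom)
  obtain ⟨r, y, hy⟩ := IsLocalRing.exists_isTranscendenceBasis_residue_sumElim (f.stalkMapₐ E.1) hx
  obtain ⟨q, hq⟩ := IsDiscreteValuationRing.exists_irreducible (X.X.presheaf.stalk E.1)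
  have huX := E.isCoordAt_option hq hy
  have huZ := isCoordAt_genericPoint hE hx
  have hux : ∀ j, algebraMap (X.X.presheaf.stalk E.1) X.K
      ((some (Sum.inr j) : Option (Fin r ⊕ Fin n)).elim q (Sum.elim y (f.stalkMapₐ E.1 ∘ x))) =
      f.pullback (algebraMap (Z.X.presheaf.stalk (f.hom E.1)) Z.K (x j)) :=
    fun j => (f.pullback_algebraMap _ _).symm
  obtain ⟨d, hd, hD, hdf⟩ := huX.isFrameAt
  obtain ⟨δ, hδ, -, hδf⟩ := huZ.isFrameAt
  let e : Option (Fin r) ⊕ Fin n ≃ Option (Fin r ⊕ Fin n) :=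
    { toFun := Sum.elim (fun o => o.elim none fun i => some (.inl i)) fun j => some (.inr j)
      invFun := fun o => o.elim (.inl none) (Sum.elim (fun i => .inl (some i)) .inr)
      left_inv := by rintro ((_ | i) | j) <;> rfl
      right_inv := by rintro (_ | i | j) <;> rfl }
  have hA : f.IsAdaptedAt E.1 (fun o => d (e (.inl o))) (fun j => d (e (.inr j))) δ
      (fun _ => 1) :=
    { frame := by
        convert hdf.comp_equiv e using 1
        funext i
        cases i <;> rfl
      frame_target := hδf
      exists_dual := ⟨_, hδ⟩
      mem_relativeDer := fun o φ => by
        have := f.apply_pullback_eq huZ (D := d (e (.inl o))) (δ := 0) (a := 0) (fun j => by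
          rw [Function.comp_apply, ← hux, hd]
          cases o <;> simp [e]) φ
        simpa using this
      lift := fun j φ => f.apply_pullback_eq huZ (fun i => by
        rw [Function.comp_apply, ← hux, hd]
        have := hδ j i
        rw [Function.comp_apply] at this
        rw [this]
        simp only [e, Equiv.coe_fn_mk, Sum.elim_inr, Option.some.injEq, Sum.inr.injEq, one_mul]
        split_ifs <;> simp) φ
      ne_zero := fun _ => one_ne_zero
      card := by rw [huX.finrank_eq, ← Fintype.card_sum, Fintype.card_congr e]
      card_target := huZ.finrank_eq.symm }
  let e₁ : Fin (r + 1) ≃ Option (Fin r) := finSuccEquiv r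
  refine ⟨r + 1, n, _, _, _, _, hA.comp_equiv e₁ (Equiv.refl _), by simp, e₁.symm none,
    algebraMap _ X.K q, ⟨q, hq, rfl⟩, ?_⟩
  have := hd none none
  simpa [e] using this

theorem exists_isAdaptedAt_of_eq [CharZero k] {E : X.PrimeDivisor} {P : Z.PrimeDivisor}
    (hE : f.hom E.1 = P.1) :
    ∃ (r n : ℕ) (bF : Fin r → X.Der) (b' : Fin n → X.Der) (bZ : Fin n → Z.Der) (a : Fin n → X.K),
      f.IsAdaptedAt E.1 bF b' bZ a ∧ X.ord (∏ j, a j) E = f.mult E P - 1 := by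
  obtain ⟨z, hz⟩ := P
  dsimp only at hE
  subst hE
  let P : Z.PrimeDivisor := ⟨f.hom E.1, hz⟩
  have : IsDiscreteValuationRing (Z.X.presheaf.stalk (f.hom E.1)) := P.isDiscreteValuationRing
  let _ := X.stalkAlgebra E.1
  let _ := Z.stalkAlgebra (f.hom E.1)
  have := X.essFiniteType_stalk E.1
  have := Z.essFiniteType_stalk (f.hom E.1)
  obtain ⟨n, x, hx⟩ := IsLocalRing.exists_isTranscendenceBasis_residue k
    (Z.X.presheaf.stalk (f.hom E.1))
  have : IsLocalHom (f.stalkMapₐ E.1).toRingHom :=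
    inferInstanceAs (IsLocalHom (f.hom.stalkMap E.1).hom)
  obtain ⟨r, y, hy⟩ := IsLocalRing.exists_isTranscendenceBasis_residue_sumElim (f.stalkMapₐ E.1) hx
  obtain ⟨q, hq⟩ := IsDiscreteValuationRing.exists_irreducible (X.X.presheaf.stalk E.1)
  obtain ⟨p, hp⟩ := IsDiscreteValuationRing.exists_irreducible (Z.X.presheaf.stalk (f.hom E.1))
  have huX := E.isCoordAt_option hq hy
  have huZ : Z.IsCoordAt (f.hom E.1) _ := P.isCoordAt_option hp hx
  have hux : ∀ j, algebraMap (X.X.presheaf.stalk E.1) X.K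
      ((some (Sum.inr j) : Option (Fin r ⊕ Fin n)).elim q (Sum.elim y (f.stalkMapₐ E.1 ∘ x))) =
      f.pullback (algebraMap (Z.X.presheaf.stalk (f.hom E.1)) Z.K (x j)) :=
    fun j => (f.pullback_algebraMap _ _).symm
  have hpP : Z.IsUniformizerAt P (algebraMap _ Z.K p) := ⟨p, hp, rfl⟩
  have hqE : X.IsUniformizerAt E (algebraMap _ X.K q) := ⟨q, hq, rfl⟩
  have hm : X.ord (f.pullback (algebraMap _ Z.K p)) E = f.mult E P := by
    rw [f.ord_pullback_eq_mult_mul (P := P) rfl hpP.ne_zero, hpP.ord_eq_one, mul_one]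
  have hm1 := f.one_le_mult (E := E) (P := P) rfl
  obtain ⟨m, hmm⟩ : ∃ m : ℕ, f.mult E P = m := ⟨_, (Int.toNat_of_nonneg (by omega)).symm⟩
  obtain ⟨v, hv, hpv⟩ := hqE.exists_eq_mul_zpow_ord (f.pullback_ne_zero hpP.ne_zero)
  rw [hm, hmm, zpow_natCast] at hpv
  obtain ⟨b, hb1, hb2, hb3, hb4, hbf⟩ := huX.exists_frame_of_eq_mul_pow hqE
    (show m ≠ 0 by omega) hv hpv
  obtain ⟨δ, hδ, -, hδf⟩ := huZ.isFrameAt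
  let e : Fin r ⊕ Option (Fin n) ≃ Option (Fin r ⊕ Fin n) :=
    { toFun := Sum.elim (fun i => some (.inl i)) fun o => o.elim none fun j => some (.inr j)
      invFun := fun o => o.elim (.inr none) (Sum.elim .inl fun j => .inr (some j))
      left_inv := by rintro (i | _ | j) <;> rfl
      right_inv := by rintro (_ | i | j) <;> rfl }
  have hq0 : (algebraMap (X.X.presheaf.stalk E.1) X.K q) ^ (m - 1) ≠ 0 := pow_ne_zero _ hqE.ne_zero
  have hA : f.IsAdaptedAt E.1 (fun i => b (e (.inl i))) (fun o => b (e (.inr o))) δ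
      (fun o => o.elim (algebraMap (X.X.presheaf.stalk E.1) X.K q ^ (m - 1)) fun _ => 1) :=
    { frame := by
        convert hbf.comp_equiv e using 1
        funext i
        cases i <;> rfl
      frame_target := hδf
      exists_dual := ⟨_, hδ⟩
      mem_relativeDer := fun i φ => by
        have := f.apply_pullback_eq huZ (D := b (e (.inl i))) (δ := 0) (a := 0) (fun o => by
          cases o with
          | none =>
            simp only [Option.elim]
            rw [zero_mul]
            exact hb2 _
          | some j =>
            have := hb1 (.inl i) (.inr j)
            rw [hux] at this
            simpa [e] using this) φ
        simpa using this
      lift := fun o φ => f.apply_pullback_eq huZ (fun o' => by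
        rw [hδ]
        cases o with
        | none =>
          cases o' with
          | none => simpa [e] using hb4
          | some j =>
            have := hb3 (.inr j)
            rw [hux] at this
            simpa [e] using this
        | some i =>
          cases o' with
          | none => simpa [e] using hb2 (.inr i)
          | some j =>
            have := hb1 (.inr i) (.inr j)
            rw [hux] at this
            simp only [e, Equiv.coe_fn_mk, Sum.elim_inr, Option.elim, Option.some.injEq, one_mul]
            refine this.trans ?_
            simp only [Sum.inr.injEq]
            split_ifs <;> simp) φ
      ne_zero := fun o => by
        cases o with
        | none => exact hq0
        | some i => exact one_ne_zero
      card := by rw [huX.finrank_eq, ← Fintype.card_sum, Fintype.card_congr e]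
      card_target := huZ.finrank_eq.symm }
  let e₁ : Fin (n + 1) ≃ Option (Fin n) := finSuccEquiv n
  refine ⟨r, n + 1, _, _, _, _, hA.comp_equiv (Equiv.refl _) e₁, ?_⟩
  simp only [Function.comp_apply]
  rw [Equiv.prod_comp e₁ fun o : Option (Fin n) =>
    o.elim (algebraMap (X.X.presheaf.stalk E.1) X.K q ^ (m - 1)) fun _ => 1, Fintype.prod_option]
  simp only [Option.elim, Finset.prod_const_one, mul_one]
  rw [ord_pow E hqE.ne_zero, hqE.ord_eq_one, hmm]
  omega

end DominantMorphism

end NormalVariety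

namespace NormalVariety

variable {k : Type u} [Field k] {X Z : NormalVariety k}

namespace Foliation

/-! ### Foliations induced by morphisms -/

variable {F : Foliation X} {f : DominantMorphism X Z}

theorem IsInducedBy.stalk_eq (hF : F.IsInducedBy f) (x : X.X) :
    F.stalk x = {D | X.DerRegularAt x D ∧ D ∈ f.relativeDer} := by
  ext D
  constructor
  · rintro ⟨U, hx, hD⟩
    have : Nonempty U := ⟨⟨x, hx⟩⟩
    have h := (hF U D).mp hD
    exact ⟨h.1 x hx, h.2⟩
  · rintro ⟨hx, hD⟩
    let U : X.X.Opens := ⟨_, isOpen_setOf_derRegularAt D⟩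
    have : Nonempty U := ⟨⟨x, hx⟩⟩
    exact ⟨U, hx, (hF U D).mpr ⟨fun y hy => hy, hD⟩⟩

theorem IsInducedBy.generic_eq (hF : F.IsInducedBy f) : F.generic = f.relativeDer := by
  have h : F.stalk (genericPoint X.X) = f.relativeDer := by
    rw [hF.stalk_eq]
    ext D
    exact ⟨fun h => h.2, fun h => ⟨fun φ _ => regularAt_genericPoint _, h⟩⟩
  rw [generic, h, Submodule.span_eq]

theorem IsInducedBy.isCanonical_iff (hF : F.IsInducedBy f) {D : X.RDivisor} :
    F.IsCanonical D ↔ X.IsDetDualDivisor f.relativeDer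
      (fun x => {D | X.DerRegularAt x D ∧ D ∈ f.relativeDer}) D := by
  rw [IsCanonical, hF.generic_eq, funext hF.stalk_eq]

/-- A horizontal prime divisor is not invariant: the vector field dual to a local equation in
suitable coordinates is tangent to the fibres and does not preserve the ideal of the divisor. -/
theorem IsInducedBy.not_isHorizontal [CharZero k] (hF : F.IsInducedBy f) {E : X.PrimeDivisor}
    (hE : F.IsInvariant E) : ¬ f.IsHorizontal E := by
  intro hh
  obtain ⟨r, n, bF, b', bZ, a, h, -, i, q, hq, hbq⟩ := f.exists_isAdaptedAt_of_isHorizontal hh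
  have hm := h.isFrameAt_relativeDer.mem i
  let U : X.X.Opens := ⟨_, (isOpen_setOf_derRegularAt (bF i)).inter (isOpen_setOf_regularAt q)⟩
  have hEU : E.1 ∈ U := ⟨hm.1, hq.vanishesAt.regularAt⟩
  have : Nonempty U := ⟨⟨E.1, hEU⟩⟩
  have hv := hE U hEU (bF i) ((hF U _).mpr ⟨fun x hx => hx.1, hm.2⟩) q (fun x hx => hx.2)
    hq.vanishesAt
  rw [hbq] at hv
  exact (regularAt_one _).vanishesAt_iff.mp hv (unitAt_one _)

end Foliation

namespace DominantMorphism

variable (f : DominantMorphism X Z)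

/-! ### Comparison of canonical divisors -/

theorem exists_separating_functions [CharZero k] :
    ∃ (r n : ℕ) (w : Fin r → X.K) (z : Fin n → Z.K),
      (∀ D : X.Der, (∀ i, D (Sum.elim w (f.pullback ∘ z) i) = 0) → D = 0) ∧
      (∀ D : Z.Der, (∀ i, D (z i) = 0) → D = 0) ∧ r + n = Module.finrank X.K X.Der ∧
      n = Module.finrank Z.K Z.Der ∧ r = Module.finrank X.K f.relativeDer := by
  obtain ⟨g, hg⟩ : ∃ g, g = genericPoint X.X := ⟨_, rfl⟩
  obtain ⟨r, n, y, x, huX, huZ⟩ : ∃ (r n : ℕ) (y : Fin r → X.K) (x : Fin n → Z.K),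
      X.IsCoordAt g (Sum.elim y (f.pullback ∘ x)) ∧ Z.IsCoordAt (f.hom g) x := by
    have hgZ : f.hom g = genericPoint Z.X := by rw [hg]; exact f.map_genericPoint
    let _ := X.stalkAlgebra g
    let _ := Z.stalkAlgebra (f.hom g)
    have := X.essFiniteType_stalk g
    have := Z.essFiniteType_stalk (f.hom g)
    obtain ⟨n, x, hx⟩ := IsLocalRing.exists_isTranscendenceBasis_residue k
      (Z.X.presheaf.stalk (f.hom g))
    have : IsLocalHom (f.stalkMapₐ g).toRingHom :=
      inferInstanceAs (IsLocalHom (f.hom.stalkMap g).hom)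
    obtain ⟨r, y, hy⟩ := IsLocalRing.exists_isTranscendenceBasis_residue_sumElim (f.stalkMapₐ g) hx
    refine ⟨r, n, algebraMap (X.X.presheaf.stalk g) X.K ∘ y,
      algebraMap (Z.X.presheaf.stalk (f.hom g)) Z.K ∘ x, ?_, isCoordAt_genericPoint hgZ hx⟩
    convert isCoordAt_genericPoint hg hy using 1
    funext i
    cases i with
    | inl i => rfl
    | inr j => exact f.pullback_algebraMap _ _
  obtain ⟨-, d, hd, -, hsum⟩ := isCoordAt_iff.mp huX
  obtain ⟨-, δ, hδ, -, hsumZ⟩ := isCoordAt_iff.mp huZ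
  have hsep : ∀ D : X.Der, (∀ i, D (Sum.elim y (f.pullback ∘ x) i) = 0) → D = 0 := by
    intro D h
    rw [hsum D]
    exact Finset.sum_eq_zero fun i _ => by rw [h, zero_smul]
  refine ⟨r, n, _, _, hsep, ?_, ?_, ?_, ?_⟩
  · intro D h
    rw [hsumZ D]
    exact Finset.sum_eq_zero fun i _ => by rw [h, zero_smul]
  · rw [huX.finrank_eq]; simp
  · rw [huZ.finrank_eq]; simp
  · have hrel : ∀ i, d (.inl i) ∈ f.relativeDer := by
      intro i φ
      have := f.apply_pullback_eq huZ (D := d (.inl i)) (δ := 0) (a := 0) (fun j => by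
        rw [zero_mul]
        exact hd (.inl i) (.inr j)) φ
      simpa using this
    let L : f.relativeDer →ₗ[X.K] (Fin r → X.K) :=
      (Derivation.evalFamily y).comp
        f.relativeDer.subtype
    have hL : Function.Bijective L := by
      constructor
      · rw [← LinearMap.ker_eq_bot, LinearMap.ker_eq_bot']
        intro D hD
        refine Subtype.ext (hsep _ ?_)
        rintro (i | j)
        · exact congrFun hD i
        · exact D.2 _
      · intro c
        refine ⟨∑ i, c i • ⟨d (.inl i), hrel i⟩, ?_⟩
        simp_rw [map_sum, map_smul]
        funext j
        have : ∀ i, L ⟨d (.inl i), hrel i⟩ j = if i = j then 1 else 0 := by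
          intro i
          have := hd (.inl i) (.inl j)
          simp only [Sum.inl.injEq] at this
          exact this
        simp [this]
    rw [(LinearEquiv.ofBijective L hL).finrank_eq]
    simp

/-- The canonical divisors of `X`, of the foliation induced by `f` and of `Z` are related by
`K_X ∼ K_F + f^* K_Z + R`, where `R` has along a vertical prime divisor the coefficient
"multiplicity minus one". -/
theorem exists_canonical_eq [CharZero k] {F : Foliation X} (hF : F.IsInducedBy f)
    {KF KX : X.RDivisor} {KZ : Z.RDivisor} (hKF : F.IsCanonical KF)
    (hKX : NormalVariety.IsCanonical KX) (hKZ : NormalVariety.IsCanonical KZ) :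
    ∃ c : X.K, c ≠ 0 ∧ (∀ E, f.IsHorizontal E → KX E = X.ord c E + KF E) ∧
      ∀ E (P : Z.PrimeDivisor), f.hom E.1 = P.1 →
        KX E = X.ord c E + KF E + (f.mult E P - 1) + f.mult E P * KZ P := by
  obtain ⟨r, n, w, z, hsep, hsepZ, hcX, hcZ, hcF⟩ := f.exists_separating_functions
  rw [hF.isCanonical_iff] at hKF
  have hsepF : ∀ D ∈ f.relativeDer, (∀ i, D (w i) = 0) → D = 0 := by
    intro D hD h
    refine hsep D ?_
    rintro (i | j)
    · exact h i
    · exact hD _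
  obtain ⟨cF, hcF0, hF'⟩ := hKF.exists_ord_eq (by rw [Fintype.card_fin, hcF]) hsepF
  obtain ⟨cX, hcX0, hX'⟩ := hKX.exists_ord_eq (ι := Fin r ⊕ Fin n)
    (by rw [finrank_top, ← hcX]; simp) fun D _ => hsep D
  obtain ⟨cZ, hcZ0, hZ'⟩ := hKZ.exists_ord_eq (ι := Fin n)
    (by rw [finrank_top, ← hcZ]; simp) fun D _ => hsepZ D
  have hcZ0' := f.pullback_ne_zero hcZ0
  have key : ∀ (E : X.PrimeDivisor) (r' n' : ℕ) (bF : Fin r' → X.Der) (b' : Fin n' → X.Der)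
      (bZ : Fin n' → Z.Der) (a : Fin n' → X.K), f.IsAdaptedAt E.1 bF b' bZ a →
      ∃ bZ' : Fin n → Z.Der,
        Z.IsFrameAt (f.hom E.1) ⊤ {D | Z.DerRegularAt (f.hom E.1) D} bZ' ∧
        Matrix.det (.of fun i j => bZ' i (z j)) ≠ 0 ∧
        KX E = X.ord cX E + (KF E - X.ord cF E) + X.ord (∏ j, a j) E +
          X.ord (f.pullback (Matrix.det (.of fun i j => bZ' i (z j)))) E := by
    intro E r' n' bF b' bZ a h
    obtain rfl : n' = n := by rw [hcZ, ← h.card_target, Fintype.card_fin]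
    obtain rfl : r' = r := by
      have := h.card
      rw [← hcX, Fintype.card_fin, Fintype.card_fin] at this
      omega
    obtain ⟨h1, h2⟩ := hX' E _ h.frame
    obtain ⟨h3, h4⟩ := hF' E _ h.isFrameAt_relativeDer
    have h5 := h.det_eq w z
    rw [h5] at h1 h2
    have h6 := right_ne_zero_of_mul h1
    have h7 := left_ne_zero_of_mul h6
    have h8 := right_ne_zero_of_mul h6
    refine ⟨bZ, h.frame_target, fun h0 => h8 (by rw [h0, map_zero]), ?_⟩
    rw [h2, h4, ord_mul E h3 h6, ord_mul E h7 h8]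
    push_cast
    ring
  refine ⟨cX / (cF * f.pullback cZ), div_ne_zero hcX0 (mul_ne_zero hcF0 hcZ0'), ?_, ?_⟩
  · intro E hE
    obtain ⟨r', n', bF, b', bZ, a, h, ha, -⟩ := f.exists_isAdaptedAt_of_isHorizontal hE
    obtain ⟨bZ', -, hdet, hK⟩ := key E _ _ _ _ _ _ h
    rw [hK, ha, ord_one, f.ord_pullback_of_isHorizontal hE hdet, div_eq_mul_inv,
      ord_mul E hcX0 (inv_ne_zero (mul_ne_zero hcF0 hcZ0')), ord_inv,
      ord_mul E hcF0 hcZ0', f.ord_pullback_of_isHorizontal hE hcZ0]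
    push_cast
    ring
  · intro E P hE
    obtain ⟨r', n', bF, b', bZ, a, h, ha⟩ := f.exists_isAdaptedAt_of_eq hE
    obtain ⟨bZ', hfr, hdet, hK⟩ := key E _ _ _ _ _ _ h
    rw [hE] at hfr
    have h9 := (hZ' P _ hfr).2
    rw [hK, ha, f.ord_pullback_eq_mult_mul hE hdet, div_eq_mul_inv,
      ord_mul E hcX0 (inv_ne_zero (mul_ne_zero hcF0 hcZ0')), ord_inv,
      ord_mul E hcF0 hcZ0', f.ord_pullback_eq_mult_mul hE hcZ0, h9]
    push_cast
    ring

end DominantMorphism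

end NormalVariety

/-! ### Dimension and transcendence degree -/

/-- A map from the spectrum of a ring to a topological space that preserves and reflects
specializations bounds the Krull dimension of the space from below. -/
theorem ringKrullDim_le_topologicalKrullDim {B T : Type*} [CommRing B] [TopologicalSpace T]
    (g : PrimeSpectrum B → T) (hg : ∀ p q, g p ⤳ g q ↔ p ≤ q) :
    ringKrullDim B ≤ topologicalKrullDim T := by
  let G : PrimeSpectrum B → (TopologicalSpace.IrreducibleCloseds T)ᵒᵈ := fun p =>
    OrderDual.toDual ⟨closure {g p}, isIrreducible_singleton.closure, isClosed_closure⟩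
  have hG : ∀ p q, G p ≤ G q ↔ p ≤ q := by
    intro p q
    rw [← hg, specializes_iff_closure_subset]
    rfl
  have hmono : StrictMono G := fun p q h => by
    rw [lt_iff_le_not_ge, hG, hG]
    exact lt_iff_le_not_ge.mp h
  exact (Order.krullDim_le_of_strictMono G hmono).trans (Order.krullDim_orderDual).le

/-- A finitely generated algebra over a field contains a transcendence basis of its fraction field,
whose cardinality is at most the dimension of the algebra. -/
theorem exists_isTranscendenceBasis_le_ringKrullDim {F L : Type*} [Field F] [Field L] [Algebra F L]
    {t : Set L} (ht : t.Finite) [Algebra.IsAlgebraic (Algebra.adjoin F t) L] :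
    ∃ (r : ℕ) (y : Fin r → L), IsTranscendenceBasis F y ∧
      (r : WithBot ℕ∞) ≤ ringKrullDim (Algebra.adjoin F t) := by
  obtain ⟨s, hst, hs⟩ := exists_isTranscendenceBasis_subset (R := F) t
  have : Finite s := ht.subset hst
  let y : Fin (Nat.card s) → L := Subtype.val ∘ (Finite.equivFin s).symm
  have hy : IsTranscendenceBasis F y := hs.comp_equiv _
  let y' : Fin (Nat.card s) → Algebra.adjoin F t :=
    fun i => ⟨y i, Algebra.subset_adjoin (hst (Subtype.coe_prop _))⟩
  have hy' : AlgebraicIndependent F y' := by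
    have h : AlgebraicIndependent F ((Algebra.adjoin F t).val ∘ y') := hy.1
    exact h.of_comp _
  have : Algebra.FiniteType F (Algebra.adjoin F t) :=
    ((Algebra.adjoin F t).fg_iff_finiteType).mp ⟨ht.toFinset, by simp⟩
  exact ⟨_, y, hy, hy'.le_ringKrullDim⟩

namespace NormalVariety

variable {k : Type u} [Field k] {X Z : NormalVariety k}

variable (X) in
theorem topologicalKrullDim_le [CharZero k] :
    topologicalKrullDim X.X ≤ Module.finrank X.K X.Der := by
  have : FinTrdeg k X.K := by
    have := X.essFiniteType_functionField
    infer_instance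
  obtain ⟨N, x, hx⟩ := exists_isTranscendenceBasis_fin k X.K
  rw [hx.finrank_derivation, Fintype.card_fin, topologicalKrullDim,
    Order.krullDim_eq_of_orderIso irreducibleSetEquivPoints, Order.krullDim_eq_iSup_coheight]
  refine iSup_le fun p => ?_
  let _ := X.stalkAlgebra p
  have := X.isScalarTower_stalk p
  by_contra! hlt
  have hlt : (N : ℕ∞) < Order.coheight p := by exact_mod_cast hlt
  have h2 : ((N + 1 : ℕ) : WithBot ℕ∞) ≤ ringKrullDim (X.X.presheaf.stalk p) := by
    rw [ringKrullDim_stalk_eq_coheight]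
    exact_mod_cast Order.add_one_le_of_lt hlt
  have h3 := IsLocalRing.add_le_of_algebraicIndependent h2 (y := (![] : Fin 0 → _))
    (algebraicIndependent_empty_type) hx
  omega

variable (X) in
theorem le_topologicalKrullDim [CharZero k] :
    (Module.finrank X.K X.Der : WithBot ℕ∞) ≤ topologicalKrullDim X.X := by
  obtain ⟨c, hc⟩ := X.exists_affineChart (genericPoint X.X)
  let _ := c.algebra
  obtain ⟨S, hS⟩ := c.finiteType
  let ψ : Γ(X.X, c.U) →ₐ[k] X.K := { c.toK with commutes' := c.toK_algebraMap }
  have hadj : Algebra.adjoin k (ψ '' S) = ψ.range := by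
    rw [← AlgHom.map_adjoin, hS, Algebra.map_top]
  have : Algebra.IsAlgebraic (Algebra.adjoin k (ψ '' S)) X.K := by
    rw [hadj]
    refine ⟨fun φ => ?_⟩
    obtain ⟨a, b, -, rfl⟩ := c.exists_eq_div hc (regularAt_genericPoint φ)
    rw [div_eq_mul_inv]
    exact (isAlgebraic_algebraMap (⟨ψ a, a, rfl⟩ : ψ.range)).mul
      (isAlgebraic_algebraMap (⟨ψ b, b, rfl⟩ : ψ.range)).inv
  obtain ⟨r, y, hy, hr⟩ := exists_isTranscendenceBasis_le_ringKrullDim (F := k)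
    (S.finite_toSet.image ψ)
  rw [hy.finrank_derivation, Fintype.card_fin]
  refine hr.trans ?_
  rw [hadj]
  let e : Γ(X.X, c.U) ≃+* ψ.range := (AlgEquiv.ofInjective ψ c.toK_injective).toRingEquiv
  rw [← ringKrullDim_eq_of_ringEquiv e]
  exact ringKrullDim_le_topologicalKrullDim c.point fun p q => c.point_specializes_iff

namespace DominantMorphism

variable (f : DominantMorphism X Z)

/-- The dimension of the closure of a point `x` in its fibre is at least the transcendence degree of
the extension of residue fields. -/
theorem exists_isTranscendenceBasis_le_topologicalKrullDim (x : X.X) :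
    letI : Algebra (IsLocalRing.ResidueField (Z.X.presheaf.stalk (f.hom x)))
        (IsLocalRing.ResidueField (X.X.presheaf.stalk x)) :=
      (IsLocalRing.ResidueField.map (f.hom.stalkMap x).hom).toAlgebra
    ∃ (r : ℕ) (y : Fin r → X.X.presheaf.stalk x),
      IsTranscendenceBasis (IsLocalRing.ResidueField (Z.X.presheaf.stalk (f.hom x)))
        (IsLocalRing.residue (X.X.presheaf.stalk x) ∘ y) ∧
      (r : WithBot ℕ∞) ≤ topologicalKrullDim {p : ↥(f.hom ⁻¹' {f.hom x}) | x ⤳ p.1} := by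
  let F := IsLocalRing.ResidueField (Z.X.presheaf.stalk (f.hom x))
  let L := IsLocalRing.ResidueField (X.X.presheaf.stalk x)
  let _ : Algebra F L := (IsLocalRing.ResidueField.map (f.hom.stalkMap x).hom).toAlgebra
  obtain ⟨c, hc⟩ := X.exists_affineChart x
  let _ := c.algebra
  obtain ⟨S, hS⟩ := c.finiteType
  let ψ : Γ(X.X, c.U) →+* L := (IsLocalRing.residue _).comp (X.X.presheaf.germ c.U x hc).hom
  have hFL : ∀ s, algebraMap F L (IsLocalRing.residue _ s) =
      IsLocalRing.residue _ (f.hom.stalkMap x s) := fun s => rfl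
  let B := Algebra.adjoin F (ψ '' S)
  have hψB : ∀ a, ψ a ∈ B := by
    intro a
    have ha : a ∈ Algebra.adjoin k (S : Set Γ(X.X, c.U)) := by rw [hS]; trivial
    induction ha using Algebra.adjoin_induction with
    | mem a ha => exact Algebra.subset_adjoin ⟨a, ha, rfl⟩
    | algebraMap r =>
      let _ := X.stalkAlgebra x
      let _ := Z.stalkAlgebra (f.hom x)
      have h1 : X.X.presheaf.germ c.U x hc (algebraMap k _ r) =
          f.hom.stalkMap x (algebraMap k _ r) := by
        apply algebraMap_stalk_injective x
        have := X.isScalarTower_stalk x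
        have := Z.isScalarTower_stalk (f.hom x)
        rw [← c.toK_eq hc, c.toK_algebraMap, ← f.pullback_algebraMap,
          ← IsScalarTower.algebraMap_apply k _ Z.K, f.pullback_algebraMap_base]
      have h2 : ψ (algebraMap k _ r) = algebraMap F L (IsLocalRing.residue _ (algebraMap k _ r)) := by
        rw [hFL, ← h1]; rfl
      rw [h2]
      exact B.algebraMap_mem _
    | add a b _ _ ha hb => rw [map_add]; exact B.add_mem ha hb
    | mul a b _ _ ha hb => rw [map_mul]; exact B.mul_mem ha hb
  let ψB : Γ(X.X, c.U) →+* B := ψ.codRestrict B hψB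
  have hfrac : ∀ (o : X.X.presheaf.stalk x) (a b : Γ(X.X, c.U)),
      algebraMap _ X.K o * c.toK b = c.toK a → IsLocalRing.residue _ o * ψ b = ψ a := by
    intro o a b h
    rw [c.toK_eq hc, c.toK_eq hc, ← map_mul] at h
    have h := algebraMap_stalk_injective x h
    have := congrArg (IsLocalRing.residue _) h
    rwa [map_mul] at this
  have hψ0 : ∀ b, X.UnitAt x (c.toK b) → ψ b ≠ 0 := by
    intro b hb h
    rw [c.toK_eq hc, unitAt_algebraMap] at hb
    exact (IsLocalRing.residue_ne_zero_iff_isUnit _).mpr hb h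
  have : Algebra.IsAlgebraic B L := by
    refine ⟨fun l => ?_⟩
    obtain ⟨o, rfl⟩ := IsLocalRing.residue_surjective l
    obtain ⟨a, b, hb, hab⟩ := c.exists_eq_div hc (regularAt_algebraMap o)
    have h1 := hfrac o a b (by rw [hab, div_mul_cancel₀ _ hb.ne_zero])
    rw [eq_div_iff_mul_eq (hψ0 b hb) |>.mpr h1, div_eq_mul_inv]
    exact (isAlgebraic_algebraMap (⟨ψ a, hψB a⟩ : B)).mul
      (isAlgebraic_algebraMap (⟨ψ b, hψB b⟩ : B)).inv
  obtain ⟨r, y, hy, hr⟩ := exists_isTranscendenceBasis_le_ringKrullDim (F := F)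
    (S.finite_toSet.image ψ)
  choose y' hy' using fun i => IsLocalRing.residue_surjective (y i)
  have hyy : IsLocalRing.residue (X.X.presheaf.stalk x) ∘ y' = y := funext hy'
  refine ⟨r, y', by rwa [hyy], hr.trans ?_⟩
  -- points of `Spec B` are specializations of `x` in the fibre of `x`
  let g : PrimeSpectrum B → X.X := fun q => c.point (PrimeSpectrum.comap ψB q)
  have hxg : ∀ q, x ⤳ g q := by
    intro q
    obtain ⟨Q, hQ⟩ := c.exists_point_eq hc
    rw [← hQ]
    refine c.point_specializes_iff.mpr fun a ha => ?_
    have h1 : ψ a = 0 := by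
      by_contra h
      rw [← c.vanishesAt_point_iff, hQ, c.toK_eq hc, vanishesAt_algebraMap,
        ← IsLocalRing.residue_eq_zero_iff] at ha
      exact h ha
    have h2 : ψB a = 0 := Subtype.ext h1
    change ψB a ∈ q.asIdeal
    rw [h2]
    exact q.asIdeal.zero_mem
  have hvan : ∀ (q : PrimeSpectrum B) (o : X.X.presheaf.stalk x) (b : B),
      IsLocalRing.residue _ o = (b : L) → X.RegularAt (g q) (algebraMap _ X.K o) →
      (X.VanishesAt (g q) (algebraMap _ X.K o) ↔ b ∈ q.asIdeal) := by
    intro q o b hob hreg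
    obtain ⟨a, d, hd, had⟩ := c.exists_eq_div (c.point_mem _) hreg
    have h1 := hfrac o a d (by rw [had, div_mul_cancel₀ _ hd.ne_zero])
    have h2 : b * ψB d = ψB a := Subtype.ext (show (b : L) * ψ d = ψ a by rw [← hob]; exact h1)
    have hdq : ψB d ∉ q.asIdeal := (c.unitAt_point_iff _ _).mp hd
    have h3 : X.VanishesAt (g q) (algebraMap _ X.K o) ↔ X.VanishesAt (g q) (c.toK a) := by
      constructor
      · intro h
        have := h.mul_right hd.regularAt
        rwa [had, div_mul_cancel₀ _ hd.ne_zero] at this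
      · intro h
        rw [had, div_eq_mul_inv]
        exact h.mul_right hd.inv.regularAt
    rw [h3, c.vanishesAt_point_iff]
    change ψB a ∈ q.asIdeal ↔ _
    rw [← h2]
    exact ⟨fun h => (q.2.mem_or_mem h).resolve_right hdq, fun h => Ideal.mul_mem_right _ _ h⟩
  have hfg : ∀ q, f.hom (g q) = f.hom x := by
    intro q
    have hsp : f.hom x ⤳ f.hom (g q) := (hxg q).map f.hom.continuous
    refine (Specializes.antisymm ?_ hsp).eq
    obtain ⟨c', hc'⟩ := Z.exists_affineChart (f.hom (g q))
    obtain ⟨Q, hQ⟩ := c'.exists_point_eq hc'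
    obtain ⟨Q', hQ'⟩ := c'.exists_point_eq (hsp.mem_open c'.U.2 hc')
    rw [← hQ, ← hQ']
    refine c'.point_specializes_iff.mpr fun a ha => ?_
    by_contra hna
    have hu : Z.UnitAt (f.hom x) (c'.toK a) := by rwa [← hQ', c'.unitAt_point_iff]
    obtain ⟨s, hs, hsa⟩ := hu
    have hreg : Z.RegularAt (f.hom (g q)) (c'.toK a) := c'.regularAt_toK hc' a
    have hpa : f.pullback (c'.toK a) = algebraMap _ X.K (f.hom.stalkMap x s) := by
      rw [← hsa, f.pullback_algebraMap]
    have h1 := (hvan q (f.hom.stalkMap x s) (algebraMap F B (IsLocalRing.residue _ s)) rfl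
      (by rw [← hpa]; exact f.regularAt_pullback hreg)).mp (by
        rw [← hpa, f.vanishesAt_pullback_iff hreg, ← hQ, c'.vanishesAt_point_iff]
        exact ha)
    refine q.2.ne_top (Ideal.eq_top_of_isUnit_mem _ h1 (IsUnit.map _ ?_))
    exact hs.map _
  have hreg : ∀ b : B, ∃ o : X.X.presheaf.stalk x, IsLocalRing.residue _ o = (b : L) ∧
      ∀ q, X.RegularAt (g q) (algebraMap _ X.K o) := by
    rintro ⟨b, hb⟩
    change ∃ o, IsLocalRing.residue _ o = b ∧ _
    induction hb using Algebra.adjoin_induction with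
    | mem b hb =>
      obtain ⟨a, -, rfl⟩ := hb
      refine ⟨X.X.presheaf.germ c.U x hc a, rfl, fun q => ?_⟩
      rw [← c.toK_eq hc]
      exact c.regularAt_toK (c.point_mem _) a
    | algebraMap w =>
      obtain ⟨s, rfl⟩ := IsLocalRing.residue_surjective w
      refine ⟨f.hom.stalkMap x s, rfl, fun q => ?_⟩
      rw [← f.pullback_algebraMap]
      exact f.regularAt_pullback (by rw [hfg]; exact regularAt_algebraMap s)
    | add a b _ _ ha hb =>
      obtain ⟨o, ho, ho'⟩ := ha
      obtain ⟨o₂, ho₂, ho₂'⟩ := hb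
      exact ⟨o + o₂, by rw [map_add, ho, ho₂], fun q => by rw [map_add]; exact (ho' q).add (ho₂' q)⟩
    | mul a b _ _ ha hb =>
      obtain ⟨o, ho, ho'⟩ := ha
      obtain ⟨o₂, ho₂, ho₂'⟩ := hb
      exact ⟨o * o₂, by rw [map_mul, ho, ho₂], fun q => by rw [map_mul]; exact (ho' q).mul (ho₂' q)⟩
  refine ringKrullDim_le_topologicalKrullDim (fun q => ⟨⟨g q, hfg q⟩, hxg q⟩) fun p q => ?_
  rw [← Topology.IsInducing.subtypeVal.specializes_iff,
    ← Topology.IsInducing.subtypeVal.specializes_iff]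
  constructor
  · intro h b hb
    obtain ⟨o, ho, ho'⟩ := hreg b
    rw [← hvan q o b ho (ho' q)]
    rw [← hvan p o b ho (ho' p)] at hb
    rw [(ho' q).vanishesAt_iff]
    rw [(ho' p).vanishesAt_iff] at hb
    exact fun hu => hb (hu.of_specializes h)
  · intro h
    exact c.point_specializes_iff.mpr (Ideal.comap_mono h)

/-- If `f` is equidimensional, every vertical prime divisor of the source lies over a prime divisor
of the target. -/
theorem IsEquidimensional.coheight_eq_one [CharZero k] {f : DominantMorphism X Z}
    (hf : f.IsEquidimensional) {E : X.PrimeDivisor} (hE : ¬ f.IsHorizontal E) :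
    Order.coheight (f.hom E.1) = 1 := by
  refine le_antisymm ?_ (one_le_coheight hE)
  let C : Set ↥(f.hom ⁻¹' {f.hom E.1}) := {p | E.1 ⤳ p.1}
  let e : ↥(f.hom ⁻¹' {f.hom E.1}) := ⟨E.1, rfl⟩
  have hCe : C = closure {e} := by
    ext p
    rw [← specializes_iff_mem_closure, ← Topology.IsInducing.subtypeVal.specializes_iff]
    rfl
  -- a larger irreducible subset of the fibre would have the generic point of `X` in its closure
  have hC : C ∈ irreducibleComponents ↥(f.hom ⁻¹' {f.hom E.1}) := by
    refine ⟨by rw [hCe]; exact isIrreducible_singleton.closure, fun C' hC' hle p hp => ?_⟩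
    obtain ⟨c, hc⟩ := QuasiSober.sober (hC'.image _ continuous_subtype_val.continuousOn).closure
      isClosed_closure
    have hcE : c ⤳ E.1 := hc.specializes (subset_closure ⟨e, hle specializes_rfl, rfl⟩)
    have hcp : c ⤳ p.1 := hc.specializes (subset_closure ⟨p, hp, rfl⟩)
    rcases E.eq_or_eq_of_specializes hcE with h | h
    · exact (specializes_of_eq h.symm).trans hcp
    · exfalso
      have h1 : f.hom c ∈ closure {f.hom E.1} := by
        have h2 : c ∈ f.hom ⁻¹' closure {f.hom E.1} := by
          refine (isClosed_closure.preimage f.hom.continuous).closure_subset_iff.mpr ?_ hc.mem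
          rintro _ ⟨p, -, rfl⟩
          exact subset_closure p.2
        exact h2
      rw [h, f.map_genericPoint, ← specializes_iff_mem_closure] at h1
      exact hE (Specializes.antisymm h1 (genericPoint_specializes _)).eq
  have hdim := hf _ _ hC
  obtain ⟨r, y, hy, hr⟩ := f.exists_isTranscendenceBasis_le_topologicalKrullDim E.1
  let _ := X.stalkAlgebra E.1
  let _ := Z.stalkAlgebra (f.hom E.1)
  have := Z.essFiniteType_stalk (f.hom E.1)
  obtain ⟨n, x, hx⟩ := IsLocalRing.exists_isTranscendenceBasis_residue k
    (Z.X.presheaf.stalk (f.hom E.1))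
  obtain ⟨q, hq⟩ := IsDiscreteValuationRing.exists_irreducible (X.X.presheaf.stalk E.1)
  have hbasis : IsTranscendenceBasis k (IsLocalRing.residue (X.X.presheaf.stalk E.1) ∘
      Sum.elim y (f.stalkMapₐ E.1 ∘ x)) := by
    let _ : Algebra (IsLocalRing.ResidueField (Z.X.presheaf.stalk (f.hom E.1)))
        (IsLocalRing.ResidueField (X.X.presheaf.stalk E.1)) :=
      (IsLocalRing.ResidueField.map (f.hom.stalkMap E.1).hom).toAlgebra
    have : IsScalarTower k (IsLocalRing.ResidueField (Z.X.presheaf.stalk (f.hom E.1)))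
        (IsLocalRing.ResidueField (X.X.presheaf.stalk E.1)) :=
      IsScalarTower.of_algebraMap_eq fun c => by
        change IsLocalRing.residue _ (algebraMap k _ c) =
          IsLocalRing.residue _ (f.stalkMapₐ E.1 (algebraMap k _ c))
        rw [(f.stalkMapₐ E.1).commutes]
    convert! hx.sumElim_comp hy using 1
    funext i
    rcases i with i | i <;> rfl
  have hcard : Module.finrank X.K X.Der = r + n + 1 := by
    have := (E.isCoordAt_option hq hbasis).finrank_eq
    rw [this]
    simp
  have hZ := Z.le_topologicalKrullDim
  have hX := X.topologicalKrullDim_le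
  have hle : Module.finrank Z.K Z.Der ≤ n + 1 := by
    have h1 : ((r + Module.finrank Z.K Z.Der : ℕ) : WithBot ℕ∞) ≤ ((r + n + 1 : ℕ) : WithBot ℕ∞) := by
      rw [← hcard]
      push_cast
      exact (add_le_add hr hZ).trans (hdim.le.trans hX)
    have h2 : r + Module.finrank Z.K Z.Der ≤ r + n + 1 := by exact_mod_cast h1
    omega
  by_contra! hlt
  have h2 : ((2 : ℕ) : WithBot ℕ∞) ≤ ringKrullDim (Z.X.presheaf.stalk (f.hom E.1)) := by
    rw [ringKrullDim_stalk_eq_coheight]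
    have := Order.add_one_le_of_lt hlt
    rw [one_add_one_eq_two] at this
    exact WithBot.coe_le_coe.mpr this
  have : FinTrdeg k Z.K := by
    have := Z.essFiniteType_functionField
    infer_instance
  have := Z.isScalarTower_stalk (f.hom E.1)
  obtain ⟨N, z, hz⟩ := exists_isTranscendenceBasis_fin k Z.K
  have h3 := IsLocalRing.add_le_of_algebraicIndependent h2 hx.1 hz
  have h4 : Module.finrank Z.K Z.Der = _ := hz.finrank_derivation
  rw [Fintype.card_fin] at h4
  omega

end DominantMorphism

end NormalVariety

namespace NormalVariety

variable {k : Type u} [Field k] {X Z : NormalVariety k}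

/-! ### Local equations of prime divisors -/

/-- The rational function `t` is a local equation of the prime divisor `P` at `x`: it generates the
ideal of `P` in the local ring at `x`. -/
def IsEquationAt (P : X.PrimeDivisor) (x : X.X) (t : X.K) : Prop :=
  X.RegularAt x t ∧ X.VanishesAt P.1 t ∧
    ∀ φ, X.RegularAt x φ → X.VanishesAt P.1 φ → ∃ ψ, X.RegularAt x ψ ∧ φ = t * ψ

theorem algebraMap_stalkSpecializes {x y : X.X} (h : y ⤳ x) (a : X.X.presheaf.stalk x) :
    algebraMap _ X.K (X.X.presheaf.stalkSpecializes h a) = algebraMap _ X.K a := by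
  have := X.X.presheaf.stalkSpecializes_comp (genericPoint_specializes y) h
  exact congrArg (fun g => g.hom a) this

theorem comap_maximalIdeal_eq_span_singleton_iff {P : X.PrimeDivisor} {x : X.X} (h : P.1 ⤳ x)
    {t : X.X.presheaf.stalk x} :
    (IsLocalRing.maximalIdeal (X.X.presheaf.stalk P.1)).comap
        (X.X.presheaf.stalkSpecializes h).hom = Ideal.span {t} ↔
      X.IsEquationAt P x (algebraMap _ X.K t) := by
  have hmem : ∀ a, a ∈ (IsLocalRing.maximalIdeal (X.X.presheaf.stalk P.1)).comap
      (X.X.presheaf.stalkSpecializes h).hom ↔ X.VanishesAt P.1 (algebraMap _ X.K a) := by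
    intro a
    rw [← algebraMap_stalkSpecializes h, vanishesAt_algebraMap]
    rfl
  constructor
  · intro ht
    refine ⟨regularAt_algebraMap t, ?_, ?_⟩
    · rw [← hmem, ht]
      exact Ideal.mem_span_singleton_self t
    · rintro _ ⟨a, rfl⟩ ha
      rw [← hmem, ht, Ideal.mem_span_singleton] at ha
      obtain ⟨b, rfl⟩ := ha
      exact ⟨_, regularAt_algebraMap b, map_mul _ _ _⟩
  · rintro ⟨-, h1, h2⟩
    refine le_antisymm (fun a ha => ?_) ?_
    · obtain ⟨_, ⟨b, rfl⟩, hb⟩ := h2 _ (regularAt_algebraMap a) ((hmem a).mp ha)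
      rw [← map_mul] at hb
      rw [algebraMap_stalk_injective x hb, Ideal.mem_span_singleton]
      exact dvd_mul_right _ _
    · rw [Ideal.span_singleton_le_iff_mem, hmem]
      exact h1

theorem IsEquationAt.exists_mul_eq {P : X.PrimeDivisor} {x : X.X} {t : X.K}
    (ht : X.IsEquationAt P x t) (h : P.1 ⤳ x) : ∃ ψ b p, X.RegularAt P.1 ψ ∧ X.UnitAt P.1 b ∧
      X.IsUniformizerAt P p ∧ t * ψ = p * b := by
  obtain ⟨h1, h2, h3⟩ := ht
  obtain ⟨c, hc⟩ := X.exists_affineChart x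
  obtain ⟨p, hp⟩ := P.exists_isUniformizerAt
  obtain ⟨a, b, hb, hab⟩ := c.exists_eq_div (h.mem_open c.U.2 hc) hp.vanishesAt.regularAt
  have hap : c.toK a = p * c.toK b := by rw [hab, div_mul_cancel₀ _ hb.ne_zero]
  obtain ⟨ψ, hψ, hat⟩ := h3 _ (c.regularAt_toK hc a)
    (by rw [hap]; exact hp.vanishesAt.mul_right hb.regularAt)
  exact ⟨ψ, _, p, hψ.of_specializes h, hb, hp, by rw [← hat, hap]⟩

theorem IsEquationAt.ne_zero {P : X.PrimeDivisor} {x : X.X} {t : X.K}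
    (ht : X.IsEquationAt P x t) (h : P.1 ⤳ x) : t ≠ 0 := by
  obtain ⟨ψ, b, p, -, hb, hp, he⟩ := ht.exists_mul_eq h
  exact left_ne_zero_of_mul (he ▸ mul_ne_zero hp.ne_zero hb.ne_zero)

theorem IsEquationAt.ord_eq_one {P : X.PrimeDivisor} {x : X.X} {t : X.K}
    (ht : X.IsEquationAt P x t) (h : P.1 ⤳ x) : X.ord t P = 1 := by
  obtain ⟨ψ, b, p, hψ, hb, hp, he⟩ := ht.exists_mul_eq h
  have ht0 := ht.ne_zero h
  have hψ0 : ψ ≠ 0 := right_ne_zero_of_mul (he ▸ mul_ne_zero hp.ne_zero hb.ne_zero)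
  have h4 := (one_le_ord_iff ht0).mpr ht.2.1
  have h5 := (ord_nonneg_iff hψ0).mpr hψ
  have h6 := ord_mul P ht0 hψ0
  rw [he, ord_mul P hp.ne_zero hb.ne_zero, hp.ord_eq_one, hb.ord_eq_zero] at h6
  omega

theorem IsEquationAt.ord_eq_zero {P : X.PrimeDivisor} {x : X.X} {t : X.K}
    (ht : X.IsEquationAt P x t) (h : P.1 ⤳ x) {Q : X.PrimeDivisor} (hQ : Q.1 ⤳ x) (hQP : Q ≠ P) :
    X.ord t Q = 0 := by
  have ht0 := ht.ne_zero h
  obtain ⟨h1, h2, h3⟩ := ht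
  obtain ⟨c, hc⟩ := X.exists_affineChart x
  rw [ord_eq_zero_iff ht0]
  by_contra hnu
  have hvQ : X.VanishesAt Q.1 t := (h1.of_specializes hQ).vanishesAt_iff.mpr hnu
  obtain ⟨P', hP'⟩ := c.exists_point_eq (h.mem_open c.U.2 hc)
  obtain ⟨Q', hQ'⟩ := c.exists_point_eq (hQ.mem_open c.U.2 hc)
  have hsp : P.1 ⤳ Q.1 := by
    rw [← hP', ← hQ', c.point_specializes_iff]
    intro a ha
    rw [← c.vanishesAt_point_iff, hP'] at ha
    obtain ⟨ψ, hψ, hat⟩ := h3 _ (c.regularAt_toK hc a) ha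
    rw [← c.vanishesAt_point_iff, hQ', hat]
    exact hvQ.mul_right (hψ.of_specializes hQ)
  rcases Q.eq_or_eq_of_specializes hsp with h | h
  · exact hQP (Subtype.ext h.symm)
  · exact P.ne_genericPoint h

/-- A divisor whose components through `x` have local equations at `x` is Cartier at `x`. -/
theorem exists_isLocalEquation {D : X.RDivisor} {x : X.X}
    (hD : ∀ P : X.PrimeDivisor, D P ≠ 0 → P.1 ⤳ x → ∃ t, X.IsEquationAt P x t) :
    ∃ (m : ℕ) (r : Fin m → ℝ) (φ : Fin m → X.K), IsLocalEquation D x r φ := by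
  classical
  let S := D.support.filter fun P => P.1 ⤳ x
  have hS : ∀ P : S, P.1.1 ⤳ x := fun P => (Finset.mem_filter.mp P.2).2
  choose t ht using fun P : S =>
    hD P (Finsupp.mem_support_iff.mp (Finset.mem_filter.mp P.2).1) (hS P)
  let e := Finite.equivFin S
  refine ⟨_, fun i => D (e.symm i).1, fun i => t (e.symm i), fun i => (ht _).ne_zero (hS _), ?_⟩
  intro Q hQ
  rw [Equiv.sum_comp e.symm (fun P : S => D P.1 * (X.ord (t P) Q : ℝ))]
  by_cases hQS : Q ∈ S
  · rw [Finset.sum_eq_single ⟨Q, hQS⟩]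
    · rw [(ht ⟨Q, hQS⟩).ord_eq_one hQ]
      simp
    · intro P _ hP
      rw [(ht P).ord_eq_zero (hS P) hQ fun h => hP (Subtype.ext h.symm)]
      simp
    · simp
  · rw [Finset.sum_eq_zero]
    · by_contra h
      exact hQS (Finset.mem_filter.mpr ⟨Finsupp.mem_support_iff.mpr h, hQ⟩)
    · intro P _
      rw [(ht P).ord_eq_zero (hS P) hQ fun h => hQS (by rw [h]; exact P.2)]
      simp

theorem SNCAt.exists_isEquationAt {S : Z.RDivisor} {z : Z.X} (h : SNCAt S z) {P : Z.PrimeDivisor}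
    (hP : S P ≠ 0) (hz : P.1 ⤳ z) : ∃ t, Z.IsEquationAt P z t := by
  obtain ⟨n, t, -, -, ht⟩ := h
  obtain ⟨i, hi⟩ := ht P hP hz
  exact ⟨_, (comap_maximalIdeal_eq_span_singleton_iff hz).mp hi⟩

theorem IsLocalEquation.add {D D' : X.RDivisor} {x : X.X} {m m' : ℕ} {r : Fin m → ℝ}
    {φ : Fin m → X.K} {r' : Fin m' → ℝ} {φ' : Fin m' → X.K} (h : IsLocalEquation D x r φ)
    (h' : IsLocalEquation D' x r' φ') :
    IsLocalEquation (D + D') x (Fin.append r r') (Fin.append φ φ') := by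
  refine ⟨fun i => ?_, fun P hP => ?_⟩
  · induction i using Fin.addCases with
    | left i => rw [Fin.append_left]; exact h.1 i
    | right i => rw [Fin.append_right]; exact h'.1 i
  · rw [Fin.sum_univ_add, Finsupp.add_apply, h.2 P hP, h'.2 P hP]
    simp

theorem IsRCartierOn.add {U : X.X.Opens} {D D' : X.RDivisor} (h : IsRCartierOn U D)
    (h' : IsRCartierOn U D') : IsRCartierOn U (D + D') := by
  intro x hx
  obtain ⟨m, r, φ, h1⟩ := h x hx
  obtain ⟨m', r', φ', h2⟩ := h' x hx
  exact ⟨_, _, _, h1.add h2⟩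

theorem IsRCartierOn.neg {U : X.X.Opens} {D : X.RDivisor} (h : IsRCartierOn U D) :
    IsRCartierOn U (-D) := by
  intro x hx
  obtain ⟨m, r, φ, h1, h2⟩ := h x hx
  exact ⟨m, -r, φ, h1, fun P hP => by simp [h2 P hP]⟩

theorem IsRCartierOn.mono {U V : X.X.Opens} (hUV : U ≤ V) {D : X.RDivisor} (h : IsRCartierOn V D) :
    IsRCartierOn U D := fun x hx => h x (hUV hx)

/-! ### Existence of canonical divisors -/

/-- At a point with coordinates, the dual vector fields are a frame, at all its generizations. -/
theorem IsCoordAt.exists_frame {x : X.X} {ι : Type*} [Fintype ι] [DecidableEq ι] {u : ι → X.K}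
    (hu : X.IsCoordAt x u) : ∃ d : ι → X.Der, (∀ i j, d i (u j) = if i = j then 1 else 0) ∧
      ∀ y, y ⤳ x → X.IsFrameAt y ⊤ {D | X.DerRegularAt y D} d := by
  obtain ⟨h1, d, hd, hdr, hD⟩ := isCoordAt_iff.mp hu
  refine ⟨d, hd, fun y hy => ?_⟩
  have huy : X.IsCoordAt y u := hu.of_specializes hy
  obtain ⟨d', hd', hD', hf⟩ := huy.isFrameAt
  convert hf using 1
  funext i
  rw [hD' (d i)]
  simp [hd]

theorem IsFrameAt.ord_det_eq {V : Submodule X.K X.Der} {T : X.X → Set X.Der} {P : X.PrimeDivisor}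
    {ι : Type*} [Fintype ι] [DecidableEq ι] {b b' : ι → X.Der} (hb : X.IsFrameAt P.1 V (T P.1) b)
    (hb' : X.IsFrameAt P.1 V (T P.1) b') {w : ι → X.K}
    (hw : ∀ D ∈ V, (∀ i, D (w i) = 0) → D = 0) :
    X.ord (Matrix.det (.of fun i j => b i (w j))) P =
      X.ord (Matrix.det (.of fun i j => b' i (w j))) P := by
  let c : ι → V := fun i => ⟨b i, hb.mem_generic i⟩
  let c' : ι → V := fun i => ⟨b' i, hb'.mem_generic i⟩
  have hc : LinearIndependent X.K c := hb.linearIndependent.of_comp V.subtype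
  have hc' : LinearIndependent X.K c' := hb'.linearIndependent.of_comp V.subtype
  exact (IsFrameAt.isLeast (b := c) hb (wedge_ne_zero hw hc)).unique
    (IsFrameAt.isLeast (b := c') hb' (wedge_ne_zero hw hc'))

/-- A variety of characteristic zero has a canonical divisor, which is Cartier at every point that
has coordinates: the divisor of `dz₁ ∧ ⋯ ∧ dzₙ` for a transcendence basis `z`. -/
theorem exists_isCanonical [CharZero k] (X : NormalVariety k) : ∃ KX : X.RDivisor, IsCanonical KX ∧
    ∀ (x : X.X) (n : ℕ) (u : Fin n → X.K), X.IsCoordAt x u →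
      ∃ (m : ℕ) (r : Fin m → ℝ) (φ : Fin m → X.K), IsLocalEquation KX x r φ := by
  obtain ⟨g, hg⟩ : ∃ g, g = genericPoint X.X := ⟨_, rfl⟩
  obtain ⟨N, z, hz⟩ : ∃ (n : ℕ) (u : Fin n → X.K), X.IsCoordAt g u := by
    let _ := X.stalkAlgebra g
    have := X.essFiniteType_stalk g
    obtain ⟨n, x, hx⟩ := IsLocalRing.exists_isTranscendenceBasis_residue k (X.X.presheaf.stalk g)
    exact ⟨n, _, isCoordAt_genericPoint hg hx⟩
  have hN : Module.finrank X.K X.Der = Fintype.card (Fin N) := hz.finrank_eq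
  have hsep : ∀ D ∈ (⊤ : Submodule X.K X.Der), (∀ i, D (z i) = 0) → D = 0 := by
    intro D _ h
    obtain ⟨-, d, -, -, hsum⟩ := isCoordAt_iff.mp hz
    rw [hsum D]
    exact Finset.sum_eq_zero fun i _ => by rw [h, zero_smul]
  have hfr : ∀ P : X.PrimeDivisor, ∃ b : Fin N → X.Der,
      X.IsFrameAt P.1 ⊤ {D | X.DerRegularAt P.1 D} b := by
    intro P
    let _ := X.stalkAlgebra P.1
    have := X.essFiniteType_stalk P.1
    obtain ⟨n, x, hx⟩ := IsLocalRing.exists_isTranscendenceBasis_residue k (X.X.presheaf.stalk P.1)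
    obtain ⟨q, hq⟩ := IsDiscreteValuationRing.exists_irreducible (X.X.presheaf.stalk P.1)
    have h1 := P.isCoordAt_option hq hx
    obtain ⟨d, -, -, hd⟩ := h1.isFrameAt
    have hc : Fintype.card (Fin N) = Fintype.card (Option (Fin n)) := by
      rw [← hN]; exact h1.finrank_eq
    exact ⟨_, hd.comp_equiv (Fintype.equivOfCardEq hc)⟩
  choose b hb using hfr
  let δ : X.PrimeDivisor → ℝ := fun P => X.ord (Matrix.det (.of fun i j => b P i (z j))) P
  have hδ : ∀ (P : X.PrimeDivisor) (b' : Fin N → X.Der),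
      X.IsFrameAt P.1 ⊤ {D | X.DerRegularAt P.1 D} b' →
      δ P = X.ord (Matrix.det (.of fun i j => b' i (z j))) P := by
    intro P b' hb'
    simp only [δ]
    exact_mod_cast IsFrameAt.ord_det_eq (T := fun x => {D | X.DerRegularAt x D}) (hb P) hb' hsep
  have hsupp : (Function.support δ).Finite := by
    refine (X.finite_setOf_primeDivisor_notMem ⟨_, isOpen_setOf_isCoordAt z⟩ (hg ▸ hz)).subset ?_
    intro P hP hPz
    obtain ⟨d, hd, hdf⟩ := IsCoordAt.exists_frame (x := P.1) hPz
    refine hP ?_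
    rw [hδ P d (hdf _ specializes_rfl)]
    have : (Matrix.of fun i j => d i (z j)) = 1 := by
      ext i j
      rw [Matrix.of_apply, hd, Matrix.one_apply]
    rw [this, Matrix.det_one, ord_one, Int.cast_zero]
  refine ⟨Finsupp.ofSupportFinite δ hsupp, ?_, ?_⟩
  · refine isDetDualDivisor_of_frames (ι := Fin N) (by rw [finrank_top, hN]) hsep fun P => ?_
    exact ⟨b P, hb P, rfl⟩
  · intro x n u hu
    obtain rfl : N = n := by
      have := hu.finrank_eq
      rw [hN] at this
      simpa using this
    obtain ⟨d, hd, hdf⟩ := hu.exists_frame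
    refine ⟨1, fun _ => 1, fun _ => Matrix.det (.of fun i j => d i (z j)), fun _ => ?_, ?_⟩
    · have hli : LinearIndependent X.K fun i => (⟨d i, trivial⟩ : (⊤ : Submodule X.K X.Der)) :=
        (hdf x specializes_rfl).linearIndependent.of_comp (⊤ : Submodule X.K X.Der).subtype
      exact wedge_ne_zero hsep hli
    · intro P hP
      have h1 : (Finsupp.ofSupportFinite δ hsupp) P = δ P := rfl
      rw [h1, hδ P d (hdf _ hP)]
      simp

/-- A point at which a divisor with simple normal crossings is given is a regular point, and has
coordinates. -/
theorem SNCAt.exists_isCoordAt [CharZero k] {S : Z.RDivisor} {z : Z.X} (h : SNCAt S z) :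
    ∃ (n : ℕ) (u : Fin n → Z.K), Z.IsCoordAt z u := by
  obtain ⟨n, t, hn, ht, -⟩ := h
  let _ := Z.stalkAlgebra z
  have := Z.essFiniteType_stalk z
  obtain ⟨e, y, hy⟩ := IsLocalRing.exists_isTranscendenceBasis_residue k (Z.X.presheaf.stalk z)
  exact ⟨n + e, _, (isCoordAt_sumElim ht hn.le hy).comp_equiv finSumFinEquiv.symm⟩

end NormalVariety

namespace NormalVariety

variable {k : Type u} [Field k] {X Z : NormalVariety k}

/-! ### Normal crossings at general points of a divisor -/

/-- A local equation at the generic point of a prime divisor is a local equation near this point. -/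
theorem IsUniformizerAt.exists_isEquationAt {P : X.PrimeDivisor} {q : X.K}
    (hq : X.IsUniformizerAt P q) :
    ∃ W : X.X.Opens, P.1 ∈ W ∧ ∀ y ∈ W, P.1 ⤳ y → X.IsEquationAt P y q := by
  obtain ⟨c, hc⟩ := X.exists_affineChart P.1
  obtain ⟨P', hP'⟩ := c.exists_point_eq hc
  have : IsNoetherianRing Γ(X.X, c.U) := IsLocallyNoetherian.component_noetherian ⟨c.U, c.affine⟩
  obtain ⟨s, hs⟩ := IsNoetherian.noetherian P'.asIdeal
  have hvan : ∀ a, a ∈ P'.asIdeal ↔ X.VanishesAt P.1 (c.toK a) := fun a => by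
    rw [← hP', c.vanishesAt_point_iff]
  refine ⟨⟨c.U ∩ {y | X.RegularAt y q} ∩ ⋂ a ∈ s, {y | X.RegularAt y (c.toK a / q)},
    (c.U.2.inter (isOpen_setOf_regularAt _)).inter
      (s.finite_toSet.isOpen_biInter fun a _ => isOpen_setOf_regularAt _)⟩, ⟨⟨hc,
      hq.vanishesAt.regularAt⟩, ?_⟩, ?_⟩
  · simp only [Set.mem_iInter, Set.mem_ofPred_eq]
    intro a ha
    have haP : X.VanishesAt P.1 (c.toK a) := (hvan a).mp (hs ▸ Submodule.subset_span ha)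
    by_cases h0 : c.toK a = 0
    · rw [h0, zero_div]; exact regularAt_zero _
    · rw [← ord_nonneg_iff (div_ne_zero h0 hq.ne_zero), div_eq_mul_inv,
        ord_mul P h0 (inv_ne_zero hq.ne_zero), ord_inv, hq.ord_eq_one]
      have := (one_le_ord_iff h0).mpr haP
      omega
  · rintro y ⟨⟨hyc, hyq⟩, hys⟩ hPy
    simp only [Set.mem_iInter, Set.mem_ofPred_eq] at hys
    refine ⟨hyq, hq.vanishesAt, fun φ hφ hφP => ?_⟩
    have hdiv : ∀ a ∈ P'.asIdeal, X.RegularAt y (c.toK a / q) := by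
      intro a ha
      rw [← hs] at ha
      induction ha using Submodule.span_induction with
      | mem a ha => exact hys a ha
      | zero => rw [map_zero, zero_div]; exact regularAt_zero _
      | add a b _ _ ha hb => rw [map_add, add_div]; exact ha.add hb
      | smul r a _ ha =>
        rw [smul_eq_mul, map_mul, mul_div_assoc]
        exact (c.regularAt_toK hyc r).mul ha
    obtain ⟨a, b, hb, rfl⟩ := c.exists_eq_div hyc hφ
    have haP : a ∈ P'.asIdeal := by
      rw [hvan]
      have := hφP.mul_right (hb.regularAt.of_specializes hPy)
      rwa [div_mul_cancel₀ _ hb.ne_zero] at this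
    refine ⟨c.toK a / q * (c.toK b)⁻¹, (hdiv a haP).mul hb.inv.regularAt, ?_⟩
    have := hq.ne_zero
    have := hb.ne_zero
    field_simp

/-- A function with nonvanishing derivative is part of a regular system of parameters. -/
theorem SNCAt.add_single {S : Z.RDivisor} {y : Z.X} (h : SNCAt S y)
    (hS : ∀ Q : Z.PrimeDivisor, S Q ≠ 0 → ¬ Q.1 ⤳ y) {P : Z.PrimeDivisor} (hP : P.1 ⤳ y) {q : Z.K}
    (hq : Z.IsEquationAt P y q) {D : Z.Der} (hD : Z.DerRegularAt y D) (hDq : D q = 1) :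
    SNCAt (S + Finsupp.single P 1) y := by
  classical
  obtain ⟨n, t, hn, ht, -⟩ := h
  have hvq : Z.VanishesAt y q := hq.2.1.of_specializes hP hq.1
  obtain ⟨q₀, hq₀, rfl⟩ := hvq
  have htm : ∀ i, t i ∈ IsLocalRing.maximalIdeal (Z.X.presheaf.stalk y) := fun i =>
    ht ▸ Ideal.subset_span ⟨i, rfl⟩
  obtain ⟨c, hc⟩ := Ideal.mem_span_range_iff_exists_fun.mp (ht ▸ hq₀)
  obtain ⟨i, hi⟩ : ∃ i, IsUnit (c i) := by
    by_contra! hno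
    have hcm : ∀ i, c i ∈ IsLocalRing.maximalIdeal (Z.X.presheaf.stalk y) := hno
    choose c' hc' using fun i => hD _ (regularAt_algebraMap (c i))
    choose t' ht' using fun i => hD _ (regularAt_algebraMap (t i))
    have h1 : Z.VanishesAt y (1 : Z.K) := by
      refine ⟨∑ i, (c i * t' i + t i * c' i), Ideal.sum_mem _ fun i _ => Ideal.add_mem _
        (Ideal.mul_mem_right _ _ (hcm i)) (Ideal.mul_mem_right _ _ (htm i)), ?_⟩
      rw [← hDq, ← hc, map_sum, map_sum, map_sum]
      refine Finset.sum_congr rfl fun i _ => ?_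
      rw [map_mul, D.leibniz, map_add, map_mul, map_mul, hc', ht', smul_eq_mul, smul_eq_mul]
    exact (regularAt_one y).vanishesAt_iff.mp h1 (unitAt_one y)
  refine ⟨n, Function.update t i q₀, hn, le_antisymm ?_ ?_, ?_⟩
  · rw [Ideal.span_le]
    rintro _ ⟨j, rfl⟩
    by_cases hj : j = i
    · rw [hj, Function.update_self]; exact hq₀
    · rw [Function.update_of_ne hj]; exact htm j
  · set I := Ideal.span (Set.range (Function.update t i q₀))
    have hmem : ∀ j, j ≠ i → t j ∈ I := fun j hj =>
      Ideal.subset_span ⟨j, Function.update_of_ne hj _ _⟩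
    have hqI : q₀ ∈ I := Ideal.subset_span ⟨i, Function.update_self _ _ _⟩
    rw [← ht, Ideal.span_le]
    rintro _ ⟨j, rfl⟩
    by_cases hj : j = i
    · rw [hj]
      have h1 : c i * t i ∈ I := by
        have : c i * t i = q₀ - ∑ j ∈ Finset.univ.erase i, c j * t j := by
          rw [← hc, ← Finset.add_sum_erase _ _ (Finset.mem_univ i)]; ring
        rw [this]
        exact Ideal.sub_mem _ hqI (Ideal.sum_mem _ fun j hj =>
          Ideal.mul_mem_left _ _ (hmem j (Finset.ne_of_mem_erase hj)))
      obtain ⟨u, hu⟩ := hi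
      rw [← hu] at h1
      exact (Ideal.unit_mul_mem_iff_mem I u.isUnit).mp h1
    · exact hmem j hj
  · intro Q hQ hQy
    have hQP : Q = P := by
      by_contra hne
      rw [Finsupp.add_apply, Finsupp.single_eq_of_ne hne, add_zero] at hQ
      exact hS Q hQ hQy
    subst hQP
    refine ⟨i, ?_⟩
    rw [Function.update_self, comap_maximalIdeal_eq_span_singleton_iff]
    exact hq

theorem LogSmoothOn.of_le {S : Z.RDivisor} (h : LogSmoothOn S ⊤) (U : Z.X.Opens) :
    Smooth (U.ι ≫ Z.str) := by
  have h1 : Smooth ((⊤ : Z.X.Opens).ι ≫ Z.str) := h.1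
  have h2 : Smooth Z.str := by
    rw [← Category.id_comp Z.str, ← Scheme.toIso_inv_ι, Category.assoc]
    infer_instance
  infer_instance

/-- Adding a new prime divisor to a divisor with simple normal crossings, the result has
simple normal crossings near some closed point of the new prime divisor. -/
theorem LogSmoothOn.exists_add_single [CharZero k] {S : Z.RDivisor} (hS : LogSmoothOn S ⊤)
    {P : Z.PrimeDivisor} (hP : S P = 0) :
    ∃ z : Z.X, IsClosed {z} ∧ P.1 ⤳ z ∧
      ∃ U : Z.X.Opens, z ∈ U ∧ LogSmoothOn (S + Finsupp.single P 1) U := by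
  obtain ⟨q, hq, D, hD, hDq⟩ : ∃ q, Z.IsUniformizerAt P q ∧
      ∃ D, Z.DerRegularAt P.1 D ∧ D q = 1 := by
    let _ := Z.stalkAlgebra P.1
    have := Z.essFiniteType_stalk P.1
    obtain ⟨n, x, hx⟩ := IsLocalRing.exists_isTranscendenceBasis_residue k (Z.X.presheaf.stalk P.1)
    obtain ⟨q, hq⟩ := IsDiscreteValuationRing.exists_irreducible (Z.X.presheaf.stalk P.1)
    obtain ⟨-, d, hd, hdr, -⟩ := isCoordAt_iff.mp (P.isCoordAt_option hq hx)
    exact ⟨_, ⟨q, hq, rfl⟩, d none, hdr none, by simpa using hd none none⟩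
  obtain ⟨W, hPW, hW⟩ := hq.exists_isEquationAt
  let U : Z.X.Opens := ⟨W ∩ {y | Z.DerRegularAt y D} ∩ ⋂ Q ∈ S.support, (closure {Q.1})ᶜ,
    (W.2.inter (isOpen_setOf_derRegularAt D)).inter
      (S.support.finite_toSet.isOpen_biInter fun Q _ => isClosed_closure.isOpen_compl)⟩
  have hPU : P.1 ∈ U := by
    refine ⟨⟨hPW, hD⟩, ?_⟩
    simp only [Set.mem_iInter, Set.mem_compl_iff]
    intro Q hQ h
    rw [← specializes_iff_mem_closure] at h
    rcases P.eq_or_eq_of_specializes h with h | h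
    · rw [Subtype.ext h] at hQ
      exact (Finsupp.mem_support_iff.mp hQ) hP
    · exact Q.ne_genericPoint h
  have : JacobsonSpace Z.X := LocallyOfFiniteType.jacobsonSpace Z.str
  obtain ⟨z, ⟨hzU, hzP⟩, hz⟩ := nonempty_inter_closedPoints
    (Z := (U : Set Z.X) ∩ closure {P.1}) ⟨P.1, hPU, subset_closure rfl⟩
    (U.2.isLocallyClosed.inter isClosed_closure.isLocallyClosed)
  refine ⟨z, hz, specializes_iff_mem_closure.mpr hzP, U, hzU, hS.of_le U, fun y hy => ?_⟩
  by_cases hPy : P.1 ⤳ y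
  · refine (hS.2 y trivial).add_single (fun Q hQ hQy => ?_) hPy (hW y hy.1.1 hPy) hy.1.2 hDq
    have := hy.2
    simp only [Set.mem_iInter, Set.mem_compl_iff] at this
    exact this Q (Finsupp.mem_support_iff.mpr hQ) (specializes_iff_mem_closure.mp hQy)
  · obtain ⟨n, t, hn, ht, hc⟩ := hS.2 y trivial
    refine ⟨n, t, hn, ht, fun Q hQ hQy => hc Q ?_ hQy⟩
    have hQP : Q ≠ P := fun h => hPy (h ▸ hQy)
    rwa [Finsupp.add_apply, Finsupp.single_eq_of_ne hQP, add_zero] at hQ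

end NormalVariety

namespace NormalVariety

variable {k : Type u} [Field k] {X Z : NormalVariety k}

namespace DominantMorphism

variable {f : DominantMorphism X Z}

/-! ### Pullback of divisors -/

theorem IsPullbackCoeff.eq_zero {D : Z.RDivisor} {E : X.PrimeDivisor} {c : ℝ}
    (h : f.IsPullbackCoeff D E c) (hE : f.IsHorizontal E) : c = 0 := by
  obtain ⟨m, r, φ, hφ, rfl⟩ := h
  refine Finset.sum_eq_zero fun i _ => ?_
  rw [f.ord_pullback_of_isHorizontal hE (hφ.1 i), Int.cast_zero, mul_zero]

theorem IsPullbackCoeff.eq_mul {D : Z.RDivisor} {E : X.PrimeDivisor} {c : ℝ}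
    (h : f.IsPullbackCoeff D E c) {P : Z.PrimeDivisor} (hE : f.hom E.1 = P.1) :
    c = f.mult E P * D P := by
  obtain ⟨m, r, φ, hφ, rfl⟩ := h
  rw [hφ.2 P (specializes_of_eq hE.symm), Finset.mul_sum]
  refine Finset.sum_congr rfl fun i _ => ?_
  rw [f.ord_pullback_eq_mult_mul hE (hφ.1 i)]
  push_cast
  ring

/-- If vertical prime divisors lie over prime divisors, every divisor on the target has a
pullback to the source. -/
theorem exists_pullback (hf : ∀ E : X.PrimeDivisor, ¬ f.IsHorizontal E →
    Order.coheight (f.hom E.1) = 1) (D : Z.RDivisor) :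
    ∃ N : X.RDivisor, (∀ E, f.IsHorizontal E → N E = 0) ∧
      (∀ E (P : Z.PrimeDivisor), f.hom E.1 = P.1 → N E = f.mult E P * D P) ∧
      ∀ V : Z.X.Opens, IsRCartierOn V D → f.IsPullbackOver V D N := by
  classical
  let ν : X.PrimeDivisor → ℝ := fun E =>
    if h : f.IsHorizontal E then 0 else f.mult E ⟨_, hf E h⟩ * D ⟨_, hf E h⟩
  have hν : ∀ E (P : Z.PrimeDivisor), f.hom E.1 = P.1 → ν E = f.mult E P * D P := by
    rintro E ⟨z, hz⟩ h
    dsimp only at h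
    subst h
    have hE : ¬ f.IsHorizontal E := PrimeDivisor.ne_genericPoint (X := Z) ⟨_, hz⟩
    simp only [ν, dif_neg hE]
  have hν0 : ∀ E, f.IsHorizontal E → ν E = 0 := fun E h => by simp only [ν, dif_pos h]
  let U : Z.X.Opens := ⟨⋂ P ∈ D.support, (closure {P.1})ᶜ,
    D.support.finite_toSet.isOpen_biInter fun Q _ => isClosed_closure.isOpen_compl⟩
  have hU : genericPoint X.X ∈ f.hom ⁻¹ᵁ U := by
    change f.hom (genericPoint X.X) ∈ ⋂ P ∈ D.support, (closure {P.1})ᶜ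
    rw [f.map_genericPoint]
    simp only [Set.mem_iInter, Set.mem_compl_iff, ← specializes_iff_mem_closure]
    exact fun P _ h => P.ne_genericPoint (Specializes.antisymm h (genericPoint_specializes _)).eq
  have hfin : (Function.support ν).Finite := by
    refine (X.finite_setOf_primeDivisor_notMem _ hU).subset fun E hE hEU => hE ?_
    by_cases h : f.IsHorizontal E
    · exact hν0 E h
    · rw [hν E ⟨_, hf E h⟩ rfl]
      have hEU : f.hom E.1 ∈ ⋂ P ∈ D.support, (closure {P.1})ᶜ := hEU
      simp only [Set.mem_iInter, Set.mem_compl_iff] at hEU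
      have h0 : D ⟨_, hf E h⟩ = 0 := by
        by_contra hne
        exact hEU ⟨_, hf E h⟩ (Finsupp.mem_support_iff.mpr hne) (subset_closure rfl)
      rw [h0, mul_zero]
  refine ⟨Finsupp.ofSupportFinite ν hfin, hν0, hν, fun V hV => ⟨hV, fun E hE => ?_⟩⟩
  obtain ⟨m, r, φ, hφ⟩ := hV _ hE
  have hc : f.IsPullbackCoeff D E (∑ i, r i * (X.ord (f.pullback (φ i)) E : ℝ)) :=
    ⟨m, r, φ, hφ, rfl⟩
  convert hc using 1
  change ν E = _
  by_cases h : f.IsHorizontal E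
  · rw [hν0 E h, hc.eq_zero h]
  · rw [hν E ⟨_, hf E h⟩ rfl, hc.eq_mul (P := ⟨_, hf E h⟩) rfl]

theorem IsPullbackOver.mono {V W : Z.X.Opens} (hVW : V ≤ W) {D : Z.RDivisor} {N : X.RDivisor}
    (h : f.IsPullbackOver W D N) : f.IsPullbackOver V D N :=
  ⟨h.1.mono hVW, fun E hE => h.2 E (hVW hE)⟩

end DominantMorphism

/-! ### Log canonical pairs -/

theorem LcOn.mono {B : X.RDivisor} {U V : X.X.Opens} (hUV : U ≤ V) (h : LcOn B V) : LcOn B U := by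
  obtain ⟨KX, hKX, hC, h⟩ := h
  exact ⟨KX, hKX, hC.mono hUV, fun Y π hπ KY hKY hp E c hE => h Y π hπ KY hKY hp E c (hUV hE)⟩

/-- The identity of a variety. -/
def DominantMorphism.id (X : NormalVariety k) : DominantMorphism X X where
  hom := 𝟙 X.X
  comm := Category.id_comp _

theorem DominantMorphism.id_pullback (φ : X.K) : (DominantMorphism.id X).pullback φ = φ := by
  obtain ⟨c, hc⟩ := X.exists_affineChart (genericPoint X.X)
  obtain ⟨a, b, hb, rfl⟩ := c.exists_eq_div hc (regularAt_genericPoint φ)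
  have key : ∀ a, (DominantMorphism.id X).pullback (c.toK a) = c.toK a := by
    intro a
    rw [c.toK_eq hc]
    have h1 := (DominantMorphism.id X).pullback_algebraMap (genericPoint X.X)
      (X.X.presheaf.germ c.U (genericPoint X.X) hc a)
    refine h1.trans ?_
    congr 1
    exact congrArg (fun g => g.hom (X.X.presheaf.germ c.U (genericPoint X.X) hc a))
      (Scheme.Hom.stalkMap_id X.X (genericPoint X.X))
  rw [map_div₀, key, key]

/-- The coefficients of the boundary of a log canonical pair are at most one. -/
theorem LcOn.le_one {B : X.RDivisor} {U : X.X.Opens} (h : LcOn B U) {E : X.PrimeDivisor}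
    (hE : E.1 ∈ U) : B E ≤ 1 := by
  obtain ⟨KX, hKX, hC, h⟩ := h
  obtain ⟨m, r, φ, hφ⟩ := hC E.1 hE
  have hbir : (DominantMorphism.id X).IsProperBirational := by
    refine ⟨inferInstanceAs (IsProper (𝟙 X.X)), ?_⟩
    have : ⇑(DominantMorphism.id X).pullback = id := funext DominantMorphism.id_pullback
    rw [this]
    exact Function.bijective_id
  have := h X (DominantMorphism.id X) hbir KX hKX (fun E P hEP => by rw [Subtype.ext hEP]) E
    ((KX + B) E) hE ⟨m, r, φ, hφ, by
      rw [hφ.2 E specializes_rfl]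
      simp only [DominantMorphism.id_pullback]⟩
  rw [Finsupp.add_apply] at this
  linarith

namespace DominantMorphism

variable {f : DominantMorphism X Z}

/-! ### The discriminant of a pair with Property (*) -/

theorem exists_preimage_le [IsProper f.hom] {z : Z.X} {U : X.X.Opens}
    (h : f.hom ⁻¹' {z} ⊆ (U : Set X.X)) : ∃ V : Z.X.Opens, z ∈ V ∧ f.hom ⁻¹ᵁ V ≤ U := by
  have hcl : IsClosedMap f.hom := f.hom.isClosedMap
  refine ⟨⟨(f.hom '' (U : Set X.X)ᶜ)ᶜ, (hcl _ U.2.isClosed_compl).isOpen_compl⟩, ?_, ?_⟩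
  · rintro ⟨x, hx, rfl⟩
    exact hx (h rfl)
  · intro x hx
    by_contra hxU
    exact hx ⟨x, hxU, rfl⟩

theorem PropertyStarWith.boundary_eq {B : X.RDivisor} {SZ : Z.RDivisor}
    (h : f.PropertyStarWith B SZ) {E : X.PrimeDivisor} {P : Z.PrimeDivisor}
    (hE : f.hom E.1 = P.1) : B E = SZ P := by
  have hh : ¬ f.IsHorizontal E := fun h => P.ne_genericPoint (hE.symm.trans h)
  rw [h.vertical_part E hh]
  rcases h.reduced P with h0 | h1
  · rw [if_neg, h0]
    rintro ⟨Q, hQ, hQE⟩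
    rw [hE] at hQE
    rcases P.eq_or_eq_of_specializes hQE with h | h
    · rw [Subtype.ext h] at hQ
      exact hQ h0
    · exact Q.ne_genericPoint h
  · rw [if_pos, h1]
    exact ⟨P, by rw [h1]; exact one_ne_zero, specializes_of_eq hE.symm⟩

/-- The log canonical threshold along `P` of a pair with Property (*) is attained and is
`1 - SZ P`. At a closed point of `P` where `SZ + P` has simple normal crossings,
the pair remains log canonical after adding the fibre over `P`. -/
theorem PropertyStarWith.lcOverGeneric [CharZero k] {B : X.RDivisor} {SZ : Z.RDivisor}
    (h : f.PropertyStarWith B SZ)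
    (hf : ∀ E : X.PrimeDivisor, ¬ f.IsHorizontal E → Order.coheight (f.hom E.1) = 1)
    (P : Z.PrimeDivisor) : f.LcOverGeneric B P (1 - SZ P) := by
  have := h.glc.proper
  rcases h.reduced P with h0 | h1
  · obtain ⟨z, hz, hPz, U, hzU, hU⟩ := h.logSmooth.exists_add_single h0
    obtain ⟨N, hN, U', hzU', hlc⟩ := h.lc z hz (SZ + Finsupp.single P 1) (fun Q => by
        by_cases hQ : Q = P
        · right; rw [hQ, Finsupp.add_apply, h0, Finsupp.single_eq_same, zero_add]
        · rw [Finsupp.add_apply, Finsupp.single_eq_of_ne hQ, add_zero]; exact h.reduced Q)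
      (le_add_of_nonneg_right (Finsupp.single_nonneg.mpr zero_le_one)) ⟨U, hzU, hU⟩
    rw [add_sub_cancel_left] at hN
    obtain ⟨V, hzV, hV⟩ := exists_preimage_le hzU'
    refine ⟨V, N, hPz.mem_open V.2 hzV, hN.mono le_top, ?_⟩
    rw [h0, sub_zero, one_smul]
    exact hlc.mono hV
  · have hcar : IsRCartier (Finsupp.single P (1 : ℝ)) := by
      intro z _
      refine exists_isLocalEquation fun Q hQ hQz => ?_
      have hQP : Q = P := by
        by_contra hne
        exact hQ (Finsupp.single_eq_of_ne hne)
      refine (h.logSmooth.2 z trivial).exists_isEquationAt ?_ hQz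
      rw [hQP, h1]
      exact one_ne_zero
    obtain ⟨N', -, -, hN'⟩ := exists_pullback hf (Finsupp.single P (1 : ℝ))
    have : JacobsonSpace Z.X := LocallyOfFiniteType.jacobsonSpace Z.str
    obtain ⟨z, hzP, hz⟩ := nonempty_inter_closedPoints
      (Z := closure {P.1}) ⟨P.1, subset_closure rfl⟩ isClosed_closure.isLocallyClosed
    obtain ⟨N, hN, U', hzU', hlc⟩ := h.lc z hz SZ h.reduced le_rfl ⟨⊤, trivial, h.logSmooth⟩
    rw [sub_self] at hN
    have hN0 : N = 0 := by
      ext E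
      by_cases hE : f.IsHorizontal E
      · rw [(hN.2 E trivial).eq_zero hE]; rfl
      · rw [(hN.2 E trivial).eq_mul (P := ⟨_, hf E hE⟩) rfl]
        simp
    rw [hN0, add_zero] at hlc
    obtain ⟨V, hzV, hV⟩ := exists_preimage_le hzU'
    refine ⟨V, N', (specializes_iff_mem_closure.mpr hzP).mem_open V.2 hzV, (hN' ⊤ hcar).mono le_top,
      ?_⟩
    rw [h1, sub_self, zero_smul, add_zero]
    exact hlc.mono hV

theorem PropertyStarWith.add_mul_mult_le {B : X.RDivisor} {SZ : Z.RDivisor}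
    (h : f.PropertyStarWith B SZ) {E : X.PrimeDivisor} {P : Z.PrimeDivisor}
    (hE : f.hom E.1 = P.1) {t : ℝ} (ht : f.LcOverGeneric B P t) : SZ P + t * f.mult E P ≤ 1 := by
  obtain ⟨V, N, hPV, hN, hlc⟩ := ht
  have hEV : f.hom E.1 ∈ V := by rw [hE]; exact hPV
  have h1 := hlc.le_one (E := E) hEV
  rw [Finsupp.add_apply, Finsupp.smul_apply, smul_eq_mul, h.boundary_eq hE,
    (hN.2 E hEV).eq_mul hE, Finsupp.single_eq_same, mul_one] at h1
  exact h1

theorem PropertyStarWith.isDiscriminant_iff [CharZero k] {B : X.RDivisor} {SZ BZ : Z.RDivisor}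
    (h : f.PropertyStarWith B SZ)
    (hf : ∀ E : X.PrimeDivisor, ¬ f.IsHorizontal E → Order.coheight (f.hom E.1) = 1) :
    f.IsDiscriminant B BZ ↔ BZ = SZ := by
  have hlub : ∀ P, IsLUB {t : ℝ | f.LcOverGeneric B P t} (1 - SZ P) := by
    intro P
    refine IsGreatest.isLUB ⟨h.lcOverGeneric hf P, fun t ht => ?_⟩
    obtain ⟨E, hE⟩ := f.exists_primeDivisor_over h.glc.surjective P
    have h1 := h.add_mul_mult_le hE ht
    have h2 : (1 : ℝ) ≤ f.mult E P := by exact_mod_cast f.one_le_mult hE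
    rcases h.reduced P with h0 | h0
    · rw [h0] at h1 ⊢
      nlinarith
    · rw [h0] at h1 ⊢
      nlinarith
  constructor
  · intro hBZ
    ext P
    have := (hBZ P).2.unique (hlub P)
    linarith
  · rintro rfl P
    exact ⟨⟨_, h.lcOverGeneric hf P⟩, hlub P⟩

/-- The fibres over prime divisors outside `SZ` are reduced. -/
theorem PropertyStarWith.mult_eq_one [CharZero k] {B : X.RDivisor} {SZ : Z.RDivisor}
    (h : f.PropertyStarWith B SZ)
    (hf : ∀ E : X.PrimeDivisor, ¬ f.IsHorizontal E → Order.coheight (f.hom E.1) = 1)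
    {E : X.PrimeDivisor} {P : Z.PrimeDivisor} (hE : f.hom E.1 = P.1) (hP : SZ P = 0) :
    f.mult E P = 1 := by
  have h1 := h.add_mul_mult_le hE (h.lcOverGeneric hf P)
  rw [hP, zero_add, sub_zero, one_mul] at h1
  exact le_antisymm (by exact_mod_cast h1) (f.one_le_mult hE)

end DominantMorphism

end NormalVariety

namespace NormalVariety

variable {k : Type u} [Field k] {X Z : NormalVariety k}

theorem RLinEquiv.of_linEquiv {D D' : X.RDivisor} (h : LinEquiv D D') : RLinEquiv D D' := by
  obtain ⟨φ, hφ, h⟩ := h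
  exact ⟨1, fun _ => 1, fun _ => φ, fun _ => hφ, fun P => by simp [h]⟩

/-- If `N` is the pullback of `K_Z + S_Z`, then `K_F + Δ` is linearly equivalent to
`K_X + Δ + G - N`. Along a vertical prime divisor of multiplicity `m` over a prime divisor `P`
the difference is, up to a principal divisor, `(m - 1) (1 - S_Z(P))`, and fibres over prime divisors
with `S_Z(P) = 0` are reduced. -/
theorem DominantMorphism.PropertyStarWith.linEquiv [CharZero k] {f : DominantMorphism X Z}
    {F : Foliation X} (hF : F.IsInducedBy f) {Δ G : X.RDivisor} {SZ : Z.RDivisor}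
    (h : f.PropertyStarWith (Δ + G) SZ)
    (hf : ∀ E : X.PrimeDivisor, ¬ f.IsHorizontal E → Order.coheight (f.hom E.1) = 1)
    (hΔ : ∀ E : X.PrimeDivisor, Δ E ≠ 0 → f.IsHorizontal E)
    (hG : ∀ E : X.PrimeDivisor, G E ≠ 0 → ¬ f.IsHorizontal E)
    {KF KX N : X.RDivisor} {KZ : Z.RDivisor} (hKF : F.IsCanonical KF)
    (hKX : NormalVariety.IsCanonical KX) (hKZ : NormalVariety.IsCanonical KZ)
    (hN0 : ∀ E, f.IsHorizontal E → N E = 0)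
    (hN : ∀ E (P : Z.PrimeDivisor), f.hom E.1 = P.1 → N E = f.mult E P * (KZ + SZ) P) :
    LinEquiv (KF + Δ) (KX + (Δ + G) - N) := by
  obtain ⟨c, hc, hhor, hver⟩ := f.exists_canonical_eq hF hKF hKX hKZ
  refine ⟨c⁻¹, inv_ne_zero hc, fun E => ?_⟩
  rw [ord_inv]
  simp only [Finsupp.sub_apply, Finsupp.add_apply]
  push_cast
  by_cases hE : f.IsHorizontal E
  · have hGE : G E = 0 := by
      by_contra hne
      exact hG E hne hE
    rw [hhor E hE, hN0 E hE, hGE]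
    ring
  · let P : Z.PrimeDivisor := ⟨f.hom E.1, hf E hE⟩
    have hEP : f.hom E.1 = P.1 := rfl
    have hΔE : Δ E = 0 := by
      by_contra hne
      exact hE (hΔ E hne)
    have hB := h.boundary_eq hEP
    rw [Finsupp.add_apply, hΔE, zero_add] at hB
    rw [hver E P hEP, hN E P hEP, hΔE, hB, Finsupp.add_apply]
    rcases h.reduced P with h0 | h1
    · rw [h.mult_eq_one hf hEP h0, h0]
      push_cast
      ring
    · rw [h1]
      ring

end NormalVariety

end

open NormalVariety
theorem mainTheorem10 {k : Type u} [Field k] [IsAlgClosed k] [CharZero k]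
    (X Z : NormalVariety k) (f : DominantMorphism X Z) (F : Foliation X)
    (Δ G : X.RDivisor)
    (hpair : F.IsFoliatedPair Δ)
    (hstar : F.IsAssociated Δ f G)
    (hΔ : ∀ E : X.PrimeDivisor, Δ E ≠ 0 → f.IsHorizontal E)
    (heq : f.IsEquidimensional) :
    (∃ M : X.RDivisor, f.IsModuliPart (Δ + G) M) ∧
    (∀ KF M : X.RDivisor, F.IsCanonical KF → f.IsModuliPart (Δ + G) M →
      LinEquiv (KF + Δ) M) ∧
    (∀ KF KX : X.RDivisor, F.IsCanonical KF → NormalVariety.IsCanonical KX →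
      f.RLinEquivOver (KF + Δ) (KX + Δ + G)) := by
  obtain ⟨SZ, hSZ⟩ := hstar.propertyStar
  have hf : ∀ E : X.PrimeDivisor, ¬ f.IsHorizontal E → Order.coheight (f.hom E.1) = 1 :=
    fun E hE => heq.coheight_eq_one hE
  have hG : ∀ E : X.PrimeDivisor, G E ≠ 0 → ¬ f.IsHorizontal E :=
    fun E hE => hstar.induced.not_isHorizontal (hstar.invariant E hE)
  obtain ⟨KZ, hKZ, hKZC⟩ := exists_isCanonical Z
  have hcar : IsRCartier (KZ + SZ) := by
    refine IsRCartierOn.add (fun z _ => ?_) fun z _ => ?_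
    · obtain ⟨n, u, hu⟩ := (hSZ.logSmooth.2 z trivial).exists_isCoordAt
      exact hKZC z n u hu
    · exact exists_isLocalEquation fun P hP hPz =>
        (hSZ.logSmooth.2 z trivial).exists_isEquationAt hP hPz
  obtain ⟨N, hN0, hN, hNp⟩ := DominantMorphism.exists_pullback hf (KZ + SZ)
  refine ⟨?_, ?_, ?_⟩
  · obtain ⟨KX, hKX, -⟩ := hSZ.glc.logPair
    exact ⟨_, KX, KZ, SZ, N, hKX, hKZ, (hSZ.isDiscriminant_iff hf).mpr rfl, hNp ⊤ hcar, rfl⟩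
  · rintro KF _ hKF ⟨KX, KZ', BZ, N', hKX, hKZ', hBZ, hN', rfl⟩
    rw [hSZ.isDiscriminant_iff hf] at hBZ
    subst hBZ
    exact hSZ.linEquiv hstar.induced hf hΔ hG hKF hKX hKZ'
      (fun E hE => (hN'.2 E trivial).eq_zero hE) fun E P hE => (hN'.2 E trivial).eq_mul hE
  · intro KF KX hKF hKX
    obtain ⟨N', hN0', hN', hNp'⟩ := DominantMorphism.exists_pullback hf (-(KZ + SZ))
    refine ⟨-(KZ + SZ), N', hNp' ⊤ hcar.neg, RLinEquiv.of_linEquiv ?_⟩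
    have hneg : N' = -N := by
      ext E
      by_cases hE : f.IsHorizontal E
      · rw [Finsupp.neg_apply, hN0' E hE, hN0 E hE, neg_zero]
      · rw [Finsupp.neg_apply, hN' E ⟨_, hf E hE⟩ rfl, hN E ⟨_, hf E hE⟩ rfl, Finsupp.neg_apply,
          mul_neg]
    rw [hneg, ← sub_eq_add_neg, add_assoc KX]
    exact hSZ.linEquiv hstar.induced hf hΔ hG hKF hKX hKZ hN0 hN
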